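/- Let $V$ be a nonzero finite-dimensional vector space over a perfect field $F$, and let $G\subseteq \mathrm{GL}_V$ be a reductive algebraic subgroup (smooth, with trivial unipotent radical over $\overline F$, not necessarily connected). Assume that there is a decomposition $V=\bigoplus_{i=1}^n V_i$ of the representation $V$ of $G$ into isotypic components, i.e. each $V_i$ is a nonzero $G$-invariant subspace isomorphic to $M_i^{n_i}$ for an irreducible representation $M_i$ of $G$, and the $M_i$ are pairwise nonisomorphic. For $I\subseteq\{1,\dots,n\}$ put $V_I:=\bigoplus_{i\in I}V_i$. For a subspace $W\subseteq V$ let $G_W$ be the algebraic subgroup (a closed subgroup scheme, possibly non-reduced) of $G$ that fixes $W$ pointwise, and set $$\alpha(G):=\min_{0\neq W\subseteq V}\frac{\dim G-\dim G_W}{\dim W}.$$ Let $\mathfrak g\subseteq\mathfrak{gl}(V)$ be the Lie algebra of $G$, for a subspace $W\subseteq V$ let $\mathfrak g_W:=\{X\in\mathfrak g: Xw=0 \text{ for all } w\in W\}$, and set $$\alpha(\mathfrak g):=\min_{0\neq W\subseteq V}\frac{\dim \mathfrak g-\dim \mathfrak g_W}{\dim W}.$$ Assume that $G_{V_I}$ is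 smooth for all nonempty subsets $I\subseteq\{1,\dots,n\}$; this always holds when $F$ has characteristic $0$. Then: (i) $\alpha(G)=\alpha(\mathfrak g)$. (ii) $\displaystyle \alpha(G)=\min_{\emptyset\neq I\subseteq\{1,\dots,n\}}\frac{\dim G-\dim G_{V_I}}{\dim V_I}$. (iii) $\alpha(G_L)=\alpha(G)$ for all field extensions $L/F$, where $\alpha(G_L)$ is defined through the embedding $G_L\subseteq\mathrm{GL}_{V\otimes_F L}$. -/

import Mathlib

open scoped TensorProduct

universe u v w t

noncomputable section

attribute [local instance] LieRing.ofAssociativeRing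

/-- A representation on the `k`-vector space `M` of the affine group scheme `G = Spec A` over `k`,
where `A` is a commutative Hopf algebra over `k`: a right comodule structure `M → M ⊗ A`.
A point `g : A →ₐ[k] B` of `G` acts on `m` by `m ↦ (id ⊗ g) (coact m)`; coassociativity and
counitality say that this is a left action, functorially in `B`. -/
structure AlgRep (k : Type u) (A : Type w) (M : Type v) [Field k] [CommRing A] [HopfAlgebra k A]
    [AddCommGroup M] [Module k M] where
  /-- the coaction -/
  coact : M →ₗ[k] M ⊗[k] A
  coassoc : (TensorProduct.assoc k M A A).toLinearMap ∘ₗ coact.rTensor A ∘ₗ coact =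
    (Coalgebra.comul (R := k) (A := A)).lTensor M ∘ₗ coact
  counit : (TensorProduct.rid k M).toLinearMap ∘ₗ
    (Coalgebra.counit (R := k) (A := A)).lTensor M ∘ₗ coact = LinearMap.id

/-- The dimension of the affine scheme `Spec R`, as a natural number: the Krull dimension of `R`
(which is finite for a nonzero algebra of finite type over a field). -/
def affineDim (R : Type w) [CommRing R] : ℕ := ((ringKrullDim R).unbotD 0).toNat

namespace AlgRep

section Basic

variable {k : Type u} {A : Type w} {M : Type v} [Field k] [CommRing A] [HopfAlgebra k A]
  [AddCommGroup M] [Module k M]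

/-- The base change of the representation `M` of `G` to the representation `L ⊗ M` of `G_L`,
for a field extension `L / k`. -/
def baseChange (L : Type t) [Field L] [Algebra k L] (ρ : AlgRep k A M) :
    AlgRep L (L ⊗[k] A) (L ⊗[k] M) where
  coact := (TensorProduct.AlgebraTensorModule.distribBaseChange k L M A).toLinearMap ∘ₗ
    ρ.coact.baseChange L
  coassoc := by
    let Φ : L ⊗[k] (M ⊗[k] (A ⊗[k] A)) →ₗ[L]
        (L ⊗[k] M) ⊗[L] ((L ⊗[k] A) ⊗[L] (L ⊗[k] A)) :=
      (TensorProduct.AlgebraTensorModule.distribBaseChange k L A A).toLinearMap.lTensor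
        (L ⊗[k] M) ∘ₗ
      (TensorProduct.AlgebraTensorModule.distribBaseChange k L M (A ⊗[k] A)).toLinearMap
    have h1 : ∀ y : M ⊗[k] A, Φ (1 ⊗ₜ (TensorProduct.assoc k M A A (ρ.coact.rTensor A y))) =
        TensorProduct.assoc L (L ⊗[k] M) (L ⊗[k] A) (L ⊗[k] A)
          (((TensorProduct.AlgebraTensorModule.distribBaseChange k L M A).toLinearMap ∘ₗ
            ρ.coact.baseChange L).rTensor (L ⊗[k] A)
            (TensorProduct.AlgebraTensorModule.distribBaseChange k L M A (1 ⊗ₜ y))) := by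
      intro y
      induction y with
      | zero => simp
      | add x y hx hy => simp only [map_add, TensorProduct.tmul_add, hx, hy]
      | tmul m a =>
        simp only [LinearMap.rTensor_tmul,
          TensorProduct.AlgebraTensorModule.distribBaseChange_tmul, LinearMap.coe_comp,
          Function.comp_apply, LinearMap.baseChange_tmul, LinearEquiv.coe_coe]
        generalize ρ.coact m = z
        induction z with
        | zero => simp
        | add x y hx hy => simp only [map_add, TensorProduct.tmul_add, TensorProduct.add_tmul, hx, hy]
        | tmul m' a' => simp [Φ]
    have h2 : ∀ y : M ⊗[k] A,
        Φ (1 ⊗ₜ ((Coalgebra.comul (R := k) (A := A)).lTensor M y)) =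
        (Coalgebra.comul (R := L) (A := L ⊗[k] A)).lTensor (L ⊗[k] M)
            (TensorProduct.AlgebraTensorModule.distribBaseChange k L M A (1 ⊗ₜ y)) := by
      intro y
      induction y with
      | zero => simp
      | add x y hx hy => simp only [map_add, TensorProduct.tmul_add, hx, hy]
      | tmul m a =>
        simp only [LinearMap.lTensor_tmul,
          TensorProduct.AlgebraTensorModule.distribBaseChange_tmul, TensorProduct.comul_tmul]
        generalize Coalgebra.comul (R := k) a = z
        induction z with
        | zero => simp
        | add x y hx hy => simp only [map_add, TensorProduct.tmul_add, hx, hy]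
        | tmul m' a' => simp [Φ]
    ext m
    have h := LinearMap.congr_fun ρ.coassoc m
    simp only [LinearMap.coe_comp, Function.comp_apply, LinearEquiv.coe_coe] at h
    have h3 := h1 (ρ.coact m)
    rw [h, h2] at h3
    simpa using h3.symm
  counit := by
    have h1 : ∀ y : M ⊗[k] A, TensorProduct.rid L (L ⊗[k] M)
        ((Coalgebra.counit (R := L) (A := L ⊗[k] A)).lTensor (L ⊗[k] M)
          (TensorProduct.AlgebraTensorModule.distribBaseChange k L M A (1 ⊗ₜ y))) =
        1 ⊗ₜ (TensorProduct.rid k M ((Coalgebra.counit (R := k) (A := A)).lTensor M y)) := by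
      intro y
      induction y with
      | zero => simp
      | add x y hx hy => simp only [map_add, TensorProduct.tmul_add, hx, hy]
      | tmul m a =>
        simp only [TensorProduct.AlgebraTensorModule.distribBaseChange_tmul,
          LinearMap.lTensor_tmul, TensorProduct.counit_tmul, TensorProduct.rid_tmul,
          TensorProduct.tmul_smul, CommSemiring.counit_apply]
        rw [← algebraMap_smul L (Coalgebra.counit (R := k) a), map_smul, TensorProduct.rid_tmul,
          one_smul, algebraMap_smul]
    ext m
    have h := LinearMap.congr_fun ρ.counit m
    simp only [LinearMap.coe_comp, Function.comp_apply, LinearEquiv.coe_coe, LinearMap.id_coe,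
      id_eq] at h
    have h3 := h1 (ρ.coact m)
    rw [h] at h3
    simpa using h3

/-- For a linear form `D` on the coordinate ring, the endomorphism `m ↦ (id ⊗ D) (coact m)` of `M`.
If `D` is a `k`-point of `G`, this is the action of that point. -/
def contract (ρ : AlgRep k A M) (D : A →ₗ[k] k) : Module.End k M :=
  (TensorProduct.rid k M).toLinearMap ∘ₗ D.lTensor M ∘ₗ ρ.coact

/-- The matrix coefficient of `m` and `φ`: the function `g ↦ φ (g • m)` on `G`. -/
def coeff (ρ : AlgRep k A M) (m : M) (φ : Module.Dual k M) : A :=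
  TensorProduct.lid k A (φ.rTensor A (ρ.coact m))

/-- The homomorphism `G → GL_M` is a closed immersion, i.e. it makes `G` an algebraic subgroup
of `GL_M`: the coordinate ring of `G` is generated by the matrix coefficients
of `g` and of `g⁻¹` on `M`. -/
def IsClosedEmbedding (ρ : AlgRep k A M) : Prop :=
  Algebra.adjoin k ({a : A | ∃ m φ, a = ρ.coeff m φ} ∪
    {a : A | ∃ m φ, a = HopfAlgebra.antipode k (ρ.coeff m φ)}) = ⊤

/-- The ideal that defines the pointwise stabilizer `G_W` in `G`: it is generated by the functions
`g ↦ φ (g • w - w)` for `w ∈ W` and linear forms `φ`. Thus `A ⧸ ρ.fixIdeal W` is the coordinate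
ring of the closed subgroup scheme `G_W` with
`G_W(B) = {g ∈ G(B) | g w = w for all w ∈ B ⊗ W}`. -/
def fixIdeal (ρ : AlgRep k A M) (W : Submodule k M) : Ideal A :=
  Ideal.span {a : A | ∃ w ∈ W, ∃ φ : Module.Dual k M, a = ρ.coeff w φ - algebraMap k A (φ w)}

/-- `(dim G - dim G_W) / dim W`. -/
def slope (ρ : AlgRep k A M) (W : Submodule k M) : ℝ :=
  ((affineDim A : ℝ) - (affineDim (A ⧸ ρ.fixIdeal W) : ℝ)) / (Module.finrank k W : ℝ)

/-- `α(G) = min_{W ≠ 0} (dim G - dim G_W) / dim W`. (For `G` an algebraic subgroup of `GL_M` with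
`M` nonzero and finite-dimensional there are finitely many values, so that the infimum is
a minimum.) -/
def alpha (ρ : AlgRep k A M) : ℝ :=
  ⨅ W : {W : Submodule k M // W ≠ ⊥}, ρ.slope W.1

/-- A `k`-linear map between representations of `G` that commutes with the action of `G`. -/
def IsEquivariant {N : Type*} [AddCommGroup N] [Module k N] (τ : AlgRep k A N)
    (ρ : AlgRep k A M) (f : N →ₗ[k] M) : Prop :=
  f.rTensor A ∘ₗ τ.coact = ρ.coact ∘ₗ f

/-- The subspace `W` is stable under `G`: the coaction maps `W` into `W ⊗ A`. -/
def IsStable (ρ : AlgRep k A M) (W : Submodule k M) : Prop :=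
  ∀ x ∈ W, ρ.coact x ∈ LinearMap.range (W.subtype.rTensor A)

/-- The representation is irreducible. -/
def IsIrreducible (ρ : AlgRep k A M) : Prop :=
  Nontrivial M ∧ ∀ W : Submodule k M, ρ.IsStable W → W = ⊥ ∨ W = ⊤

/-- `M = ⨁ Vᵢ` is the decomposition of the representation `M` into isotypic components:
`Vᵢ ≠ 0` is a stable subspace isomorphic to `Mᵢ ^ mᵢ` (through the equivariant map `e`) with `Mᵢ`
irreducible, and the `Mᵢ` are pairwise nonisomorphic. -/
def IsIsotypicDecomposition (ρ : AlgRep k A M) {n : ℕ} (Vi : Fin n → Submodule k M) : Prop :=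
  DirectSum.IsInternal Vi ∧ (∀ i, Vi i ≠ ⊥) ∧ (∀ i, ρ.IsStable (Vi i)) ∧
  ∃ (N : Fin n → Type v) (_ : ∀ i, AddCommGroup (N i)) (_ : ∀ i, Module k (N i))
    (τ : ∀ i, AlgRep k A (N i)),
    (∀ i, (τ i).IsIrreducible) ∧
    (∀ i j, i ≠ j → ¬ ∃ f : N i ≃ₗ[k] N j, IsEquivariant (τ i) (τ j) f.toLinearMap) ∧
    ∀ i, ∃ (m : ℕ) (e : (Fin m → N i) →ₗ[k] M),
      Function.Injective e ∧ LinearMap.range e = Vi i ∧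
      ∀ j : Fin m, IsEquivariant (τ i) ρ (e ∘ₗ LinearMap.single k (fun _ : Fin m => N i) j)

/-- A tangent vector of `G` at the identity: a linear form `D` on the coordinate ring with
`D (a b) = ε(a) D(b) + D(a) ε(b)`, where `ε` is the counit. Equivalently `ε + D·δ` is a point of
`G` with values in the dual numbers `k[δ]`, `δ² = 0`. -/
def IsTangent (D : A →ₗ[k] k) : Prop :=
  ∀ a b : A, D (a * b) = Coalgebra.counit (R := k) a * D b + D a * Coalgebra.counit (R := k) b

theorem contract_mul (ρ : AlgRep k A M) (D E : A →ₗ[k] k) :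
    ρ.contract D * ρ.contract E =
      ρ.contract (LinearMap.mul' k k ∘ₗ TensorProduct.map D E ∘ₗ Coalgebra.comul) := by
  have h1 : ∀ y : M ⊗[k] A, TensorProduct.rid k M ((LinearMap.mul' k k ∘ₗ
      TensorProduct.map D E).lTensor M (TensorProduct.assoc k M A A (ρ.coact.rTensor A y))) =
      ρ.contract D (TensorProduct.rid k M (E.lTensor M y)) := by
    intro y
    induction y with
    | zero => simp
    | add x y hx hy => simp only [map_add, hx, hy]
    | tmul m a =>
      simp only [LinearMap.rTensor_tmul, LinearMap.lTensor_tmul, TensorProduct.rid_tmul, map_smul,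
        contract, LinearMap.coe_comp, Function.comp_apply, LinearEquiv.coe_coe]
      generalize ρ.coact m = z
      induction z with
      | zero => simp
      | add x y hx hy => simp only [map_add, TensorProduct.add_tmul, smul_add, hx, hy]
      | tmul m' a' => simp [mul_smul, smul_comm (D a') (E a) m']
  ext m
  have h := LinearMap.congr_fun ρ.coassoc m
  simp only [LinearMap.coe_comp, Function.comp_apply, LinearEquiv.coe_coe] at h
  have h2 := h1 (ρ.coact m)
  rw [h, ← LinearMap.comp_apply (LinearMap.lTensor M _), ← LinearMap.lTensor_comp] at h2
  exact h2.symm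

theorem IsTangent.bracket {D E : A →ₗ[k] k} (hD : IsTangent D) (hE : IsTangent E) :
    IsTangent (LinearMap.mul' k k ∘ₗ TensorProduct.map D E ∘ₗ Coalgebra.comul -
      LinearMap.mul' k k ∘ₗ TensorProduct.map E D ∘ₗ Coalgebra.comul) := by
  have h1 : ∀ {D E : A →ₗ[k] k}, IsTangent D → IsTangent E → ∀ a b : A,
      LinearMap.mul' k k (TensorProduct.map D E (Coalgebra.comul (R := k) (a * b))) =
      Coalgebra.counit (R := k) a *
        LinearMap.mul' k k (TensorProduct.map D E (Coalgebra.comul (R := k) b)) +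
      LinearMap.mul' k k (TensorProduct.map D E (Coalgebra.comul (R := k) a)) *
        Coalgebra.counit (R := k) b + D a * E b + E a * D b := by
    intro D E hD hE a b
    have e0 : ∀ (D E : A →ₗ[k] k) (x : A ⊗[k] A), LinearMap.mul' k k (TensorProduct.map D E x) =
        D (TensorProduct.rid k A (E.lTensor A x)) ∧
        LinearMap.mul' k k (TensorProduct.map D E x) =
        E (TensorProduct.lid k A (D.rTensor A x)) := by
      intro D E x
      induction x with
      | zero => simp
      | add x y hx hy =>
        simp only [map_add]
        exact ⟨by rw [hx.1, hy.1], by rw [hx.2, hy.2]⟩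
      | tmul x y => simp [mul_comm]
    have e1 : ∀ (D : A →ₗ[k] k) (a : A), LinearMap.mul' k k (TensorProduct.map D
        (Coalgebra.counit (R := k) (A := A)) (Coalgebra.comul (R := k) a)) = D a := by
      intro D a
      rw [(e0 _ _ _).1, Coalgebra.lTensor_counit_comul]
      simp
    have e2 : ∀ (D : A →ₗ[k] k) (a : A), LinearMap.mul' k k (TensorProduct.map
        (Coalgebra.counit (R := k) (A := A)) D (Coalgebra.comul (R := k) a)) = D a := by
      intro D a
      rw [(e0 _ _ _).2, Coalgebra.rTensor_counit_comul]
      simp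
    have e3 : ∀ x y : A ⊗[k] A, LinearMap.mul' k k (TensorProduct.map D E (x * y)) =
        LinearMap.mul' k k (TensorProduct.map Coalgebra.counit Coalgebra.counit x) *
          LinearMap.mul' k k (TensorProduct.map D E y) +
        LinearMap.mul' k k (TensorProduct.map D E x) *
          LinearMap.mul' k k (TensorProduct.map Coalgebra.counit Coalgebra.counit y) +
        LinearMap.mul' k k (TensorProduct.map D Coalgebra.counit x) *
          LinearMap.mul' k k (TensorProduct.map Coalgebra.counit E y) +
        LinearMap.mul' k k (TensorProduct.map Coalgebra.counit E x) *
          LinearMap.mul' k k (TensorProduct.map D Coalgebra.counit y) := by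
      intro x y
      induction x with
      | zero => simp
      | add x x' hx hx' => simp only [add_mul, map_add, hx, hx']; ring
      | tmul a b =>
        induction y with
        | zero => simp
        | add x x' hx hx' => simp only [mul_add, map_add, hx, hx']; ring
        | tmul c d =>
          simp only [Algebra.TensorProduct.tmul_mul_tmul, TensorProduct.map_tmul,
            LinearMap.mul'_apply, hD a c, hE b d]
          ring
    rw [Bialgebra.comul_mul, e3]
    simp only [e1, e2]
  intro a b
  simp only [LinearMap.sub_apply, LinearMap.coe_comp, Function.comp_apply, h1 hD hE, h1 hE hD]
  ring

/-- The Lie algebra of `G ⊆ GL_M`, as a Lie subalgebra of `gl(M)`: the endomorphisms through which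
the tangent vectors of `G` at the identity act on `M`, i.e. the `X` such that `1 + δ X` is the
action on `k[δ] ⊗ M` of a `k[δ]`-point of `G` above the identity, `δ² = 0`. -/
def lieAlgebra (ρ : AlgRep k A M) : LieSubalgebra k (Module.End k M) where
  carrier := {X | ∃ D : A →ₗ[k] k, IsTangent D ∧ X = ρ.contract D}
  add_mem' := by
    rintro _ _ ⟨D, hD, rfl⟩ ⟨E, hE, rfl⟩
    refine ⟨D + E, fun a b => ?_, ?_⟩
    · simp only [LinearMap.add_apply, hD a b, hE a b]; ring
    · simp [contract, LinearMap.lTensor_add, LinearMap.add_comp, LinearMap.comp_add]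
  zero_mem' := ⟨0, fun a b => by simp, by simp [contract]⟩
  smul_mem' := by
    rintro c _ ⟨D, hD, rfl⟩
    refine ⟨c • D, fun a b => ?_, ?_⟩
    · simp only [LinearMap.smul_apply, hD a b, smul_eq_mul]; ring
    · simp [contract, LinearMap.lTensor_smul, LinearMap.smul_comp, LinearMap.comp_smul]
  lie_mem' := by
    rintro _ _ ⟨D, hD, rfl⟩ ⟨E, hE, rfl⟩
    refine ⟨_, hD.bracket hE, ?_⟩
    rw [Ring.lie_def, contract_mul, contract_mul]
    simp [contract, LinearMap.lTensor_sub, LinearMap.sub_comp, LinearMap.comp_sub]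

end Basic

end AlgRep

section Lie

variable {k : Type u} {M : Type v} [Field k] [AddCommGroup M] [Module k M]

/-- `𝔤_W`, the subalgebra of those `X ∈ 𝔤` with `X w = 0` for all `w ∈ W`. -/
def lieFix (g : LieSubalgebra k (Module.End k M)) (W : Submodule k M) :
    LieSubalgebra k (Module.End k M) where
  carrier := {X | X ∈ g ∧ ∀ x ∈ W, X x = 0}
  add_mem' := fun ha hb => ⟨add_mem ha.1 hb.1, fun x hx => by simp [ha.2 x hx, hb.2 x hx]⟩
  zero_mem' := ⟨zero_mem g, fun x _ => by simp⟩
  smul_mem' := fun c _ ha => ⟨g.smul_mem c ha.1, fun x hx => by simp [ha.2 x hx]⟩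
  lie_mem' := fun ha hb => ⟨g.lie_mem ha.1 hb.1, fun x hx => by
    simp [Ring.lie_def, ha.2 x hx, hb.2 x hx]⟩

/-- `α(𝔤, W) = (dim 𝔤 - dim 𝔤_W) / dim W`. -/
def lieSlope (g : LieSubalgebra k (Module.End k M)) (W : Submodule k M) : ℝ :=
  ((Module.finrank k g : ℝ) - (Module.finrank k (lieFix g W) : ℝ)) / (Module.finrank k W : ℝ)

/-- `α(𝔤) = min_{W ≠ 0} α(𝔤, W)`. (There are finitely many values if `M` is nonzero and
finite-dimensional, so that the infimum is a minimum.) -/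
def lieAlpha (g : LieSubalgebra k (Module.End k M)) : ℝ :=
  ⨅ W : {W : Submodule k M // W ≠ ⊥}, lieSlope g W.1

end Lie

section Reductive

/-- The closed subscheme `H` of `G = Spec A` that the ideal `I` defines is a normal subgroup scheme:
for every `k`-algebra `B`, the set `H(B)` of the points `g : A →ₐ[k] B` that vanish on `I` is a
normal subgroup of the group `G(B)`, whose law is convolution. -/
def IsNormalSubgroupIdeal (k : Type u) {A : Type w} [Field k] [CommRing A] [HopfAlgebra k A]
    (I : Ideal A) : Prop :=
  ∀ (B : Type w) [CommRing B] [Algebra k B],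
    let H : Set (WithConv (A →ₐ[k] B)) := {h | ∀ a ∈ I, h.ofConv a = 0}
    1 ∈ H ∧ (∀ h ∈ H, ∀ h' ∈ H, h * h' ∈ H) ∧ (∀ h ∈ H, ∀ h', h * h' = 1 → h' ∈ H) ∧
      ∀ g g', g * g' = 1 → ∀ h ∈ H, g * h * g' ∈ H

/-- The algebraic group `G ⊆ GL_M` over an algebraically closed field `K` has trivial unipotent
radical: every smooth connected normal closed subgroup scheme whose elements are all
unipotent is trivial. -/
def AlgRep.HasTrivialUnipotentRadical {K : Type u} {A : Type w} {M : Type v} [Field K]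
    [CommRing A] [HopfAlgebra K A] [AddCommGroup M] [Module K M] (ρ : AlgRep K A M) : Prop :=
  ∀ I : Ideal A, IsNormalSubgroupIdeal K I → Algebra.Smooth K (A ⧸ I) →
    ConnectedSpace (PrimeSpectrum (A ⧸ I)) →
    (∀ g : A →ₐ[K] K, (∀ a ∈ I, g a = 0) →
      IsNilpotent (ρ.contract g.toLinearMap - 1 : Module.End K M)) →
    I = RingHom.ker (Bialgebra.counitAlgHom K A)

/-- The algebraic group `G ⊆ GL_M` is reductive (not necessarily connected): it is smooth, and its
unipotent radical over an algebraic closure of the base field is trivial. -/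
def AlgRep.IsReductive {k : Type u} {A : Type w} {M : Type v} [Field k] [CommRing A]
    [HopfAlgebra k A] [AddCommGroup M] [Module k M] (ρ : AlgRep k A M) : Prop :=
  Algebra.Smooth k A ∧ (ρ.baseChange (AlgebraicClosure k)).HasTrivialUnipotentRadical

end Reductive

end

/-! The slope is minimized first on the Lie algebra side, where it is linear algebra. Choose local
coordinates `x` at the identity with dual tangent vectors `D`; the `D l` act on `V` through
matrices, and `annCoeff` of `W` is the Lie algebra of `G_W` in these coordinates. This makes sense
for subspaces over every field extension.

The function `W ↦ dim 𝔤_W` is supermodular. Hence, over the algebraic closure `Ω`, a subspace of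
minimal slope and, among those, of largest dimension contains every subspace of the same dimension
whose annihilator is at least as large (`exists_maximal_of_minimal_slope`). It is therefore stable
under the Galois group, so it descends to `F` because `F` is perfect. It is also stable under
`G(Ω)`, which normalizes the Lie algebra (`conj_tangentMatrix_mem`), and so it is a
subrepresentation because `G` is smooth. A tangent vector that kills a subrepresentation kills every
isotypic component into which it projects nontrivially (`exists_le_iSup`). So the subspace may be
enlarged to some `V_I` without raising its slope.

A subspace over any extension `L` specializes to one over `Ω` of the same dimension with an
annihilator at least as large (`exists_specialization`). Thus `V_I` bounds the Lie slopes over all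
`L`.

Passing to groups uses `dim H ≤ dim Lie H`, with equality for smooth `H`. For smooth `G` the group
slope is at least the Lie slope, and the two agree at `V_I` because `G_{V_I}` is smooth. All three
conclusions follow. The inequality comes from Krull's height theorem and translation by points. The
equality comes from quasi-regular coordinates and the growth of `A / m ^ N`. In characteristic zero,
invariant derivations give quasi-regularity, hence Cartier's theorem. -/

noncomputable section

attribute [local instance] LieRing.ofAssociativeRing

/-! ### Linear algebra: dimensions under field extension, minimal slopes, Galois descent. -/

section LinearAlgebra

open Module

/-- A subspace of `K^m` of dimension `s` contains `s` vectors that are in duality with `s` vectors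
of `K^m` under the dot product. -/
theorem exists_dotProduct_dual {K : Type*} [Field K] {m : Type*} [Fintype m]
    (U : Submodule K (m → K)) :
    ∃ B C : Fin (finrank K U) → m → K, (∀ i, B i ∈ U) ∧
      ∀ i j, B i ⬝ᵥ C j = if i = j then 1 else 0 := by
  classical
  let b := finBasis K U
  have h : ∀ j, ∃ φ : (m → K) →ₗ[K] K, φ ∘ₗ U.subtype = b.coord j :=
    fun j => LinearMap.exists_extend (b.coord j)
  choose φ hφ using h
  -- `B` is a basis of `U`. Each extended coordinate form is the dot product with its vector of
  -- values on the standard basis, and this vector is `C j`.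
  refine ⟨fun i => b i, fun j x => φ j (Pi.single x 1), fun i => (b i).2, fun i j => ?_⟩
  have h1 : φ j (b i) = b.coord j (b i) := LinearMap.congr_fun (hφ j) (b i)
  rw [Basis.coord_apply, Basis.repr_self, Finsupp.single_apply] at h1
  rw [← h1, ← LinearMap.sum_single_apply (fun _ : m => K) ((b i : U) : m → K), map_sum, dotProduct]
  refine Finset.sum_congr rfl fun x _ => ?_
  have h2 : (Pi.single x ((b i : m → K) x) : m → K) = ((b i : m → K) x) • Pi.single x 1 := by
    ext y; simp [Pi.single_apply]
  simp [h2]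

/-- Pairing a linear relation with `C j` isolates its `j`-th coefficient. A dual pair thus certifies
a lower bound for a dimension by polynomial identities, which survive every ring homomorphism, in
particular a specialization. -/
theorem le_finrank_of_dotProduct_dual {K : Type*} [Field K] {m : Type*} [Fintype m]
    (U : Submodule K (m → K)) {s : ℕ} (B C : Fin s → m → K) (hB : ∀ i, B i ∈ U)
    (hBC : ∀ i j, B i ⬝ᵥ C j = if i = j then 1 else 0) : s ≤ finrank K U := by
  have h : LinearIndependent K (fun i => (⟨B i, hB i⟩ : U)) := by
    rw [Fintype.linearIndependent_iff]
    intro g hg j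
    have h1 : ∑ i, g i • B i = 0 := by
      have := congrArg U.subtype hg
      simpa using this
    have h2 : (∑ i, g i • B i) ⬝ᵥ C j = g j := by
      simp [sum_dotProduct, hBC]
    rw [← h2, h1, zero_dotProduct]
  simpa using h.fintype_card_le_finrank

/-- If a homomorphism of fields maps the subspace `U` of `K^m` into the subspace `U'` of `K'^m`,
then `dim U ≤ dim U'`. -/
theorem finrank_le_of_map_mem {K K' : Type*} [Field K] [Field K'] {m : Type*} [Fintype m]
    (f : K →+* K') (U : Submodule K (m → K)) (U' : Submodule K' (m → K'))
    (h : ∀ u ∈ U, (fun x => f (u x)) ∈ U') : finrank K U ≤ finrank K' U' := by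
  obtain ⟨B, C, hB, hBC⟩ := exists_dotProduct_dual U
  refine le_finrank_of_dotProduct_dual U' (fun i x => f (B i x)) (fun i x => f (C i x))
    (fun i => h _ (hB i)) fun i j => ?_
  have := congrArg f (hBC i j)
  simp only [dotProduct, map_sum, map_mul] at this ⊢
  rw [this]; split_ifs <;> simp

/-- Existence of a canonical subspace `W₁` of minimal slope `(dim E' - dim (a W)) / dim W`, for an
antitone `a` that turns sums into intersections. -/
theorem exists_maximal_of_minimal_slope {K E E' : Type*} [Field K] [AddCommGroup E] [Module K E]
    [FiniteDimensional K E] [Nontrivial E] [AddCommGroup E'] [Module K E'] [FiniteDimensional K E']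
    (a : Submodule K E → Submodule K E') (hanti : Antitone a)
    (hsup : ∀ W W', a W ⊓ a W' ≤ a (W ⊔ W')) :
    ∃ W₁ : Submodule K E, W₁ ≠ ⊥ ∧
      (∀ W : Submodule K E, W ≠ ⊥ → ((finrank K E' : ℤ) - finrank K (a W₁)) * finrank K W ≤
        ((finrank K E' : ℤ) - finrank K (a W)) * finrank K W₁) ∧
      ∀ W' : Submodule K E, finrank K W' = finrank K W₁ → finrank K (a W₁) ≤ finrank K (a W') → W' ≤ W₁ := by
  let T : Set (ℕ × ℕ) := {p | ∃ W : Submodule K E, W ≠ ⊥ ∧ p = (finrank K (a W), finrank K W)}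
  have hTfin : T.Finite := by
    refine ((Set.finite_Iic (finrank K E')).prod (Set.finite_Iic (finrank K E))).subset ?_
    rintro _ ⟨W, -, rfl⟩
    exact ⟨Submodule.finrank_le _, Submodule.finrank_le _⟩
  have hTne : T.Nonempty := ⟨_, ⊤, top_ne_bot, rfl⟩
  -- Only finitely many pairs of dimensions occur, so a minimum exists. The lexicographic order
  -- takes the least slope first and breaks ties by the largest dimension.
  obtain ⟨_, ⟨W₁, hW₁, rfl⟩, hmin⟩ := Set.exists_min_image T
    (fun p => toLex ((((finrank K E' : ℚ) - p.1) / p.2 : ℚ), (-(p.2 : ℤ)))) hTfin hTne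
  have hpos : ∀ W : Submodule K E, W ≠ ⊥ → 0 < finrank K W := fun W hW =>
    Nat.pos_of_ne_zero fun h => hW (Submodule.finrank_eq_zero.mp h)
  have hp1 : (0 : ℚ) < finrank K W₁ := by exact_mod_cast hpos W₁ hW₁
  have key : ∀ W : Submodule K E, W ≠ ⊥ → ((finrank K E' : ℤ) - finrank K (a W₁)) * finrank K W ≤
        ((finrank K E' : ℤ) - finrank K (a W)) * finrank K W₁ := by
    intro W hW
    have hp : (0 : ℚ) < finrank K W := by exact_mod_cast hpos W hW
    have h := hmin _ ⟨W, hW, rfl⟩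
    rw [Prod.Lex.toLex_le_toLex'] at h
    have h1 := h.1
    simp only at h1
    rw [div_le_div_iff₀ hp1 hp] at h1
    exact_mod_cast h1
  refine ⟨W₁, hW₁, key, fun W' hdim hle => ?_⟩
  -- The case `⊥` is needed because `W₁ ⊓ W'` may be zero.
  have key' : ∀ W : Submodule K E, ((finrank K E' : ℤ) - finrank K (a W₁)) * finrank K W ≤
        ((finrank K E' : ℤ) - finrank K (a W)) * finrank K W₁ := by
    intro W
    by_cases hW : W = ⊥
    · subst hW
      have : finrank K (a ⊥) ≤ finrank K E' := Submodule.finrank_le _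
      simp only [finrank_bot, Nat.cast_zero, mul_zero]
      exact mul_nonneg (by omega) (by positivity)
    · exact key W hW
  -- Supermodularity: `a W₁ ⊓ a W'` lies in `a (W₁ ⊔ W')`, and `a W₁ ⊔ a W'` lies in `a (W₁ ⊓ W')`.
  have hsub : finrank K (a W₁) + finrank K (a W') ≤
      finrank K (a (W₁ ⊔ W')) + finrank K (a (W₁ ⊓ W')) := by
    rw [← Submodule.finrank_sup_add_finrank_inf_eq (a W₁) (a W')]
    have h1 := Submodule.finrank_mono (hsup W₁ W')
    have h2 : finrank K ↥(a W₁ ⊔ a W') ≤ finrank K (a (W₁ ⊓ W')) :=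
      Submodule.finrank_mono (sup_le (hanti inf_le_left) (hanti inf_le_right))
    omega
  have hdims := Submodule.finrank_sup_add_finrank_inf_eq W₁ W'
  have hU := key' (W₁ ⊔ W')
  have hN := key' (W₁ ⊓ W')
  have hUne : W₁ ⊔ W' ≠ ⊥ := fun h => hW₁ (by rw [eq_bot_iff, ← h]; exact le_sup_left)
  -- Supermodularity and the bound for `W₁ ⊓ W'` leave `W₁ ⊔ W'` no room for a slope above the
  -- minimum. The tie-break then forces `W₁ ⊔ W' = W₁`.
  have hUeq : ((finrank K E' : ℤ) - finrank K (a (W₁ ⊔ W'))) * finrank K W₁ =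
      ((finrank K E' : ℤ) - finrank K (a W₁)) * finrank K ↥(W₁ ⊔ W') := by
    refine le_antisymm ?_ hU
    have e1 : (finrank K ↥(W₁ ⊔ W') : ℤ) = 2 * finrank K W₁ - finrank K ↥(W₁ ⊓ W') := by omega
    have e2 : (2 : ℤ) * finrank K (a W₁) ≤
        finrank K (a (W₁ ⊔ W')) + finrank K (a (W₁ ⊓ W')) := by omega
    have e3 : (0 : ℤ) ≤ finrank K W₁ := by positivity
    rw [e1]
    nlinarith [mul_le_mul_of_nonneg_right e2 e3]
  have h := hmin _ ⟨W₁ ⊔ W', hUne, rfl⟩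
  rw [Prod.Lex.toLex_le_toLex'] at h
  have hpU : (0 : ℚ) < finrank K ↥(W₁ ⊔ W') := by exact_mod_cast hpos _ hUne
  have h2 := h.2 (by
    simp only
    rw [div_eq_div_iff hp1.ne' hpU.ne']
    exact_mod_cast hUeq.symm)
  have h3 : finrank K ↥(W₁ ⊔ W') ≤ finrank K W₁ := by
    simp only at h2; omega
  rw [Submodule.eq_of_le_of_finrank_le (le_sup_left : W₁ ≤ W₁ ⊔ W') h3]
  exact le_sup_right

variable {F : Type*} [Field F] {ι κ : Type*} [Fintype ι] [Fintype κ]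

/-- The coefficient vectors `c` for which `∑ cᵢ Xᵢ` vanishes on `W`, for matrices `Xᵢ` over `F` and
a subspace `W` over the field extension `K`. -/
def annCoeff {K : Type*} [Field K] [Algebra F K] (X : κ → Matrix ι ι F)
    (W : Submodule K (ι → K)) : Submodule K (κ → K) where
  carrier := {c | ∀ w ∈ W, (∑ i, c i • (X i).map (algebraMap F K)).mulVec w = 0}
  add_mem' := fun {a b} ha hb w hw => by
    simp [add_smul, Finset.sum_add_distrib, Matrix.add_mulVec, ha w hw, hb w hw]
  zero_mem' := fun w _ => by simp
  smul_mem' := fun s c hc w hw => by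
    have : ∑ i, (s • c) i • (X i).map (algebraMap F K) =
        s • ∑ i, c i • (X i).map (algebraMap F K) := by
      simp [Finset.smul_sum, mul_smul]
    rw [this, Matrix.smul_mulVec, hc w hw, smul_zero]

theorem mem_annCoeff {K : Type*} [Field K] [Algebra F K] {X : κ → Matrix ι ι F}
    {W : Submodule K (ι → K)} {c : κ → K} : c ∈ annCoeff X W ↔
      ∀ w ∈ W, (∑ i, c i • (X i).map (algebraMap F K)).mulVec w = 0 := Iff.rfl

theorem annCoeff_antitone {K : Type*} [Field K] [Algebra F K] (X : κ → Matrix ι ι F) :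
    Antitone (annCoeff (K := K) X) := fun _ _ h _ hc w hw => hc w (h hw)

theorem annCoeff_inf_le {K : Type*} [Field K] [Algebra F K] (X : κ → Matrix ι ι F)
    (W W' : Submodule K (ι → K)) : annCoeff X W ⊓ annCoeff X W' ≤ annCoeff X (W ⊔ W') := by
  rintro c ⟨h1, h2⟩ w hw
  obtain ⟨x, hx, y, hy, rfl⟩ := Submodule.mem_sup.mp hw
  rw [Matrix.mulVec_add, h1 x hx, h2 y hy, add_zero]

/-- The entries of `(∑ cᵢ Xᵢ) w`. -/
theorem sum_smul_map_mulVec_apply {R : Type*} [CommRing R] [Algebra F R] (X : κ → Matrix ι ι F)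
    (c : κ → R) (w : ι → R) (x : ι) :
    (∑ i, c i • (X i).map (algebraMap F R)).mulVec w x =
      ∑ y, (∑ i, c i * algebraMap F R (X i x y)) * w y := by
  simp [Matrix.mulVec, dotProduct, Matrix.sum_apply]

/-- The extension to `K` of a subspace of `F^ι`. -/
def extendScalars (K : Type*) [Field K] [Algebra F K] (W : Submodule F (ι → F)) :
    Submodule K (ι → K) := Submodule.span K ((fun w x => algebraMap F K (w x)) '' (W : Set (ι → F)))

omit [Fintype ι] in
theorem mem_extendScalars {K : Type*} [Field K] [Algebra F K] {W : Submodule F (ι → F)}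
    {w : ι → F} (hw : w ∈ W) : (fun x => algebraMap F K (w x)) ∈ extendScalars K W :=
  Submodule.subset_span ⟨w, hw, rfl⟩

theorem mem_annCoeff_extendScalars {K : Type*} [Field K] [Algebra F K] {X : κ → Matrix ι ι F}
    {W : Submodule F (ι → F)} {c : κ → K} : c ∈ annCoeff X (extendScalars K W) ↔
      ∀ w ∈ W, (∑ i, c i • (X i).map (algebraMap F K)).mulVec (fun x => algebraMap F K (w x)) = 0 := by
  refine ⟨fun h w hw => h _ (mem_extendScalars hw), fun h w hw => ?_⟩
  induction hw using Submodule.span_induction with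
  | mem x hx => obtain ⟨w, hw, rfl⟩ := hx; exact h w hw
  | zero => simp
  | add x y _ _ hx hy => rw [Matrix.mulVec_add, hx, hy, add_zero]
  | smul a x _ hx => rw [Matrix.mulVec_smul, hx, smul_zero]

theorem finrank_annCoeff_extendScalars_ge (K : Type*) [Field K] [Algebra F K]
    (X : κ → Matrix ι ι F) (W : Submodule F (ι → F)) :
    finrank F (annCoeff X W) ≤ finrank K (annCoeff X (extendScalars K W)) := by
  refine finrank_le_of_map_mem (algebraMap F K) _ _ fun c hc => ?_
  rw [mem_annCoeff_extendScalars]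
  intro w hw
  have h := hc w hw
  ext x
  have h1 := congrArg (algebraMap F K) (congrFun h x)
  rw [sum_smul_map_mulVec_apply] at h1 ⊢
  simpa using h1

theorem finrank_extendScalars_ge (K : Type*) [Field K] [Algebra F K] (W : Submodule F (ι → F)) :
    finrank F W ≤ finrank K (extendScalars K W) :=
  finrank_le_of_map_mem (algebraMap F K) _ _ fun _ hc => mem_extendScalars hc

/-- A subspace of `K^m` all of whose `F`-linear projections lie in `U` is at most as large
as `U`. -/
theorem finrank_le_of_forall_dual {K : Type*} [Field K] [Algebra F K] {m : Type*} [Fintype m]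
    (U : Submodule F (m → F)) (U' : Submodule K (m → K))
    (h : ∀ u ∈ U', ∀ l : K →ₗ[F] F, (fun x => l (u x)) ∈ U) : finrank K U' ≤ finrank F U := by
  have hle : U' ≤ Submodule.span K (Set.range fun (i : Fin (finrank F U)) (x : m) =>
      algebraMap F K ((finBasis F U i : m → F) x)) := by
    classical
    intro u hu
    let b := Basis.ofVectorSpace F K
    -- Finitely many basis elements of `K` over `F` occur in the coordinates of `u`. Grouping by
    -- them writes `u` as a `K`-combination of its `F`-linear projections, which lie in `U`.
    let S : Finset (Basis.ofVectorSpaceIndex F K) := Finset.univ.biUnion fun x : m => (b.repr (u x)).support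
    have hu' : u = ∑ j ∈ S, b j • (fun x => algebraMap F K (b.coord j (u x))) := by
      ext x
      conv_lhs => rw [← b.linearCombination_repr (u x)]
      rw [Finsupp.linearCombination_apply, Finsupp.sum_of_support_subset (s := S)]
      · simp [Algebra.smul_def, mul_comm]
      · exact Finset.subset_biUnion_of_mem (fun x : m => (b.repr (u x)).support) (Finset.mem_univ x)
      · simp
    rw [hu']
    refine Submodule.sum_mem _ fun j _ => Submodule.smul_mem _ _ ?_
    have h1 := h u hu (b.coord j)
    have h2 := (finBasis F U).sum_repr ⟨_, h1⟩
    have h3 : (fun x => algebraMap F K (b.coord j (u x))) =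
        ∑ i, algebraMap F K ((finBasis F U).repr ⟨_, h1⟩ i) •
          (fun x => algebraMap F K ((finBasis F U i : m → F) x)) := by
      ext x
      have h4 := congrArg (fun v : U => algebraMap F K ((v : m → F) x)) h2
      simp only [AddSubmonoidClass.coe_finsetSum, SetLike.val_smul, Finset.sum_apply,
        Pi.smul_apply, smul_eq_mul, map_sum, map_mul] at h4
      simpa [-algebraMap_smul, smul_eq_mul, Algebra.smul_def] using h4.symm
    rw [h3]
    exact Submodule.sum_mem _ fun i _ => Submodule.smul_mem _ _ (Submodule.subset_span ⟨i, rfl⟩)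
  refine (Submodule.finrank_mono hle).trans ((finrank_range_le_card _).trans ?_)
  simp

/-- The equations that define the annihilator of `extendScalars K W` have coefficients in `F`, so
applying an `F`-linear form to the coordinates of a solution gives a solution over `F`. -/
theorem finrank_annCoeff_extendScalars_le (K : Type*) [Field K] [Algebra F K]
    (X : κ → Matrix ι ι F) (W : Submodule F (ι → F)) :
    finrank K (annCoeff X (extendScalars K W)) ≤ finrank F (annCoeff X W) := by
  refine finrank_le_of_forall_dual _ _ fun c hc l => ?_
  rw [mem_annCoeff_extendScalars] at hc
  intro w hw
  ext x
  have h1 := congrArg l (congrFun (hc w hw) x)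
  rw [sum_smul_map_mulVec_apply] at h1
  simp only [Pi.zero_apply, map_zero, Finset.sum_mul, map_sum] at h1
  rw [sum_smul_map_mulVec_apply]
  simp only [Finset.sum_mul]
  refine Eq.trans ?_ h1
  refine Finset.sum_congr rfl fun y _ => Finset.sum_congr rfl fun i _ => ?_
  have h2 : c i * algebraMap F K (X i x y) * algebraMap F K (w y) = (X i x y * w y) • c i := by
    rw [Algebra.smul_def, map_mul]; ring
  rw [h2, map_smul, smul_eq_mul, Algebra.algebraMap_self_apply]
  ring

theorem finrank_extendScalars (K : Type*) [Field K] [Algebra F K] (W : Submodule F (ι → F)) :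
    finrank K (extendScalars K W) = finrank F W := by
  refine le_antisymm (finrank_le_of_forall_dual _ _ fun u hu l => ?_)
    (finrank_extendScalars_ge K W)
  induction hu using Submodule.span_induction generalizing l with
  | mem x hx =>
    obtain ⟨w, hw, rfl⟩ := hx
    have : (fun x => l (algebraMap F K (w x))) = l 1 • w := by
      ext x
      rw [← mul_one (algebraMap F K (w x)), ← Algebra.smul_def, map_smul]
      simp [mul_comm]
    simpa only [this] using W.smul_mem _ hw
  | zero => simp only [Pi.zero_apply, map_zero]; exact W.zero_mem
  | add x y _ _ hx hy => simpa using! W.add_mem (hx l) (hy l)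
  -- A scalar of `K` is absorbed into the form; this is why the induction runs over all `l`.
  | smul a x _ hx => exact hx (l ∘ₗ LinearMap.mulLeft F a)

theorem finrank_annCoeff_extendScalars (K : Type*) [Field K] [Algebra F K]
    (X : κ → Matrix ι ι F) (W : Submodule F (ι → F)) :
    finrank K (annCoeff X (extendScalars K W)) = finrank F (annCoeff X W) :=
  le_antisymm (finrank_annCoeff_extendScalars_le K X W) (finrank_annCoeff_extendScalars_ge K X W)

theorem exists_min_card_image {α β : Type*} (T : Set α) (h : T.Nonempty) (f : α → Finset β) :
    ∃ a ∈ T, ∀ b ∈ T, (f a).card ≤ (f b).card := by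
  obtain ⟨a, ha, hm⟩ := (measure fun a => (f a).card).wf.has_min T h
  exact ⟨a, ha, fun b hb => not_lt.mp (hm b hb)⟩

/-- **Galois descent** for subspaces of `Ω^ι`. -/
theorem eq_extendScalars_of_forall_algEquiv {Ω : Type*} [Field Ω] [Algebra F Ω] [IsGalois F Ω]
    (W : Submodule Ω (ι → Ω)) (hW : ∀ σ : Ω ≃ₐ[F] Ω, ∀ w ∈ W, (fun x => σ (w x)) ∈ W) :
    ∃ W₀ : Submodule F (ι → F), W = extendScalars Ω W₀ := by
  classical
  let W₀ : Submodule F (ι → F) :=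
    { carrier := {w | (fun x => algebraMap F Ω (w x)) ∈ W}
      add_mem' := fun {a b} ha hb => by simpa using! W.add_mem ha hb
      zero_mem' := by
        simp only [Set.mem_ofPred_eq, Pi.zero_apply, map_zero]; exact W.zero_mem
      smul_mem' := fun c w hw => by
        simp only [Set.mem_ofPred_eq, Pi.smul_apply, smul_eq_mul, map_mul]
        exact W.smul_mem (algebraMap F Ω c) hw }
  refine ⟨W₀, le_antisymm ?_ (Submodule.span_le.mpr ?_)⟩
  swap
  · rintro _ ⟨w, hw, rfl⟩
    exact hw
  let supp : (ι → Ω) → Finset ι := fun w => Finset.univ.filter fun x => w x ≠ 0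
  have main : ∀ (n : ℕ) (w : ι → Ω), w ∈ W → (supp w).card = n → w ∈ extendScalars Ω W₀ := by
    intro n
    induction n using Nat.strong_induction_on with
    | _ n ih =>
      intro w hw hn
      by_cases hw0 : w = 0
      · rw [hw0]; exact Submodule.zero_mem _
      -- Take a nonzero vector of `W` of minimal support within that of `w`, scaled to have a
      -- coordinate `1`. Its difference with a Galois conjugate has smaller support, hence vanishes,
      -- so the scaled vector has coordinates in `F`.
      let T : Set (ι → Ω) := {v | v ∈ W ∧ v ≠ 0 ∧ supp v ⊆ supp w}
      obtain ⟨v, ⟨hvW, hv0, hvs⟩, hvmin⟩ := exists_min_card_image T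
        ⟨w, hw, hw0, subset_rfl⟩ supp
      obtain ⟨k, hk⟩ := Function.ne_iff.mp hv0
      have hk : v k ≠ 0 := hk
      let u : ι → Ω := (v k)⁻¹ • v
      have huW : u ∈ W := W.smul_mem _ hvW
      have huk : u k = 1 := by simp [u, hk]
      have hus : supp u = supp v := by
        ext x; simp [supp, u, hk]
      have hfix : ∀ σ : Ω ≃ₐ[F] Ω, ∀ x, σ (u x) = u x := by
        intro σ
        by_contra hne
        push Not at hne
        obtain ⟨y, hy⟩ := hne
        have hdW : (fun x => σ (u x)) - u ∈ W := W.sub_mem (hW σ u huW) huW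
        have hds : supp ((fun x => σ (u x)) - u) ⊂ supp v := by
          rw [← hus]
          refine Finset.ssubset_iff_of_subset ?_ |>.mpr ⟨k, ?_, ?_⟩
          · intro x hx
            simp only [supp, Finset.mem_filter, Finset.mem_univ, true_and, Pi.sub_apply] at hx ⊢
            intro h0
            simp [h0] at hx
          · simp [supp, huk]
          · simp [supp, huk]
        have := hvmin _ ⟨hdW, fun h0 => hy (sub_eq_zero.mp (congrFun h0 y)), hds.subset.trans hvs⟩
        exact absurd (Finset.card_lt_card hds) (not_lt.mpr this)
      have hr : ∀ x, ∃ a : F, algebraMap F Ω a = u x := fun x =>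
        (InfiniteGalois.mem_range_algebraMap_iff_fixed (u x)).mpr fun σ => hfix σ x
      choose u₀ hu₀ using hr
      have hu₀' : (fun x => algebraMap F Ω (u₀ x)) = u := funext hu₀
      have hu₁ : u ∈ extendScalars Ω W₀ := by
        rw [← hu₀']
        refine mem_extendScalars ?_
        change (fun x => algebraMap F Ω (u₀ x)) ∈ W
        rwa [hu₀']
      -- Subtracting `w k • u` removes the index `k` from the support and adds none, so the
      -- induction hypothesis applies.
      have hsm : supp (w - w k • u) ⊂ supp w := by
        refine Finset.ssubset_iff_of_subset ?_ |>.mpr ⟨k, ?_, ?_⟩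
        · intro x hx
          by_contra hxw
          have h1 : w x = 0 := by simpa [supp] using hxw
          have h2 : x ∉ supp u := fun h => hxw (hvs (hus ▸ h))
          have h3 : u x = 0 := by simpa [supp] using h2
          simp [supp, h1, h3] at hx
        · exact hvs (by simp [supp, hk])
        · simp [supp, huk]
      have h1 := ih _ (hn ▸ Finset.card_lt_card hsm) (w - w k • u)
        (W.sub_mem hw (W.smul_mem _ huW)) rfl
      have h2 := Submodule.add_mem _ h1 (Submodule.smul_mem _ (w k) hu₁)
      simpa using h2
  exact fun w hw => main _ w hw rfl

end LinearAlgebra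

/-! ### Specialization of subspaces, and the canonical subspace of minimal slope. -/

section Specialization

open Module

/-- Every maximal ideal of a finitely generated algebra over `F` is the kernel of a point with
values in an algebraically closed extension of `F`. -/
theorem exists_algHom_ker_eq_of_isMaximal {F : Type*} [Field F] (Ω : Type*) [Field Ω]
    [IsAlgClosed Ω] [Algebra F Ω] {R : Type*} [CommRing R] [Algebra F R] [Algebra.FiniteType F R]
    (M : Ideal R) [M.IsMaximal] : ∃ φ : R →ₐ[F] Ω, RingHom.ker φ = M := by
  let _ : Field (R ⧸ M) := Ideal.Quotient.field M
  -- Zariski's lemma: the residue field is finite over `F`, so it embeds into `Ω`.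
  have : Module.Finite F (R ⧸ M) := finite_of_finite_type_of_isJacobsonRing F (R ⧸ M)
  have : Algebra.IsAlgebraic F (R ⧸ M) := Algebra.IsAlgebraic.of_finite F _
  let ψ : (R ⧸ M) →ₐ[F] Ω := IsAlgClosed.lift
  refine ⟨ψ.comp (Ideal.Quotient.mkₐ F M), ?_⟩
  ext x
  rw [RingHom.mem_ker, AlgHom.comp_apply, map_eq_zero_iff ψ ψ.toRingHom.injective]
  simp [Ideal.Quotient.eq_zero_iff_mem]

variable {F : Type*} [Field F] {ι κ : Type*} [Fintype ι] [Fintype κ]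

/-- Specialization of a subspace over a field extension of `F` to a subspace over an
algebraically closed extension of `F`. -/
theorem exists_specialization (Ω : Type*) [Field Ω] [IsAlgClosed Ω] [Algebra F Ω]
    {L : Type*} [Field L] [Algebra F L] (X : κ → Matrix ι ι F) (W : Submodule L (ι → L)) :
    ∃ W' : Submodule Ω (ι → Ω), finrank Ω W' = finrank L W ∧
      finrank L (annCoeff X W) ≤ finrank Ω (annCoeff X W') := by
  obtain ⟨B, C, hB, hBC⟩ := exists_dotProduct_dual W
  obtain ⟨B', C', hB', hBC'⟩ := exists_dotProduct_dual (annCoeff X W)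
  -- The coordinates of dual pairs for `W` and for its annihilator generate an `F`-algebra `R` of
  -- finite type, which has a point `φ` in `Ω`. Duality and annihilation are polynomial identities
  -- over `F`, so `φ` preserves them. The span of the image of `B` keeps its dimension, and the
  -- annihilator cannot shrink.
  let S : Set L := Set.range (fun p : _ × _ => B p.1 p.2) ∪ Set.range (fun p : _ × _ => C p.1 p.2) ∪
    (Set.range (fun p : _ × _ => B' p.1 p.2) ∪ Set.range (fun p : _ × _ => C' p.1 p.2))
  have hS : S.Finite := ((Set.finite_range _).union (Set.finite_range _)).union
    ((Set.finite_range _).union (Set.finite_range _))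
  let R := Algebra.adjoin F S
  have hR : Algebra.FiniteType F R := by
    rw [← Subalgebra.fg_iff_finiteType]
    exact ⟨hS.toFinset, by simp [R]⟩
  obtain ⟨M, hM⟩ := Ideal.exists_maximal R
  obtain ⟨φ, -⟩ := exists_algHom_ker_eq_of_isMaximal (F := F) Ω M
  have hb : ∀ i x, ∃ r : R, (r : L) = B i x := fun i x =>
    ⟨⟨_, Algebra.subset_adjoin (Or.inl (Or.inl ⟨(i, x), rfl⟩))⟩, rfl⟩
  have hc : ∀ i x, ∃ r : R, (r : L) = C i x := fun i x =>
    ⟨⟨_, Algebra.subset_adjoin (Or.inl (Or.inr ⟨(i, x), rfl⟩))⟩, rfl⟩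
  have hb' : ∀ i x, ∃ r : R, (r : L) = B' i x := fun i x =>
    ⟨⟨_, Algebra.subset_adjoin (Or.inr (Or.inl ⟨(i, x), rfl⟩))⟩, rfl⟩
  have hc' : ∀ i x, ∃ r : R, (r : L) = C' i x := fun i x =>
    ⟨⟨_, Algebra.subset_adjoin (Or.inr (Or.inr ⟨(i, x), rfl⟩))⟩, rfl⟩
  choose b hb using hb
  choose c hc using hc
  choose b' hb' using hb'
  choose c' hc' using hc'
  have h1 : ∀ i j, (fun x => φ (b i x)) ⬝ᵥ (fun x => φ (c j x)) = if i = j then 1 else 0 := by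
    intro i j
    have : ∑ x, b i x * c j x = if i = j then 1 else 0 := by
      apply Subtype.val_injective
      have := hBC i j
      simp only [← hb, ← hc, dotProduct] at this
      push_cast
      rw [this]; split_ifs <;> simp
    have := congrArg φ this
    simp only [map_sum, map_mul] at this
    rw [dotProduct, this]; split_ifs <;> simp
  have h2 : ∀ i j, (fun x => φ (b' i x)) ⬝ᵥ (fun x => φ (c' j x)) = if i = j then 1 else 0 := by
    intro i j
    have : ∑ x, b' i x * c' j x = if i = j then 1 else 0 := by
      apply Subtype.val_injective
      have := hBC' i j
      simp only [← hb', ← hc', dotProduct] at this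
      push_cast
      rw [this]; split_ifs <;> simp
    have := congrArg φ this
    simp only [map_sum, map_mul] at this
    rw [dotProduct, this]; split_ifs <;> simp
  refine ⟨Submodule.span Ω (Set.range fun i x => φ (b i x)), le_antisymm ?_ ?_, ?_⟩
  · exact (finrank_range_le_card _).trans (by simp)
  · exact le_finrank_of_dotProduct_dual _ _ _ (fun i => Submodule.subset_span ⟨i, rfl⟩) h1
  · refine le_finrank_of_dotProduct_dual _ _ _ (fun i w hw => ?_) h2
    induction hw using Submodule.span_induction with
    | mem w hw =>
      obtain ⟨j, rfl⟩ := hw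
      have h3 := hB' i _ (hB j)
      ext x
      have h4 := congrFun h3 x
      rw [sum_smul_map_mulVec_apply] at h4
      simp only [← hb, ← hb'] at h4
      have h5 : ∑ y, (∑ k, b' i k * algebraMap F R (X k x y)) * b j y = 0 := by
        apply Subtype.val_injective
        push_cast
        exact h4
      have h6 := congrArg φ h5
      simp only [map_sum, map_mul, AlgHom.commutes, map_zero] at h6
      rw [sum_smul_map_mulVec_apply]
      exact h6
    | zero => simp
    | add x y _ _ hx hy => rw [Matrix.mulVec_add, hx, hy, add_zero]
    | smul a x _ hx => rw [Matrix.mulVec_smul, hx, smul_zero]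

omit [Fintype ι] in
/-- Linear independence of matrices is preserved by extension of scalars. -/
theorem linearIndependent_map_algebraMap (K : Type*) [Field K] [Algebra F K]
    {X : κ → Matrix ι ι F} (hX : LinearIndependent F X) :
    LinearIndependent K fun i => (X i).map (algebraMap F K) := by
  classical
  rw [Fintype.linearIndependent_iff]
  intro c hc i
  let b := Basis.ofVectorSpace F K
  have h : ∀ j, b.coord j (c i) = 0 := by
    intro j
    refine Fintype.linearIndependent_iff.mp hX (fun i => b.coord j (c i)) ?_ i
    ext x y
    have h1 := congrArg (b.coord j) (congrFun (congrFun hc x) y)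
    simp only [Matrix.sum_apply, Matrix.smul_apply, Matrix.map_apply, smul_eq_mul, map_sum,
      Matrix.zero_apply, map_zero] at h1 ⊢
    rw [← h1]
    refine Finset.sum_congr rfl fun k _ => ?_
    rw [mul_comm (c k), ← Algebra.smul_def, map_smul, smul_eq_mul, mul_comm]
  refine b.repr.injective (Finsupp.ext fun j => ?_)
  simpa using h j

/-- If the matrix `P` normalizes the span of the `Xᵢ`, then `P` maps a subspace to one with an
annihilator that is at least as large. -/
theorem finrank_annCoeff_map_ge {K : Type*} [Field K] [Algebra F K] [DecidableEq ι]
    {X : κ → Matrix ι ι F} (hX : LinearIndependent F X) {P Q : Matrix ι ι K} (hQP : Q * P = 1)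
    (hP : ∀ i, P * (X i).map (algebraMap F K) * Q ∈
      Submodule.span K (Set.range fun i => (X i).map (algebraMap F K)))
    (W : Submodule K (ι → K)) :
    finrank K (annCoeff X W) ≤ finrank K (annCoeff X (W.map P.mulVecLin)) := by
  have h : ∀ i, ∃ a : κ → K, ∑ j, a j • (X j).map (algebraMap F K) =
      P * (X i).map (algebraMap F K) * Q := fun i => by
    have := hP i
    rwa [Submodule.mem_span_range_iff_exists_fun] at this
  choose a ha using h
  -- On coefficient vectors, conjugation by `P` is `c ↦ c a`. It takes the annihilator of `W` into
  -- that of `P W`, and it is injective because conjugation can be undone and the `Xᵢ` stay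
  -- independent over `K`.
  have hsum : ∀ c : κ → K, ∑ j, (Matrix.vecMulLinear (Matrix.of a)) c j • (X j).map (algebraMap F K) =
      P * (∑ i, c i • (X i).map (algebraMap F K)) * Q := by
    intro c
    simp only [Matrix.vecMulLinear_apply, Matrix.vecMul, dotProduct, Matrix.of_apply,
      Finset.sum_smul, mul_smul]
    rw [Finset.sum_comm, Finset.mul_sum, Finset.sum_mul]
    refine Finset.sum_congr rfl fun i _ => ?_
    rw [← Finset.smul_sum, ha, Matrix.mul_smul, Matrix.smul_mul]
  have hPQ : P * Q = 1 := mul_eq_one_comm.mp hQP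
  refine LinearMap.finrank_le_finrank_of_injective
    (f := (Matrix.vecMulLinear (Matrix.of a)).restrict (p := annCoeff X W)
      (q := annCoeff X (W.map P.mulVecLin)) ?_) ?_
  · rintro c hc _ ⟨w, hw, rfl⟩
    rw [hsum, Matrix.mulVecLin_apply, Matrix.mulVec_mulVec, Matrix.mul_assoc, hQP, mul_one,
      ← Matrix.mulVec_mulVec, hc w hw, Matrix.mulVec_zero]
  · rw [← LinearMap.ker_eq_bot, LinearMap.ker_eq_bot']
    rintro ⟨c, hc⟩ h0
    have h1 : Matrix.vecMulLinear (Matrix.of a) c = 0 := congrArg Subtype.val h0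
    have h2 := hsum c
    rw [h1] at h2
    simp only [Pi.zero_apply, zero_smul, Finset.sum_const_zero] at h2
    have h3 : ∑ i, c i • (X i).map (algebraMap F K) = 0 := by
      calc _ = Q * (P * (∑ i, c i • (X i).map (algebraMap F K)) * Q) * P := by
              rw [Matrix.mul_assoc P, ← Matrix.mul_assoc Q, hQP, one_mul, Matrix.mul_assoc, hQP,
                mul_one]
        _ = 0 := by rw [← h2]; simp
    apply Subtype.ext
    funext i
    exact Fintype.linearIndependent_iff.mp (linearIndependent_map_algebraMap K hX) c h3 i

/-- Over a field `F` with Galois extension `Ω`, there is a subspace of `F^ι` whose slope is minimal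
among all subspaces of `Ω^ι` and which is stable under all matrices over `Ω` that normalize the
span of the `Xᵢ`. -/
theorem exists_stable_of_minimal_slope (Ω : Type*) [Field Ω] [Algebra F Ω] [IsGalois F Ω]
    [Nonempty ι] [DecidableEq ι] {X : κ → Matrix ι ι F} (hX : LinearIndependent F X) :
    ∃ W₀ : Submodule F (ι → F), W₀ ≠ ⊥ ∧
      (∀ P Q : Matrix ι ι Ω, Q * P = 1 → (∀ i, P * (X i).map (algebraMap F Ω) * Q ∈
        Submodule.span Ω (Set.range fun i => (X i).map (algebraMap F Ω))) →
        ∀ w ∈ W₀, P.mulVec (fun x => algebraMap F Ω (w x)) ∈ extendScalars Ω W₀) ∧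
      ∀ W : Submodule Ω (ι → Ω), W ≠ ⊥ →
        ((Fintype.card κ : ℤ) - finrank F (annCoeff X W₀)) * finrank Ω W ≤
          ((Fintype.card κ : ℤ) - finrank Ω (annCoeff X W)) * finrank F W₀ := by
  obtain ⟨W₁, hW₁, hmin, hmax⟩ := exists_maximal_of_minimal_slope
    (annCoeff (K := Ω) X) (annCoeff_antitone X) (annCoeff_inf_le X)
  obtain ⟨W₀, rfl⟩ := eq_extendScalars_of_forall_algEquiv (F := F) W₁ (by
    intro σ w hw
    -- `W'` is `σ(W₁)`. Since the matrices have entries in `F`, `σ` carries the annihilator of `W₁`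
    -- into that of `W'`, and the dimensions agree; so maximality gives `W' ≤ W₁`.
    let W' : Submodule Ω (ι → Ω) :=
      { carrier := {w | (fun x => σ.symm (w x)) ∈ W₁}
        add_mem' := fun {a b} ha hb => by
          have := W₁.add_mem ha hb
          simpa [Pi.add_def] using! this
        zero_mem' := by
          have := W₁.zero_mem
          simpa [Pi.zero_def] using! this
        smul_mem' := fun c w hw => by
          have := W₁.smul_mem (σ.symm c) hw
          simpa [Pi.smul_def] using! this }
    refine hmax W' (le_antisymm ?_ ?_) ?_ ?_
    · exact finrank_le_of_map_mem (σ.symm : Ω →+* Ω) _ _ fun u hu => hu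
    · refine finrank_le_of_map_mem (σ : Ω →+* Ω) _ _ fun u hu => ?_
      change (fun x => σ.symm (σ (u x))) ∈ W₁
      simpa using hu
    · refine finrank_le_of_map_mem (σ : Ω →+* Ω) _ _ fun c hc w hw => ?_
      have h := hc _ hw
      ext x
      have h1 := congrArg σ (congrFun h x)
      rw [sum_smul_map_mulVec_apply] at h1 ⊢
      simpa using h1
    · change (fun x => σ.symm (σ (w x))) ∈ W₁
      simpa using hw)
  have hfin := finrank_extendScalars Ω W₀
  refine ⟨W₀, ?_, ?_, fun W hW => ?_⟩
  · rintro rfl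
    refine hW₁ (Submodule.finrank_eq_zero.mp ?_)
    rw [hfin, finrank_bot]
  · intro P Q hQP hP w hw
    have hinj : Function.Injective P.mulVecLin := by
      refine Function.LeftInverse.injective (g := Q.mulVecLin) fun w => ?_
      simp [Matrix.mulVec_mulVec, hQP]
    refine hmax ((extendScalars Ω W₀).map P.mulVecLin) ?_ (finrank_annCoeff_map_ge hX hQP hP _)
      ⟨_, mem_extendScalars hw, rfl⟩
    exact (LinearEquiv.finrank_eq (Submodule.equivMapOfInjective _ hinj _)).symm
  · have := hmin W hW
    rwa [hfin, finrank_annCoeff_extendScalars, finrank_fintype_fun_eq_card] at this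

end Specialization

/-! ### Krull dimension at a rational point: height bounds and the growth of `A / m ^ N`. -/

section Dimension

open MvPolynomial

/-- An injective integral extension does not decrease the Krull dimension. -/
theorem ringKrullDim_le_of_isIntegral (R S : Type*) [CommRing R] [CommRing S] [Algebra R S]
    [Algebra.IsIntegral R S] [FaithfulSMul R S] : ringKrullDim R ≤ ringKrullDim S := by
  refine iSup_le fun l => ?_
  -- Lying over provides a prime above the bottom of the chain, and going up lifts the rest.
  obtain ⟨P, hP⟩ := Algebra.IsIntegral.comap_surjective R S l.head
  have : P.asIdeal.LiesOver l.head.asIdeal := ⟨by rw [← hP]; rfl⟩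
  have : Algebra.HasGoingUp R S := Algebra.HasGoingUp.of_isIntegral
  obtain ⟨l', hl', -⟩ := Ideal.exists_ltSeries_of_hasGoingUp l P.asIdeal
  rw [← hl']
  exact le_iSup (fun p : LTSeries (PrimeSpectrum S) => (p.length : WithBot ℕ∞)) l'

/-- If `n` elements of the maximal ideal `m` generate it modulo `m²`, then `m` has height at
most `n`. -/
theorem Ideal.height_le_of_le_span_sup_sq {A : Type*} [CommRing A] [IsNoetherianRing A]
    (m : Ideal A) [m.IsMaximal] {n : ℕ} (x : Fin n → A) (hx : ∀ i, x i ∈ m)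
    (h : m ≤ Ideal.span (Set.range x) ⊔ m ^ 2) : m.height ≤ n := by
  rw [Ideal.height_le_iff_exists_minimalPrimes]
  refine ⟨Ideal.span (Set.range x), ⟨⟨inferInstance, Ideal.span_le.mpr ?_⟩, fun q hq hqm => ?_⟩, ?_⟩
  · rintro _ ⟨i, rfl⟩
    exact hx i
  · obtain ⟨r, hr, hrm⟩ := Submodule.exists_sub_one_mem_and_smul_le_of_fg_of_le_sup
      (I := m) (N := Ideal.span (Set.range x)) (N' := m) (P := m) (IsNoetherian.noetherian m) le_rfl
      (by rwa [smul_eq_mul, ← sq])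
    have hrq : r ∉ q := fun h1 =>
      (Ideal.ne_top_iff_one m).mp (Ideal.IsMaximal.ne_top inferInstance) (by
        have := m.sub_mem (hqm h1) hr
        simpa using this)
    intro a ha
    have h1 : r * a ∈ q := hq.2 (hrm (Submodule.smul_mem_pointwise_smul a r m ha))
    exact (hq.1.mem_or_mem h1).resolve_left hrq
  · refine (Submodule.spanRank_span_le_card _).trans ?_
    have h1 := Cardinal.mk_range_le_lift (f := x)
    simpa using h1

variable {F : Type*} [Field F] {A : Type*} [CommRing A] [Algebra F A]

theorem aeval_mem_pow_of_mem_pow_idealOfVars {σ : Type*} {m : Ideal A} {x : σ → A}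
    (hx : ∀ i, x i ∈ m) {k : ℕ} {p : MvPolynomial σ F} (hp : p ∈ idealOfVars σ F ^ k) :
    aeval x p ∈ m ^ k := by
  have h : (idealOfVars σ F).map (aeval x : MvPolynomial σ F →ₐ[F] A) ≤ m := by
    rw [idealOfVars, Ideal.map_span, Ideal.span_le]
    rintro _ ⟨_, ⟨i, rfl⟩, rfl⟩
    simpa using hx i
  have h1 := Ideal.mem_map_of_mem (aeval x : MvPolynomial σ F →ₐ[F] A) hp
  rw [Ideal.map_pow] at h1
  exact Ideal.pow_right_mono h k h1

/-- The family `x` is quasi-regular with respect to `m`: a homogeneous polynomial of degree `k`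
whose value at `x` lies in `m ^ (k + 1)` is zero. -/
def IsQuasiRegular (F : Type*) [Field F] {A : Type*} [CommRing A] [Algebra F A] (m : Ideal A)
    {σ : Type*} (x : σ → A) : Prop :=
  ∀ (k : ℕ) (p : MvPolynomial σ F), p.IsHomogeneous k → aeval x p ∈ m ^ (k + 1) → p = 0

theorem sub_homogeneousComponent_mem {σ : Type*} {p : MvPolynomial σ F} {k : ℕ}
    (h : p ∈ idealOfVars σ F ^ k) : p - homogeneousComponent k p ∈ idealOfVars σ F ^ (k + 1) := by
  rw [mem_pow_idealOfVars_iff] at h ⊢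
  intro d hd
  have h1 : d ∈ p.support := by
    by_contra h0
    rw [mem_support_iff, not_not] at h0
    rw [mem_support_iff, coeff_sub, coeff_homogeneousComponent, h0] at hd
    simp at hd
  refine Nat.lt_of_le_of_ne (h d h1) fun hk => ?_
  rw [mem_support_iff, coeff_sub, coeff_homogeneousComponent, if_pos hk.symm] at hd
  simp at hd

/-- The lowest homogeneous component of a nonzero `p` agrees with `p` modulo the next power of `m`,
so quasi-regularity kills it. Consequently the monomials in `x` of degree less than `N` are linearly
independent modulo `m ^ N`. -/
theorem IsQuasiRegular.eq_zero {m : Ideal A} {σ : Type*} {x : σ → A}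
    (h : IsQuasiRegular F m x) (hx : ∀ i, x i ∈ m) {N : ℕ} {p : MvPolynomial σ F}
    (hN : ∀ d ∈ p.support, d.degree < N) (hp : aeval x p ∈ m ^ N) : p = 0 := by
  by_contra hp0
  have hS : (p.support.image Finsupp.degree).Nonempty := by
    rw [Finset.image_nonempty, Finset.nonempty_iff_ne_empty, Ne, support_eq_empty]
    exact hp0
  obtain ⟨d, hd, hdk⟩ := Finset.mem_image.mp (Finset.min'_mem _ hS)
  set k := (p.support.image Finsupp.degree).min' hS
  have hk : p ∈ idealOfVars σ F ^ k := by
    rw [mem_pow_idealOfVars_iff]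
    exact fun d hd => Finset.min'_le _ _ (Finset.mem_image_of_mem _ hd)
  have h1 := aeval_mem_pow_of_mem_pow_idealOfVars hx (sub_homogeneousComponent_mem hk)
  have h2 : aeval x p ∈ m ^ (k + 1) := Ideal.pow_le_pow_right (hdk ▸ hN d hd) hp
  have h3 : homogeneousComponent k p = 0 := by
    refine h k _ (homogeneousComponent_isHomogeneous k p) ?_
    have := (m ^ (k + 1)).sub_mem h2 h1
    simpa using this
  have h4 := congrArg (coeff d) h3
  rw [coeff_homogeneousComponent, if_pos hdk, coeff_zero] at h4
  exact mem_support_iff.mp hd h4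

/-- Growth of `A / m ^ N`, upper bound, for `A` finite over a polynomial ring in `s` variables. -/
theorem exists_finrank_quotient_pow_le (ε : A →ₐ[F] F) {s : ℕ}
    (g : MvPolynomial (Fin s) F →ₐ[F] A) (hg : g.Finite) :
    ∃ t : ℕ, ∀ N : ℕ, Module.Finite F (A ⧸ RingHom.ker ε ^ N) ∧
      Module.finrank F (A ⧸ RingHom.ker ε ^ N) ≤ t * N ^ s := by
  let := g.toRingHom.toAlgebra
  have : Module.Finite (MvPolynomial (Fin s) F) A := hg
  obtain ⟨t, e, he⟩ := Module.Finite.exists_fin (R := MvPolynomial (Fin s) F) (M := A)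
  refine ⟨t, fun N => ?_⟩
  set m := RingHom.ker ε
  let c : Fin s → F := fun i => ε (g (X i))
  -- Shifting the variables by their values at the point moves them into `m`.
  let z : Fin s → A := fun i => g (X i) - algebraMap F A (c i)
  have hz : ∀ i, z i ∈ m := fun i => by simp [m, z, c, RingHom.mem_ker]
  -- The `t * N ^ s` products of a module generator with a monomial in `z` whose exponents are all
  -- below `N` span the quotient, because `z i ^ N` lies in `m ^ N`.
  let B : (Fin t × (Fin s → Fin N)) → A ⧸ m ^ N := fun q =>
    Ideal.Quotient.mk _ (e q.1 * ∏ i, z i ^ (q.2 i : ℕ))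
  have hmon : ∀ (j : Fin t) (d : Fin s →₀ ℕ),
      Ideal.Quotient.mk (m ^ N) (e j * d.prod fun i k => z i ^ k) ∈ Submodule.span F (Set.range B) := by
    intro j d
    by_cases hd : ∀ i, d i < N
    · refine Submodule.subset_span ⟨(j, fun i => ⟨d i, hd i⟩), ?_⟩
      simp only [B]
      rw [Finsupp.prod_fintype _ _ (by simp)]
    · push Not at hd
      obtain ⟨i, hi⟩ := hd
      have : e j * d.prod (fun i k => z i ^ k) ∈ m ^ N := by
        rw [Finsupp.prod_fintype _ _ (by simp)]
        refine Ideal.mul_mem_left _ _ (Ideal.mem_of_dvd _ (Finset.dvd_prod_of_mem _ (Finset.mem_univ i)) ?_)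
        exact Ideal.pow_le_pow_right hi (Ideal.pow_mem_pow (hz i) _)
      rw [Ideal.Quotient.eq_zero_iff_mem.mpr this]
      exact Submodule.zero_mem _
  have hpoly : ∀ (j : Fin t) (p : MvPolynomial (Fin s) F),
      Ideal.Quotient.mk (m ^ N) (e j * aeval z p) ∈ Submodule.span F (Set.range B) := by
    intro j p
    induction p using MvPolynomial.induction_on' with
    | monomial d a =>
      rw [aeval_monomial, mul_left_comm, ← Algebra.smul_def]
      exact Submodule.smul_mem _ a (hmon j d)
    | add p q hp hq =>
      rw [map_add, mul_add, map_add]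
      exact Submodule.add_mem _ hp hq
  have hshift : ∀ p : MvPolynomial (Fin s) F, ∃ p' : MvPolynomial (Fin s) F, g p = aeval z p' := by
    intro p
    refine ⟨aeval (fun i => X i + C (c i)) p, ?_⟩
    rw [← AlgHom.comp_apply]
    congr 1
    ext i
    simp [z]
  have hspan : Submodule.span F (Set.range B) = ⊤ := by
    rw [eq_top_iff]
    rintro a -
    obtain ⟨a, rfl⟩ := Ideal.Quotient.mk_surjective a
    have ha : a ∈ Submodule.span (MvPolynomial (Fin s) F) (Set.range e) := he ▸ Submodule.mem_top
    rw [Submodule.mem_span_range_iff_exists_fun] at ha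
    obtain ⟨p, rfl⟩ := ha
    rw [map_sum]
    refine Submodule.sum_mem _ fun j _ => ?_
    obtain ⟨p', hp'⟩ := hshift (p j)
    have : p j • e j = e j * aeval z p' := by
      rw [← hp', Algebra.smul_def, mul_comm]; rfl
    rw [this]
    exact hpoly j p'
  refine ⟨⟨Submodule.fg_def.mpr ⟨_, Set.finite_range B, hspan⟩⟩, ?_⟩
  have h := finrank_range_le_card (R := F) B
  rw [Set.finrank, hspan, finrank_top] at h
  simpa using h

/-- The `M ^ n` monomials with all exponents below `M` have degree at most `n * M`, so they remain
independent in this quotient. -/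
theorem IsQuasiRegular.pow_le_finrank {m : Ideal A} {n : ℕ} {x : Fin n → A}
    (h : IsQuasiRegular F m x) (hx : ∀ i, x i ∈ m) (M : ℕ)
    [Module.Finite F (A ⧸ m ^ (n * M + 1))] :
    M ^ n ≤ Module.finrank F (A ⧸ m ^ (n * M + 1)) := by
  classical
  let E : (Fin n → Fin M) → (Fin n →₀ ℕ) := fun α => Finsupp.equivFunOnFinite.symm fun i => α i
  have hE : Function.Injective E := fun α β hαβ => by
    ext i
    exact DFunLike.congr_fun hαβ i
  have hli : LinearIndependent F fun α : Fin n → Fin M =>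
      Ideal.Quotient.mk (m ^ (n * M + 1)) (aeval x (monomial (E α) (1 : F))) := by
    rw [Fintype.linearIndependent_iff]
    intro c hc β
    let p : MvPolynomial (Fin n) F := ∑ α, monomial (E α) (c α)
    have hcoeff : coeff (E β) p = c β := by
      simp [p, coeff_sum, coeff_monomial, hE.eq_iff]
    have hp : p = 0 := by
      refine h.eq_zero hx (N := n * M + 1) (fun d hd => ?_) ?_
      · obtain ⟨α, -, hα⟩ := Finset.exists_ne_zero_of_sum_ne_zero (s := Finset.univ)
          (f := fun α => coeff d (monomial (E α) (c α))) (by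
            rw [mem_support_iff, coeff_sum] at hd
            exact hd)
        rw [coeff_monomial] at hα
        have hd' : E α = d := by
          by_contra h0
          rw [if_neg h0] at hα
          exact hα rfl
        rw [← hd', Finsupp.degree_eq_sum, Nat.lt_succ_iff]
        calc ∑ i, E α i ≤ ∑ _i : Fin n, M := Finset.sum_le_sum fun i _ => (α i).2.le
          _ = n * M := by simp
      · rw [← Ideal.Quotient.eq_zero_iff_mem, ← hc, map_sum, map_sum]
        refine Finset.sum_congr rfl fun α _ => ?_
        rw [aeval_monomial, aeval_monomial, map_one, one_mul, ← Algebra.smul_def]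
        rfl
    rw [← hcoeff, hp, coeff_zero]
  simpa using hli.fintype_card_le_finrank

/-- A quasi-regular family at a rational point has at most `dim A` elements. -/
theorem IsQuasiRegular.le_ringKrullDim [Algebra.FiniteType F A] (ε : A →ₐ[F] F) {n : ℕ}
    {x : Fin n → A} (h : IsQuasiRegular F (RingHom.ker ε) x) (hx : ∀ i, ε (x i) = 0) :
    (n : WithBot ℕ∞) ≤ ringKrullDim A := by
  have : Nontrivial A := ε.toRingHom.domain_nontrivial
  obtain ⟨s, g, hinj, hg⟩ := exists_finite_inj_algHom_of_fg F A
  obtain ⟨t, ht⟩ := exists_finrank_quotient_pow_le ε g hg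
  have hns : n ≤ s := by
    by_contra! hlt
    -- If `n > s`, the two growth estimates give `M ^ (s + 1) ≤ t * ((n + 1) * M) ^ s`, that is `M ≤
    -- t * (n + 1) ^ s`; this `M` is one too large.
    set M := t * (n + 1) ^ s + 1 with hM
    have := (ht (n * M + 1)).1
    have h1 := (h.pow_le_finrank hx M).trans (ht (n * M + 1)).2
    have h2 : M ^ (s + 1) ≤ M ^ n := Nat.pow_le_pow_right (by omega) hlt
    have h3 : (n * M + 1) ^ s ≤ ((n + 1) * M) ^ s := Nat.pow_le_pow_left (by
      have : 1 ≤ M := by omega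
      rw [add_mul, one_mul]; omega) s
    have h4 : M ^ s * M ≤ M ^ s * (t * (n + 1) ^ s) := by
      calc M ^ s * M = M ^ (s + 1) := (pow_succ M s).symm
        _ ≤ t * (n * M + 1) ^ s := h2.trans h1
        _ ≤ t * ((n + 1) * M) ^ s := Nat.mul_le_mul_left t h3
        _ = M ^ s * (t * (n + 1) ^ s) := by rw [mul_pow]; ring
    have h5 := Nat.le_of_mul_le_mul_left h4 (pow_pos (by omega) s)
    omega
  let := g.toRingHom.toAlgebra
  have : Algebra.IsIntegral (MvPolynomial (Fin s) F) A := ⟨hg.to_isIntegral⟩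
  have : FaithfulSMul (MvPolynomial (Fin s) F) A :=
    (faithfulSMul_iff_algebraMap_injective _ _).mpr hinj
  refine le_trans ?_ (ringKrullDim_le_of_isIntegral (MvPolynomial (Fin s) F) A)
  rw [MvPolynomial.ringKrullDim_of_isNoetherianRing, ringKrullDim_eq_zero_of_field, zero_add]
  simpa using hns

/-- At a point with a quasi-regular system of generators of `m` modulo `m²`, nilpotent elements
lie in all powers of `m`. -/
theorem IsQuasiRegular.mem_pow_of_isNilpotent {m : Ideal A} {σ : Type*} {x : σ → A}
    (h : IsQuasiRegular F m x)
    (hgen : ∀ (k : ℕ), ∀ a ∈ m ^ k, ∃ p : MvPolynomial σ F, p.IsHomogeneous k ∧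
      a - aeval x p ∈ m ^ (k + 1)) {a : A} (ha : IsNilpotent a) (k : ℕ) : a ∈ m ^ k := by
  induction k with
  | zero => simp
  | succ k ih =>
    obtain ⟨p, hp, hap⟩ := hgen k a ih
    obtain ⟨r, hr⟩ := ha
    have hmem : aeval x p ∈ m ^ k := by
      have := (m ^ k).sub_mem ih (Ideal.pow_le_pow_right k.le_succ hap)
      simpa using this
    -- The powers of `a` have the powers of `p` as leading forms. If `a ^ r = 0`, quasi-regularity
    -- gives `p ^ r = 0`, hence `p = 0` and `a` lies one power deeper.
    have hpow : ∀ r : ℕ, a ^ r - aeval x (p ^ r) ∈ m ^ (k * r + 1) := by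
      intro r
      induction r with
      | zero => simp
      | succ r ihr =>
        have e : a ^ (r + 1) - aeval x (p ^ (r + 1)) =
            (a ^ r - aeval x (p ^ r)) * a + aeval x (p ^ r) * (a - aeval x p) := by
          simp only [map_pow]; ring
        rw [e]
        refine Ideal.add_mem _ ?_ ?_
        · have := Ideal.mul_mem_mul ihr ih
          rwa [← pow_add, show k * r + 1 + k = k * (r + 1) + 1 by ring] at this
        · have h1 : aeval x (p ^ r) ∈ m ^ (k * r) := by
            rw [map_pow, pow_mul]
            exact Ideal.pow_mem_pow hmem r
          have := Ideal.mul_mem_mul h1 hap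
          rwa [← pow_add, show k * r + (k + 1) = k * (r + 1) + 1 by ring] at this
    have h1 := hpow r
    rw [hr, zero_sub, neg_mem_iff] at h1
    have h2 := h (k * r) (p ^ r) (hp.pow r) h1
    have h3 : p = 0 := eq_zero_of_pow_eq_zero h2
    simpa [h3] using hap

end Dimension

/-! ### Points of the group, inverses and translations. -/

section Points

open WithConv AlgHom

variable {k : Type*} [Field k] {A : Type*} [CommRing A] [HopfAlgebra k A]
  {B : Type*} [CommRing B] [Algebra k B]

/-- The antipode axiom is this identity for the universal point `id`; composition with `g` gives the
general case. -/
theorem toConv_antipode_mul_self (g : A →ₐ[k] B) :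
    toConv (g.comp (HopfAlgebra.antipodeAlgHom k A)) * toConv g = 1 := by
  have h : (toConv (HopfAlgebra.antipodeAlgHom k A) * toConv (AlgHom.id k A) :
      WithConv (A →ₐ[k] A)) = 1 :=
    WithConv.ofConv_injective (AlgHom.toLinearMap_injective (congrArg WithConv.ofConv
      (LinearMap.antipode_mul_id (R := k) (C := A))))
  have h1 := comp_convMul_distrib g (toConv (HopfAlgebra.antipodeAlgHom k A)) (toConv (AlgHom.id k A))
  rw [h] at h1
  apply WithConv.ofConv_injective
  refine Eq.trans h1.symm ?_
  ext a
  simp [AlgHom.convOne_def, Algebra.ofId_apply]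

theorem toConv_mul_antipode_self (g : A →ₐ[k] B) :
    toConv g * toConv (g.comp (HopfAlgebra.antipodeAlgHom k A)) = 1 := by
  have h : (toConv (AlgHom.id k A) * toConv (HopfAlgebra.antipodeAlgHom k A) :
      WithConv (A →ₐ[k] A)) = 1 :=
    WithConv.ofConv_injective (AlgHom.toLinearMap_injective (congrArg WithConv.ofConv
      (LinearMap.id_mul_antipode (R := k) (C := A))))
  have h1 := comp_convMul_distrib g (toConv (AlgHom.id k A)) (toConv (HopfAlgebra.antipodeAlgHom k A))
  rw [h] at h1
  apply WithConv.ofConv_injective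
  refine Eq.trans h1.symm ?_
  ext a
  simp [AlgHom.convOne_def, Algebra.ofId_apply]

/-- Translation by a rational point, as an endomorphism of the coordinate ring. -/
def translateHom (g : A →ₐ[k] k) : A →ₐ[k] A :=
  (toConv (AlgHom.id k A) * toConv ((Algebra.ofId k A).comp g)).ofConv

theorem translateHom_comp (g h : A →ₐ[k] k) (hgh : toConv h * toConv g = 1) :
    (translateHom h).comp (translateHom g) = AlgHom.id k A := by
  conv_lhs => rw [translateHom.eq_def g]
  rw [comp_convMul_distrib]
  have e1 : (translateHom h).comp (Algebra.ofId k A |>.comp g) = (Algebra.ofId k A).comp g := by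
    ext a; simp [Algebra.ofId_apply]
  have e2 := comp_convMul_distrib (Algebra.ofId k A) (toConv h) (toConv g)
  rw [hgh] at e2
  rw [e1, AlgHom.comp_id, translateHom, WithConv.toConv_ofConv, mul_assoc]
  have e3 : (toConv ((Algebra.ofId k A).comp h) * toConv ((Algebra.ofId k A).comp g) :
      WithConv (A →ₐ[k] A)) = 1 := by
    apply WithConv.ofConv_injective
    refine Eq.trans e2.symm ?_
    ext a
    simp [AlgHom.convOne_def, Algebra.ofId_apply]
  rw [e3, mul_one]

/-- Translation by a rational point, as an automorphism of the coordinate ring. -/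
def pointTranslate (g : A →ₐ[k] k) : A ≃ₐ[k] A :=
  AlgEquiv.ofAlgHom (translateHom g)
    (translateHom (g.comp (HopfAlgebra.antipodeAlgHom k A)))
    (translateHom_comp _ _ (toConv_mul_antipode_self g))
    (translateHom_comp _ _ (toConv_antipode_mul_self g))

/-- Translation moves the identity to `g`, so local statements at the identity transfer to every
rational point. -/
theorem counit_pointTranslate (g : A →ₐ[k] k) (a : A) :
    Coalgebra.counit (R := k) (pointTranslate g a) = g a := by
  have h := comp_convMul_distrib (Bialgebra.counitAlgHom k A) (toConv (AlgHom.id k A))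
    (toConv ((Algebra.ofId k A).comp g))
  have e : (toConv ((Bialgebra.counitAlgHom k A).comp (AlgHom.id k A)) :
      WithConv (A →ₐ[k] k)) = 1 := by
    apply WithConv.ofConv_injective
    ext a
    simp [AlgHom.convOne_def]
  rw [e, one_mul] at h
  have := AlgHom.congr_fun h a
  simpa [Algebra.ofId_apply] using! this

end Points

/-! ### The tangent space at the identity and local coordinates. -/

section Tangent

variable {k : Type*} [Field k] {A : Type*} [CommRing A] [HopfAlgebra k A]

open Coalgebra Module

/-- The tangent space at the identity. -/
def tangentSpace (k : Type*) [Field k] (A : Type*) [CommRing A] [HopfAlgebra k A] :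
    Submodule k (Module.Dual k A) where
  carrier := {D | AlgRep.IsTangent D}
  add_mem' := fun {D E} hD hE a b => by
    simp only [LinearMap.add_apply, hD a b, hE a b]; ring
  zero_mem' := fun a b => by simp
  smul_mem' := fun c D hD a b => by
    simp only [LinearMap.smul_apply, hD a b, smul_eq_mul]; ring

theorem AlgRep.IsTangent.map_one {D : A →ₗ[k] k} (hD : AlgRep.IsTangent D) : D 1 = 0 := by
  have := hD 1 1
  simpa using this

theorem AlgRep.IsTangent.map_algebraMap {D : A →ₗ[k] k} (hD : AlgRep.IsTangent D) (c : k) :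
    D (algebraMap k A c) = 0 := by
  rw [Algebra.algebraMap_eq_smul_one, map_smul, hD.map_one, smul_zero]

/-- The augmentation ideal. -/
abbrev augIdeal (k : Type*) [Field k] (A : Type*) [CommRing A] [HopfAlgebra k A] : Ideal A :=
  RingHom.ker (Bialgebra.counitAlgHom k A)

theorem mem_augIdeal {a : A} : a ∈ augIdeal k A ↔ counit (R := k) a = 0 := Iff.rfl

theorem sub_counit_mem_augIdeal (a : A) :
    a - algebraMap k A (counit (R := k) a) ∈ augIdeal k A := by
  rw [mem_augIdeal, map_sub, Bialgebra.counit_algebraMap, sub_self]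

theorem AlgRep.IsTangent.map_of_mem_sq {D : A →ₗ[k] k} (hD : AlgRep.IsTangent D) {a : A}
    (ha : a ∈ augIdeal k A ^ 2) : D a = 0 := by
  rw [sq] at ha
  induction ha using Submodule.mul_induction_on' with
  | mem_mul_mem x hx y hy =>
    rw [hD, mem_augIdeal.mp hx, mem_augIdeal.mp hy, zero_mul, mul_zero, add_zero]
  | add x _ y _ hx hy => rw [map_add, hx, hy, add_zero]

/-- Local coordinates `x` at the identity together with the dual tangent vectors `D`. -/
structure IsCoordinateSystem {n : ℕ} (x : Fin n → A) (D : Fin n → A →ₗ[k] k) : Prop where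
  counit_eq : ∀ i, counit (R := k) (x i) = 0
  isTangent : ∀ i, AlgRep.IsTangent (D i)
  apply_eq : ∀ i j, D i (x j) = if i = j then 1 else 0
  generate : ∀ a : A, ∃ c : Fin n → k,
    a - algebraMap k A (counit (R := k) a) - ∑ j, c j • x j ∈ augIdeal k A ^ 2

theorem IsCoordinateSystem.finrank_eq {n : ℕ} {x : Fin n → A} {D : Fin n → A →ₗ[k] k}
    (h : IsCoordinateSystem x D) : finrank k (tangentSpace k A) = n := by
  have hli : LinearIndependent k D := by
    rw [Fintype.linearIndependent_iff]
    intro c hc i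
    have h1 := LinearMap.congr_fun hc (x i)
    simpa [h.apply_eq] using h1
  have hspan : tangentSpace k A = Submodule.span k (Set.range D) := by
    refine le_antisymm (fun E hE => ?_) (Submodule.span_le.mpr ?_)
    · have hE : AlgRep.IsTangent E := hE
      have : E = ∑ i, E (x i) • D i := by
        ext a
        obtain ⟨c, hc⟩ := h.generate a
        have e : ∀ {E : A →ₗ[k] k}, AlgRep.IsTangent E → E a = ∑ j, c j * E (x j) := by
          intro E hE
          have h1 := hE.map_of_mem_sq hc
          rw [map_sub, map_sub, hE.map_algebraMap, sub_zero, sub_eq_zero] at h1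
          simpa using h1
        rw [e hE]
        simp [e (h.isTangent _), h.apply_eq, mul_comm]
      rw [this]
      exact Submodule.sum_mem _ fun i _ => Submodule.smul_mem _ _ (Submodule.subset_span ⟨i, rfl⟩)
    · rintro _ ⟨i, rfl⟩
      exact h.isTangent i
  rw [hspan, finrank_span_eq_card hli, Fintype.card_fin]

/-- By the Leibniz rule a tangent vector is determined by its values on a finite set of algebra
generators. -/
instance finite_tangentSpace [Algebra.FiniteType k A] : Module.Finite k (tangentSpace k A) := by
  obtain ⟨S, hS⟩ := (inferInstance : Algebra.FiniteType k A).out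
  let f : tangentSpace k A →ₗ[k] (S → k) :=
    LinearMap.pi fun s => (LinearMap.applyₗ (R := k) (s : A)) ∘ₗ (tangentSpace k A).subtype
  refine Module.Finite.of_injective f ?_
  rintro ⟨D, hD⟩ ⟨E, hE⟩ hDE
  have hD : AlgRep.IsTangent D := hD
  have hE : AlgRep.IsTangent E := hE
  apply Subtype.ext
  ext a
  change D a = E a
  have ha : a ∈ Algebra.adjoin k (S : Set A) := hS ▸ Algebra.mem_top
  induction ha using Algebra.adjoin_induction with
  | mem x hx => exact congrFun hDE ⟨x, hx⟩
  | algebraMap r => rw [hD.map_algebraMap, hE.map_algebraMap]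
  | add x y _ _ hx hy => rw [map_add, map_add, hx, hy]
  | mul x y _ _ hx hy => rw [hD, hE, hx, hy]

/-- With `m` the augmentation ideal, tangent vectors are the forms that kill `Q = k·1 + m²`, and `A
/ Q` is the cotangent space. Lifting a basis of `A / Q` into `m` gives `x`, and the dual basis gives
`D`. -/
theorem exists_isCoordinateSystem [Algebra.FiniteType k A] :
    ∃ (x : Fin (finrank k (tangentSpace k A)) → A) (D : Fin (finrank k (tangentSpace k A)) → A →ₗ[k] k),
      IsCoordinateSystem x D := by
  suffices h : ∃ (n : ℕ) (x : Fin n → A) (D : Fin n → A →ₗ[k] k), IsCoordinateSystem x D by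
    obtain ⟨n, x, D, h⟩ := h
    have := h.finrank_eq
    subst this
    exact ⟨x, D, h⟩
  let Q : Submodule k A := Submodule.span k {1} ⊔ (augIdeal k A ^ 2).restrictScalars k
  have hQ : Q.dualAnnihilator = tangentSpace k A := by
    ext D
    rw [Submodule.mem_dualAnnihilator]
    constructor
    · intro h a b
      have h1 : D 1 = 0 := h 1 (Submodule.mem_sup_left (Submodule.mem_span_singleton_self 1))
      have hc : ∀ c : k, D (algebraMap k A c) = 0 := fun c => by
        rw [Algebra.algebraMap_eq_smul_one, map_smul, h1, smul_zero]
      have h2 : D ((a - algebraMap k A (counit (R := k) a)) *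
          (b - algebraMap k A (counit (R := k) b))) = 0 := by
        refine h _ (Submodule.mem_sup_right ?_)
        change _ ∈ augIdeal k A ^ 2
        rw [sq]
        exact Ideal.mul_mem_mul (sub_counit_mem_augIdeal a) (sub_counit_mem_augIdeal b)
      have e : (a - algebraMap k A (counit (R := k) a)) * (b - algebraMap k A (counit (R := k) b)) =
          a * b - counit (R := k) a • b - counit (R := k) b • a +
            algebraMap k A (counit (R := k) a * counit (R := k) b) := by
        simp only [Algebra.smul_def, map_mul]; ring
      rw [e, map_add, map_sub, map_sub, map_smul, map_smul, hc, add_zero, sub_sub,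
        sub_eq_zero] at h2
      rw [h2, smul_eq_mul, smul_eq_mul]; ring
    · intro hD a ha
      have hD : AlgRep.IsTangent D := hD
      obtain ⟨y, hy, z, hz, rfl⟩ := Submodule.mem_sup.mp ha
      obtain ⟨c, rfl⟩ := Submodule.mem_span_singleton.mp hy
      rw [map_add, map_smul, hD.map_one, smul_zero, zero_add]
      exact hD.map_of_mem_sq hz
  have hfin : Module.Finite k (Module.Dual k (A ⧸ Q)) := by
    have : Module.Finite k Q.dualAnnihilator := by rw [hQ]; infer_instance
    exact Module.Finite.equiv Q.dualQuotEquivDualAnnihilator.symm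
  have hfin' : Module.Finite k (A ⧸ Q) := by
    rwa [Module.finite_dual_iff] at hfin
  let b := finBasis k (A ⧸ Q)
  choose y hy using fun j => Submodule.mkQ_surjective Q (b j)
  let x := fun j => y j - algebraMap k A (counit (R := k) (y j))
  have hone : ∀ c : k, algebraMap k A c ∈ Q := fun c => by
    rw [Algebra.algebraMap_eq_smul_one]
    exact Submodule.mem_sup_left (Submodule.smul_mem _ _ (Submodule.mem_span_singleton_self 1))
  have hx : ∀ j, Q.mkQ (x j) = b j := fun j => by
    rw [map_sub, hy, sub_eq_self, Submodule.mkQ_apply, Submodule.Quotient.mk_eq_zero]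
    exact hone _
  have hxm : ∀ j, counit (R := k) (x j) = 0 := fun j => sub_counit_mem_augIdeal (y j)
  refine ⟨_, x, fun i => b.coord i ∘ₗ Q.mkQ, hxm, fun i => ?_, fun i j => ?_, fun a => ?_⟩
  · have : b.coord i ∘ₗ Q.mkQ ∈ Q.dualAnnihilator := by
      rw [Submodule.mem_dualAnnihilator]
      intro q hq
      rw [LinearMap.comp_apply, Submodule.mkQ_apply, (Submodule.Quotient.mk_eq_zero Q).mpr hq,
        map_zero]
    rw [hQ] at this
    exact this
  · rw [LinearMap.comp_apply, hx, Basis.coord_apply, Basis.repr_self, Finsupp.single_apply]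
    simp [eq_comm]
  · refine ⟨fun j => b.repr (Q.mkQ a) j, ?_⟩
    set z := a - algebraMap k A (counit (R := k) a) - ∑ j, b.repr (Q.mkQ a) j • x j
    have hz : z ∈ Q := by
      rw [← Submodule.Quotient.mk_eq_zero, ← Submodule.mkQ_apply]
      have h1 : Q.mkQ (algebraMap k A (counit (R := k) a)) = 0 := by
        rw [Submodule.mkQ_apply, Submodule.Quotient.mk_eq_zero]; exact hone _
      simp only [z, map_sub, map_sum, map_smul, hx, h1, b.sum_repr]
      simp
    have hz0 : counit (R := k) z = 0 := by
      simp [z, hxm]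
    obtain ⟨u, hu, q, hq, huq⟩ := Submodule.mem_sup.mp hz
    obtain ⟨c, rfl⟩ := Submodule.mem_span_singleton.mp hu
    have hq2 : q ∈ augIdeal k A ^ 2 := hq
    have hq0 : counit (R := k) q = 0 := mem_augIdeal.mp (Ideal.pow_le_self two_ne_zero hq2)
    rw [← huq, map_add, hq0, add_zero, map_smul, Bialgebra.counit_one, smul_eq_mul,
      mul_one] at hz0
    rw [← huq, hz0, zero_smul, zero_add]
    exact hq2

/-- The extension of a linear form to `L ⊗ A`. -/
def extendForm (L : Type*) [Field L] [Algebra k L] (D : A →ₗ[k] k) : L ⊗[k] A →ₗ[L] L :=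
  (TensorProduct.AlgebraTensorModule.rid k L L).toLinearMap ∘ₗ D.baseChange L

@[simp]
theorem extendForm_tmul (L : Type*) [Field L] [Algebra k L] (D : A →ₗ[k] k) (l : L) (a : A) :
    extendForm L D (l ⊗ₜ a) = D a • l := by
  simp [extendForm]

theorem AlgRep.IsTangent.extendForm (L : Type*) [Field L] [Algebra k L] {D : A →ₗ[k] k}
    (hD : AlgRep.IsTangent D) : AlgRep.IsTangent (extendForm L D) := by
  intro a b
  induction a with
  | zero => simp
  | add x y hx hy => simp only [add_mul, map_add, hx, hy]; ring
  | tmul l a =>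
    induction b with
    | zero => simp
    | add x y hx hy => simp only [mul_add, map_add, hx, hy]; ring
    | tmul l' a' =>
      simp only [Algebra.TensorProduct.tmul_mul_tmul, extendForm_tmul, hD a a',
        TensorProduct.counit_tmul, CommSemiring.counit_apply, Algebra.smul_def, map_add, map_mul]
      ring

/-- This permits passing to the algebraic closure, where every maximal ideal is a rational point,
and it lets the same tangent matrices serve over every extension. -/
theorem IsCoordinateSystem.baseChange (L : Type*) [Field L] [Algebra k L] {n : ℕ} {x : Fin n → A}
    {D : Fin n → A →ₗ[k] k} (h : IsCoordinateSystem x D) :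
    IsCoordinateSystem (k := L) (A := L ⊗[k] A) (fun i => 1 ⊗ₜ x i) (fun i => extendForm L (D i)) where
  counit_eq i := by simp [h.counit_eq]
  isTangent i := (h.isTangent i).extendForm L
  apply_eq i j := by simp [h.apply_eq]
  generate a := by
    have hm : (augIdeal k A).map (Algebra.TensorProduct.includeRight : A →ₐ[k] L ⊗[k] A) ≤
        augIdeal L (L ⊗[k] A) := by
      rw [Ideal.map_le_iff_le_comap]
      intro a ha
      rw [Ideal.mem_comap, mem_augIdeal]
      simp [mem_augIdeal.mp ha]
    have hm2 : ∀ a ∈ augIdeal k A ^ 2, (1 : L) ⊗ₜ[k] a ∈ augIdeal L (L ⊗[k] A) ^ 2 := by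
      intro a ha
      have := Ideal.mem_map_of_mem (Algebra.TensorProduct.includeRight : A →ₐ[k] L ⊗[k] A) ha
      rw [Ideal.map_pow] at this
      exact Ideal.pow_right_mono hm 2 this
    induction a with
    | zero => exact ⟨0, by simp⟩
    | add a b ha hb =>
      obtain ⟨c, hc⟩ := ha
      obtain ⟨d, hd⟩ := hb
      refine ⟨c + d, ?_⟩
      have := Ideal.add_mem _ hc hd
      convert! this using 1
      simp only [map_add, Pi.add_apply, add_smul, Finset.sum_add_distrib]
      abel
    | tmul l a =>
      obtain ⟨c, hc⟩ := h.generate a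
      refine ⟨fun j => c j • l, ?_⟩
      have := Ideal.mul_mem_left _ (l ⊗ₜ[k] (1 : A)) (hm2 _ hc)
      convert! this using 1
      simp only [TensorProduct.tmul_sub, TensorProduct.tmul_sum, mul_sub, Finset.mul_sum,
        Algebra.TensorProduct.tmul_mul_tmul, mul_one, one_mul, TensorProduct.counit_tmul,
        CommSemiring.counit_apply, Algebra.TensorProduct.algebraMap_apply, Algebra.algebraMap_self,
        RingHom.id_apply, TensorProduct.tmul_smul]
      congr 1
      · congr 1
        rw [Algebra.algebraMap_eq_smul_one, TensorProduct.tmul_smul, TensorProduct.smul_tmul']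
      · refine Finset.sum_congr rfl fun j _ => ?_
        rw [TensorProduct.smul_tmul', TensorProduct.smul_tmul', Algebra.TensorProduct.tmul_mul_tmul,
          one_mul, mul_smul_comm, mul_one, smul_eq_mul, mul_one]

end Tangent

/-! ### Quasi-regularity of coordinates: the smooth case and characteristic zero. -/

section QuasiRegular

open MvPolynomial Coalgebra

/-- `u` and `v` lie in `m ^ k` and agree modulo `m ^ (k + 1)`. -/
def SameLeading {S : Type*} [CommRing S] (m : Ideal S) (k : ℕ) (u v : S) : Prop :=
  u ∈ m ^ k ∧ v ∈ m ^ k ∧ u - v ∈ m ^ (k + 1)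

theorem SameLeading.mul {S : Type*} [CommRing S] {m : Ideal S} {k l : ℕ} {u v u' v' : S}
    (h : SameLeading m k u v) (h' : SameLeading m l u' v') :
    SameLeading m (k + l) (u * u') (v * v') := by
  refine ⟨?_, ?_, ?_⟩
  · rw [pow_add]; exact Ideal.mul_mem_mul h.1 h'.1
  · rw [pow_add]; exact Ideal.mul_mem_mul h.2.1 h'.2.1
  · have e : u * u' - v * v' = (u - v) * u' + v * (u' - v') := by ring
    rw [e]
    refine Ideal.add_mem _ ?_ ?_
    · have := Ideal.mul_mem_mul h.2.2 h'.1
      rwa [← pow_add, show k + 1 + l = k + l + 1 by ring] at this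
    · have := Ideal.mul_mem_mul h.2.1 h'.2.2
      rwa [← pow_add, ← add_assoc] at this

theorem SameLeading.one {S : Type*} [CommRing S] (m : Ideal S) : SameLeading m 0 1 1 := by
  refine ⟨?_, ?_, ?_⟩ <;> simp

theorem SameLeading.pow {S : Type*} [CommRing S] {m : Ideal S} {u v : S}
    (h : SameLeading m 1 u v) (k : ℕ) : SameLeading m k (u ^ k) (v ^ k) := by
  induction k with
  | zero => simpa using SameLeading.one m
  | succ k ih => simpa only [pow_succ] using ih.mul h

theorem SameLeading.prod {S : Type*} [CommRing S] {m : Ideal S} {σ : Type*} {u v : σ → S}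
    (h : ∀ i, SameLeading m 1 (u i) (v i)) (s : Finset σ) (d : σ → ℕ) :
    SameLeading m (∑ i ∈ s, d i) (∏ i ∈ s, u i ^ d i) (∏ i ∈ s, v i ^ d i) := by
  classical
  induction s using Finset.induction_on with
  | empty => simpa using SameLeading.one m
  | insert i s hi ih =>
    rw [Finset.sum_insert hi, Finset.prod_insert hi, Finset.prod_insert hi]
    exact ((h i).pow (d i)).mul ih

variable {k : Type*} [Field k]

theorem aeval_sub_aeval_mem_of_isHomogeneous {S : Type*} [CommRing S] [Algebra k S]
    {m : Ideal S} {σ : Type*} {u v : σ → S} (h : ∀ i, SameLeading m 1 (u i) (v i)) {n : ℕ}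
    {p : MvPolynomial σ k} (hp : p.IsHomogeneous n) : aeval u p - aeval v p ∈ m ^ (n + 1) := by
  rw [p.as_sum, map_sum, map_sum, ← Finset.sum_sub_distrib]
  refine Ideal.sum_mem _ fun d hd => ?_
  rw [aeval_monomial, aeval_monomial, ← mul_sub]
  refine Ideal.mul_mem_left _ _ ?_
  have h1 := (SameLeading.prod h d.support d).2.2
  have h2 : ∑ i ∈ d.support, d i = n := by
    rw [← hp (mem_support_iff.mp hd), Finsupp.weight_apply]
    simp [Finsupp.sum]
  rw [h2] at h1
  exact h1

variable {A : Type*} [CommRing A] [HopfAlgebra k A]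

/-- Coordinates at the identity of a smooth group are quasi-regular. -/
theorem IsCoordinateSystem.isQuasiRegular_of_formallySmooth [Algebra.FormallySmooth k A] {n : ℕ}
    {x : Fin n → A} {D : Fin n → A →ₗ[k] k} (h : IsCoordinateSystem x D) :
    IsQuasiRegular k (augIdeal k A) x := by
  intro r p hp hpm
  set I : Ideal (MvPolynomial (Fin n) k) := idealOfVars (Fin n) k
  set N := r + 2
  let π := Ideal.Quotient.mkₐ k (I ^ N)
  set J : Ideal (MvPolynomial (Fin n) k ⧸ I ^ N) := (I ^ 2).map π with hJ
  have hJnil : IsNilpotent J := by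
    refine ⟨N, ?_⟩
    rw [hJ, ← Ideal.map_pow, ← pow_mul, Ideal.zero_eq_bot, Ideal.map_eq_bot_iff_le_ker]
    intro q hq
    rw [RingHom.mem_ker]
    exact Ideal.Quotient.eq_zero_iff_mem.mpr (Ideal.pow_le_pow_right (by omega) hq)
  -- The first-order Taylor expansion at the identity is multiplicative modulo `I ^ 2`. Formal
  -- smoothness lifts it to an algebra map `f` into polynomials modulo `I ^ N`, with `N` large
  -- enough for degree `r` to stay visible.
  let f₀ : A →ₗ[k] MvPolynomial (Fin n) k :=
    Algebra.linearMap k _ ∘ₗ counit + ∑ i, (LinearMap.mulRight k (X i)) ∘ₗ Algebra.linearMap k _ ∘ₗ D i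
  have hf₀ : ∀ a, f₀ a = C (counit (R := k) a) + ∑ i, C (D i a) * X i := by
    intro a
    simp [f₀, MvPolynomial.algebraMap_eq]
  have hX : ∀ i, (X i : MvPolynomial (Fin n) k) ∈ I := fun i => Ideal.subset_span ⟨i, rfl⟩
  have hlin : ∀ a, ∑ i, C (D i a) * X i ∈ I := fun a =>
    Ideal.sum_mem _ fun i _ => Ideal.mul_mem_left _ _ (hX i)
  let f₁ : A →ₐ[k] (MvPolynomial (Fin n) k ⧸ I ^ N) ⧸ J :=
    AlgHom.ofLinearMap ((Ideal.Quotient.mkₐ k J).toLinearMap ∘ₗ π.toLinearMap ∘ₗ f₀)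
      (by
        change Ideal.Quotient.mkₐ k J (π (f₀ 1)) = 1
        simp [hf₀, (h.isTangent _).map_one])
      (by
        intro a b
        change Ideal.Quotient.mkₐ k J (π (f₀ (a * b))) =
          Ideal.Quotient.mkₐ k J (π (f₀ a)) * Ideal.Quotient.mkₐ k J (π (f₀ b))
        rw [← map_mul, ← map_mul]
        refine Ideal.Quotient.eq.mpr ?_
        rw [← map_sub]
        refine Ideal.mem_map_of_mem _ ?_
        have e : f₀ (a * b) - f₀ a * f₀ b =
            -((∑ i, C (D i a) * X i) * (∑ i, C (D i b) * X i)) := by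
          simp only [hf₀, Bialgebra.counit_mul, h.isTangent _ a b, map_add, map_mul, add_mul,
            Finset.sum_add_distrib, mul_add, mul_assoc, ← Finset.mul_sum]
          simp only [mul_left_comm (C (D _ a)), ← Finset.mul_sum]
          ring
        rw [e, sq, neg_mem_iff]
        exact Ideal.mul_mem_mul (hlin a) (hlin b))
  obtain ⟨f, hf⟩ := Algebra.FormallySmooth.exists_lift J hJnil f₁
  have hfa : ∀ a, f a - π (f₀ a) ∈ J := fun a => by
    have := AlgHom.congr_fun hf a
    exact Ideal.Quotient.eq.mp this
  have hπ : Function.Surjective π := Ideal.Quotient.mk_surjective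
  have hlift : ∀ a, ∃ q : MvPolynomial (Fin n) k, π q = f a ∧ q - f₀ a ∈ I ^ 2 := by
    intro a
    obtain ⟨z, hz, hza⟩ := (Ideal.mem_map_iff_of_surjective _ hπ).mp (hfa a)
    exact ⟨f₀ a + z, by rw [map_add, hza]; ring, by simpa using hz⟩
  choose q hq hq2 using hlift
  have hqm : ∀ a ∈ augIdeal k A, q a ∈ I := by
    intro a ha
    have h1 : f₀ a ∈ I := by
      rw [hf₀, mem_augIdeal.mp ha, map_zero, zero_add]
      exact hlin a
    have := I.add_mem (Ideal.pow_le_self two_ne_zero (hq2 a)) h1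
    simpa using this
  have hfm : (augIdeal k A).map f ≤ I.map π := by
    rw [Ideal.map_le_iff_le_comap]
    intro a ha
    rw [Ideal.mem_comap, ← hq a]
    exact Ideal.mem_map_of_mem _ (hqm a ha)
  have h1 : f (aeval x p) ∈ (I ^ (r + 1)).map π := by
    rw [Ideal.map_pow]
    refine Ideal.pow_right_mono hfm _ ?_
    rw [← Ideal.map_pow]
    exact Ideal.mem_map_of_mem f hpm
  have h2 : f (aeval x p) = π (aeval (fun i => q (x i)) p) := by
    rw [← AlgHom.comp_apply, ← AlgHom.comp_apply]
    congr 1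
    ext i
    simp [hq]
  rw [h2] at h1
  obtain ⟨z, hz, hzp⟩ := (Ideal.mem_map_iff_of_surjective _ hπ).mp h1
  have h3 : z - aeval (fun i => q (x i)) p ∈ I ^ N := Ideal.Quotient.eq.mp hzp
  have h4 : aeval (fun i => q (x i)) p ∈ I ^ (r + 1) := by
    have := (I ^ (r + 1)).sub_mem hz (Ideal.pow_le_pow_right (by omega) h3)
    simpa using this
  -- Since `f` takes `x i` to `X i` up to order two, it takes `p(x)` to `p` modulo `I ^ (r + 1)`. As
  -- `f` also takes `m ^ (r + 1)` into the image of `I ^ (r + 1)`, the form `p` of degree `r` must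
  -- vanish.
  have h5 : ∀ i, SameLeading I 1 (q (x i)) (X i) := by
    intro i
    refine ⟨by simpa using hqm _ (h.counit_eq i), by simpa using hX i, ?_⟩
    have : f₀ (x i) = X i := by
      rw [hf₀, h.counit_eq, map_zero, zero_add]
      simp [h.apply_eq]
    rw [← this]
    exact hq2 (x i)
  have h6 := aeval_sub_aeval_mem_of_isHomogeneous h5 hp
  have h7 : p ∈ I ^ (r + 1) := by
    have := (I ^ (r + 1)).sub_mem h4 h6
    simpa [aeval_X_left] using this
  rw [mem_pow_idealOfVars_iff] at h7
  by_contra hp0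
  obtain ⟨d, hd⟩ := Finset.nonempty_iff_ne_empty.mpr (mt support_eq_empty.mp hp0)
  have h8 := h7 d hd
  have h9 := hp (mem_support_iff.mp hd)
  rw [Finsupp.weight_apply] at h9
  simp only [Pi.one_apply, smul_eq_mul, mul_one] at h9
  rw [Finsupp.degree_apply] at h8
  simp only [Finsupp.sum] at h9
  omega

/-- The left-invariant derivation attached to a tangent vector. -/
def invariantDerivation (D : A →ₗ[k] k) : A →ₗ[k] A :=
  (TensorProduct.rid k A).toLinearMap ∘ₗ D.lTensor A ∘ₗ comul

theorem AlgRep.IsTangent.invariantDerivation_mul {D : A →ₗ[k] k} (hD : AlgRep.IsTangent D) (a b : A) :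
    invariantDerivation D (a * b) = a * invariantDerivation D b + invariantDerivation D a * b := by
  have key : ∀ y z : A ⊗[k] A, TensorProduct.rid k A (D.lTensor A (y * z)) =
      TensorProduct.rid k A ((Coalgebra.counit (R := k) (A := A)).lTensor A y) *
        TensorProduct.rid k A (D.lTensor A z) +
      TensorProduct.rid k A (D.lTensor A y) *
        TensorProduct.rid k A ((Coalgebra.counit (R := k) (A := A)).lTensor A z) := by
    intro y z
    induction y with
    | zero => simp
    | add y y' hy hy' => simp only [add_mul, map_add, hy, hy']; ring
    | tmul a b =>
      induction z with
      | zero => simp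
      | add z z' hz hz' => simp only [mul_add, map_add, hz, hz']; ring
      | tmul c d =>
        simp only [Algebra.TensorProduct.tmul_mul_tmul, LinearMap.lTensor_tmul, hD b d,
          TensorProduct.rid_tmul, Algebra.smul_def, map_add, map_mul]
        ring
  have h1 := key (comul (R := k) a) (comul (R := k) b)
  rw [← Bialgebra.comul_mul, Coalgebra.lTensor_counit_comul, Coalgebra.lTensor_counit_comul,
    TensorProduct.rid_tmul, TensorProduct.rid_tmul, one_smul, one_smul] at h1
  exact h1

theorem counit_invariantDerivation (D : A →ₗ[k] k) (a : A) :
    counit (R := k) (invariantDerivation D a) = D a := by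
  have h : ∀ z : A ⊗[k] A, counit (R := k) (TensorProduct.rid k A (D.lTensor A z)) =
      D (TensorProduct.lid k A ((counit (R := k) (A := A)).rTensor A z)) := by
    intro z
    induction z with
    | zero => simp
    | add z z' hz hz' => simp only [map_add, hz, hz']
    | tmul a b => simp [mul_comm]
  have h1 := h (comul (R := k) a)
  rw [Coalgebra.rTensor_counit_comul, TensorProduct.lid_tmul, one_smul] at h1
  exact h1

theorem AlgRep.IsTangent.invariantDerivation_mem {D : A →ₗ[k] k} (hD : AlgRep.IsTangent D) (r : ℕ)
    {a : A} (ha : a ∈ augIdeal k A ^ (r + 1)) : invariantDerivation D a ∈ augIdeal k A ^ r := by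
  induction r generalizing a with
  | zero => simp
  | succ r ih =>
    rw [pow_succ] at ha
    induction ha using Submodule.mul_induction_on' with
    | mem_mul_mem u hu v hv =>
      rw [hD.invariantDerivation_mul]
      refine Ideal.add_mem _ (Ideal.mul_mem_right _ _ hu) ?_
      rw [pow_succ]
      exact Ideal.mul_mem_mul (ih hu) hv
    | add u _ v _ hu hv => rw [map_add]; exact Ideal.add_mem _ hu hv

theorem AlgRep.IsTangent.invariantDerivation_aeval {D : A →ₗ[k] k} (hD : AlgRep.IsTangent D) {n : ℕ}
    (x : Fin n → A) (p : MvPolynomial (Fin n) k) :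
    invariantDerivation D (aeval x p) =
      ∑ j, aeval x (pderiv j p) * invariantDerivation D (x j) := by
  have hone : invariantDerivation D 1 = 0 := by
    have := hD.invariantDerivation_mul 1 1
    simpa using this
  induction p using MvPolynomial.induction_on with
  | C c =>
    simp only [algHom_C, pderiv_C, map_zero, zero_mul, Finset.sum_const_zero]
    rw [Algebra.algebraMap_eq_smul_one, map_smul, hone, smul_zero]
  | add p q hp hq => simp only [map_add, hp, hq, add_mul, Finset.sum_add_distrib]
  | mul_X p i hp =>
    rw [map_mul, hD.invariantDerivation_mul, hp, aeval_X]
    simp only [Derivation.leibniz, smul_eq_mul, map_add, map_mul, aeval_X, pderiv_X, add_mul,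
      Finset.sum_add_distrib]
    congr 1
    · rw [Finset.sum_eq_single i]
      · simp
      · intro j _ hj
        simp [hj.symm]
      · simp
    · rw [Finset.sum_mul]
      exact Finset.sum_congr rfl fun j _ => by ring

/-- Coordinates at the identity are quasi-regular in characteristic zero. -/
theorem IsCoordinateSystem.isQuasiRegular_of_charZero [CharZero k] {n : ℕ} {x : Fin n → A}
    {D : Fin n → A →ₗ[k] k} (h : IsCoordinateSystem x D) :
    IsQuasiRegular k (augIdeal k A) x := by
  intro r
  induction r with
  | zero =>
    intro p hp hpm
    rw [← totalDegree_zero_iff_isHomogeneous, totalDegree_eq_zero_iff_eq_C] at hp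
    rw [hp] at hpm ⊢
    rw [zero_add, pow_one, mem_augIdeal, algHom_C, Bialgebra.counit_algebraMap] at hpm
    rw [hpm, map_zero]
  | succ r ih =>
    intro p hp hpm
    -- The invariant derivation of `D i` lowers the order at the identity by at most one, and its
    -- value on `x j` at the identity is the Kronecker delta. So it takes `p(x)` to `(∂ᵢ p)(x)`
    -- modulo `m ^ (r + 1)`, and induction applies to `∂ᵢ p`.
    have hder : ∀ i, pderiv i p = 0 := by
      intro i
      have hpi : ∀ j, (pderiv j p).IsHomogeneous r := fun j => by
        simpa using hp.pderiv (i := j)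
      refine ih _ (hpi i) ?_
      have h1 := (h.isTangent i).invariantDerivation_mem (r + 1) hpm
      rw [(h.isTangent i).invariantDerivation_aeval] at h1
      have h2 : ∑ j, aeval x (pderiv j p) * (invariantDerivation (D i) (x j) -
          if i = j then 1 else 0) ∈ augIdeal k A ^ (r + 1) := by
        refine Ideal.sum_mem _ fun j _ => ?_
        rw [pow_succ]
        refine Ideal.mul_mem_mul ?_ ?_
        · refine aeval_mem_pow_of_mem_pow_idealOfVars (fun i => h.counit_eq i) ?_
          rw [mem_pow_idealOfVars_iff]
          intro d hd
          have := hpi j (mem_support_iff.mp hd)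
          rw [Finsupp.weight_apply] at this
          simp only [Pi.one_apply, smul_eq_mul, mul_one, Finsupp.sum] at this
          rw [Finsupp.degree_apply, this]
        · rw [mem_augIdeal, map_sub, counit_invariantDerivation, h.apply_eq]
          split_ifs <;> simp
      have h3 := Ideal.sub_mem _ h1 h2
      rw [← Finset.sum_sub_distrib] at h3
      simpa [← mul_sub] using h3
    -- Euler's identity yields `(r + 1) p = 0`; characteristic zero enters here.
    have h4 := hp.sum_X_mul_pderiv
    simp only [hder, mul_zero, Finset.sum_const_zero] at h4
    rw [eq_comm, ← Nat.cast_smul_eq_nsmul k] at h4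
    exact (smul_eq_zero.mp h4).resolve_left (by exact_mod_cast r.succ_ne_zero)

/-- Polynomials in the coordinates approximate elements of the powers of the augmentation ideal. -/
theorem IsCoordinateSystem.exists_isHomogeneous {n : ℕ} {x : Fin n → A} {D : Fin n → A →ₗ[k] k}
    (h : IsCoordinateSystem x D) (r : ℕ) : ∀ a ∈ augIdeal k A ^ r,
    ∃ p : MvPolynomial (Fin n) k, p.IsHomogeneous r ∧ a - aeval x p ∈ augIdeal k A ^ (r + 1) := by
  induction r with
  | zero =>
    intro a _
    refine ⟨C (counit (R := k) a), isHomogeneous_C _ _, ?_⟩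
    rw [algHom_C, zero_add, pow_one]
    exact sub_counit_mem_augIdeal a
  | succ r ih =>
    intro a ha
    rw [pow_succ] at ha
    induction ha using Submodule.mul_induction_on' with
    | mem_mul_mem u hu v hv =>
      obtain ⟨p, hp, hup⟩ := ih u hu
      obtain ⟨c, hc⟩ := h.generate v
      rw [mem_augIdeal.mp hv, map_zero, sub_zero] at hc
      have hl : aeval x (∑ j, C (c j) * X j : MvPolynomial (Fin n) k) = ∑ j, c j • x j := by
        simp [Algebra.smul_def]
      refine ⟨p * ∑ j, C (c j) * X j, hp.mul (IsHomogeneous.sum _ _ _ fun j _ => ?_), ?_⟩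
      · simpa using (isHomogeneous_C (Fin n) (c j)).mul (isHomogeneous_X k j)
      · have e : u * v - aeval x (p * ∑ j, C (c j) * X j) =
            (u - aeval x p) * v + aeval x p * (v - ∑ j, c j • x j) := by
          rw [map_mul, hl]; ring
        rw [e]
        refine Ideal.add_mem _ ?_ ?_
        · rw [pow_succ]
          exact Ideal.mul_mem_mul hup hv
        · have hpm : aeval x p ∈ augIdeal k A ^ r := by
            have := Ideal.sub_mem _ hu (Ideal.pow_le_pow_right r.le_succ hup)
            simpa using this
          have := Ideal.mul_mem_mul hpm hc
          rwa [← pow_add] at this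
    | add u _ v _ hu hv =>
      obtain ⟨p, hp, hup⟩ := hu
      obtain ⟨q, hq, hvq⟩ := hv
      refine ⟨p + q, hp.add hq, ?_⟩
      have := Ideal.add_mem _ hup hvq
      rw [map_add]
      convert! this using 1
      ring

end QuasiRegular

/-! ### Dimension against tangent dimension, reducedness, Cartier's theorem. -/

section Smoothness

open MvPolynomial Coalgebra Module

variable {k : Type*} [Field k] {A : Type*} [CommRing A] [HopfAlgebra k A]

theorem comap_pointTranslate_augIdeal (g : A →ₐ[k] k) :
    (augIdeal k A).comap (pointTranslate g) = RingHom.ker g := by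
  ext a
  rw [Ideal.mem_comap, mem_augIdeal, counit_pointTranslate, RingHom.mem_ker]

theorem IsCoordinateSystem.augIdeal_le {n : ℕ} {x : Fin n → A} {D : Fin n → A →ₗ[k] k}
    (h : IsCoordinateSystem x D) : augIdeal k A ≤ Ideal.span (Set.range x) ⊔ augIdeal k A ^ 2 := by
  intro a ha
  obtain ⟨c, hc⟩ := h.generate a
  rw [mem_augIdeal.mp ha, map_zero, sub_zero] at hc
  rw [← sub_add_cancel a (∑ j, c j • x j), add_comm]
  refine Submodule.add_mem_sup (Ideal.sum_mem _ fun j _ => ?_) hc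
  rw [Algebra.smul_def]
  exact Ideal.mul_mem_left _ _ (Ideal.subset_span ⟨j, rfl⟩)

instance augIdeal_isMaximal : (augIdeal k A).IsMaximal :=
  RingHom.ker_isMaximal_of_surjective _ fun c => ⟨algebraMap k A c, by simp⟩

/-- The Krull dimension is bounded by the heights of maximal ideals. Each is the kernel of a
rational point, and translation carries it to the augmentation ideal, where `n` coordinates generate
modulo the square. -/
theorem IsCoordinateSystem.ringKrullDim_le_of_isAlgClosed [IsAlgClosed k] [Algebra.FiniteType k A]
    {n : ℕ} {x : Fin n → A} {D : Fin n → A →ₗ[k] k} (h : IsCoordinateSystem x D) :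
    ringKrullDim A ≤ n := by
  have : IsNoetherianRing A := Algebra.FiniteType.isNoetherianRing k A
  rw [ringKrullDim_le_iff_isMaximal_height_le]
  intro M hM
  obtain ⟨g, rfl⟩ := exists_algHom_ker_eq_of_isMaximal (F := k) k M
  have h1 := RingEquiv.height_comap (pointTranslate g).toRingEquiv (augIdeal k A)
  have h2 := Ideal.height_le_of_le_span_sup_sq (augIdeal k A) x (fun i => h.counit_eq i) h.augIdeal_le
  rw [← h1] at h2
  have h3 := comap_pointTranslate_augIdeal g
  rw [← h3]
  exact_mod_cast h2

/-- Extending scalars to the algebraic closure is integral and injective, so it does not lower the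
dimension. -/
theorem IsCoordinateSystem.ringKrullDim_le [Algebra.FiniteType k A]
    {n : ℕ} {x : Fin n → A} {D : Fin n → A →ₗ[k] k} (h : IsCoordinateSystem x D) :
    ringKrullDim A ≤ n := by
  refine le_trans ?_ (h.baseChange (AlgebraicClosure k)).ringKrullDim_le_of_isAlgClosed
  rw [← ringKrullDim_eq_of_ringEquiv (Algebra.TensorProduct.comm k A (AlgebraicClosure k)).toRingEquiv]
  have : FaithfulSMul A (A ⊗[k] AlgebraicClosure k) := by
    rw [faithfulSMul_iff_algebraMap_injective]
    exact Algebra.TensorProduct.includeLeft_injective (S := k) (algebraMap k (AlgebraicClosure k)).injective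
  exact ringKrullDim_le_of_isIntegral A (A ⊗[k] AlgebraicClosure k)

theorem ringKrullDim_le_finrank_tangentSpace [Algebra.FiniteType k A] :
    ringKrullDim A ≤ finrank k (tangentSpace k A) := by
  obtain ⟨x, D, h⟩ := exists_isCoordinateSystem (k := k) (A := A)
  exact h.ringKrullDim_le

theorem hopf_nontrivial (k : Type*) [Field k] (A : Type*) [CommRing A] [HopfAlgebra k A] :
    Nontrivial A := (Bialgebra.counitAlgHom k A).toRingHom.domain_nontrivial

/-- The dimension of a group is at most the dimension of its tangent space. -/
theorem affineDim_le_finrank_tangentSpace [Algebra.FiniteType k A] :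
    affineDim A ≤ finrank k (tangentSpace k A) := by
  have := hopf_nontrivial k A
  have h := ringKrullDim_le_finrank_tangentSpace (k := k) (A := A)
  rw [affineDim]
  generalize ringKrullDim A = d at *
  induction d using WithBot.recBotCoe with
  | bot => simp
  | coe d =>
    rw [WithBot.unbotD_coe]
    have h' : d ≤ (finrank k (tangentSpace k A) : ℕ∞) := by exact_mod_cast h
    exact ENat.toNat_le_of_le_natCast h'

/-- The upper bound holds for every group of finite type. The lower bound comes from smoothness,
which makes the coordinates quasi-regular. -/
theorem affineDim_eq_finrank_tangentSpace [Algebra.Smooth k A] :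
    affineDim A = finrank k (tangentSpace k A) := by
  have h := ringKrullDim_le_finrank_tangentSpace (k := k) (A := A)
  obtain ⟨x, D, hx⟩ := exists_isCoordinateSystem (k := k) (A := A)
  have h2 := IsQuasiRegular.le_ringKrullDim (Bialgebra.counitAlgHom k A)
    hx.isQuasiRegular_of_formallySmooth hx.counit_eq
  rw [affineDim, le_antisymm h h2]
  simp

/-- A group with quasi-regular coordinates at the identity over an algebraically closed field is
reduced. -/
theorem IsCoordinateSystem.isReduced [IsAlgClosed k] [Algebra.FiniteType k A]
    {n : ℕ} {x : Fin n → A} {D : Fin n → A →ₗ[k] k} (h : IsCoordinateSystem x D)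
    (hq : IsQuasiRegular k (augIdeal k A) x) : IsReduced A := by
  have : IsNoetherianRing A := Algebra.FiniteType.isNoetherianRing k A
  refine ⟨fun a ha => ?_⟩
  by_contra h0
  -- If `a ≠ 0`, its annihilator lies in the kernel of some rational point `g`. After translation to
  -- the identity, `a` is in all powers of the augmentation ideal. Krull's intersection theorem then
  -- gives an element that annihilates `a` and takes the value `1` at `g`, a contradiction.
  have hne : (⊥ : Ideal A).colon {a} ≠ ⊤ := by
    rw [Ne, Ideal.eq_top_iff_one]
    simpa [Submodule.mem_colon_singleton] using h0
  obtain ⟨M, hM, hle⟩ := Ideal.exists_le_maximal _ hne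
  obtain ⟨g, rfl⟩ := exists_algHom_ker_eq_of_isMaximal (F := k) k M
  have hb : ∀ r, pointTranslate g a ∈ augIdeal k A ^ r := fun r =>
    hq.mem_pow_of_isNilpotent (fun r => h.exists_isHomogeneous r) (ha.map (pointTranslate g)) r
  have h1 : pointTranslate g a ∈ (⨅ i : ℕ, augIdeal k A ^ i • ⊤ : Submodule A A) := by
    simpa [Submodule.mem_iInf] using hb
  obtain ⟨r, hr⟩ := (Ideal.mem_iInf_smul_pow_eq_bot_iff _ _).mp h1
  have h2 : (1 - (pointTranslate g).symm r.1) ∈ (⊥ : Ideal A).colon {a} := by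
    rw [Submodule.mem_colon_singleton, Ideal.mem_bot]
    apply (pointTranslate g).injective
    rw [smul_eq_mul, map_mul, map_sub, AlgEquiv.apply_symm_apply, map_one, map_zero, sub_mul, one_mul,
      ← smul_eq_mul r.1, hr, sub_self]
  have h3 := hle h2
  have h4 : g ((pointTranslate g).symm r.1) = 0 := by
    rw [← counit_pointTranslate, AlgEquiv.apply_symm_apply]
    exact r.2
  rw [RingHom.mem_ker, map_sub, map_one, h4, sub_zero] at h3
  exact one_ne_zero h3

theorem isReduced_of_smooth [Algebra.Smooth k A] : IsReduced A := by
  let K := AlgebraicClosure k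
  obtain ⟨x, D, hx⟩ := exists_isCoordinateSystem (k := k) (A := A)
  have h := hx.baseChange K
  have : IsReduced (K ⊗[k] A) := h.isReduced h.isQuasiRegular_of_formallySmooth
  exact isReduced_of_injective (Algebra.TensorProduct.includeRight : A →ₐ[k] K ⊗[k] A)
    (Algebra.TensorProduct.includeRight_injective (algebraMap k K).injective)

/-- Every reduced group over an algebraically closed field is smooth. -/
theorem smooth_of_isReduced [IsAlgClosed k] [Algebra.FiniteType k A] [IsReduced A] :
    Algebra.Smooth k A := by
  have : IsNoetherianRing A := Algebra.FiniteType.isNoetherianRing k A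
  have : Algebra.FinitePresentation k A := Algebra.FinitePresentation.of_finiteType.mp inferInstance
  have := hopf_nontrivial k A
  have hJ : IsJacobsonRing A := isJacobsonRing_of_finiteType (A := k)
  have htr : ∀ (e : A ≃ₐ[k] A) (p q : Ideal A) [p.IsPrime] [q.IsPrime], q.comap e = p →
      Algebra.IsSmoothAt k p → Algebra.IsSmoothAt k q := by
    intro e p q _ _ hpq hp
    refine Algebra.FormallySmooth.of_equiv (A := Localization.AtPrime p)
      (IsLocalization.algEquivOfAlgEquiv (M := p.primeCompl) (T := q.primeCompl) _ _ e ?_)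
    ext a
    rw [Submonoid.mem_map]
    constructor
    · rintro ⟨b, hb, rfl⟩ hq
      exact hb (hpq ▸ hq)
    · intro ha
      refine ⟨e.symm a, fun hp => ha ?_, e.apply_symm_apply a⟩
      have : e.symm a ∈ q.comap e := hpq ▸ hp
      simpa [Ideal.mem_comap] using this
  -- The local ring at a minimal prime of a reduced ring is a field, and it is formally smooth over
  -- the perfect field `k`.
  have hne : (Algebra.smoothLocus k A).Nonempty := by
    obtain ⟨p, hp⟩ := Ideal.nonempty_minimalPrimes (I := (⊥ : Ideal A)) bot_ne_top
    have hp' : p.IsPrime := hp.1.1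
    have h0 : p.height = 0 := Ideal.height_eq_zero_iff.mpr hp
    have hdim : Ring.KrullDimLE 0 (Localization.AtPrime p) := by
      rw [Ring.krullDimLE_iff, IsLocalization.AtPrime.ringKrullDim_eq_height p, h0]
      simp
    let := (Ring.KrullDimLE.isField_of_isReduced (R := Localization.AtPrime p)).toField
    have : Algebra.EssFiniteType A (Localization.AtPrime p) := .of_isLocalization _ p.primeCompl
    have : Algebra.EssFiniteType k (Localization.AtPrime p) := .comp k A _
    have hs : Algebra.FormallySmooth k (Localization.AtPrime p) := Algebra.FormallySmooth.of_perfectField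
    exact ⟨⟨p, hp'⟩, hs⟩
  -- In a Jacobson space the open smooth locus contains a closed point, here rational, and
  -- translation moves it to the identity. Moving back to any closed point shows that the complement
  -- contains none, hence is empty.
  obtain ⟨q, hq, hqc⟩ := nonempty_inter_closedPoints hne Algebra.isOpen_smoothLocus.isLocallyClosed
  rw [mem_closedPoints_iff, PrimeSpectrum.isClosed_singleton_iff_isMaximal] at hqc
  obtain ⟨g, hg⟩ := exists_algHom_ker_eq_of_isMaximal (F := k) k q.asIdeal
  have h1 : Algebra.IsSmoothAt k (augIdeal k A) := 
    htr (pointTranslate g) q.asIdeal (augIdeal k A) ((comap_pointTranslate_augIdeal g).trans hg) hq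
  have h2 : Algebra.smoothLocus k A = Set.univ := by
    by_contra hcon
    obtain ⟨q, hq, hqc⟩ := nonempty_inter_closedPoints
      (Set.nonempty_compl.mpr hcon) Algebra.isOpen_smoothLocus.isClosed_compl.isLocallyClosed
    rw [mem_closedPoints_iff, PrimeSpectrum.isClosed_singleton_iff_isMaximal] at hqc
    obtain ⟨g, hg⟩ := exists_algHom_ker_eq_of_isMaximal (F := k) k q.asIdeal
    refine hq (htr (pointTranslate g).symm (augIdeal k A) q.asIdeal ?_ h1)
    rw [← hg, ← comap_pointTranslate_augIdeal g]
    ext a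
    simp [Ideal.mem_comap]
  exact ⟨Algebra.smoothLocus_eq_univ_iff.mp h2, inferInstance⟩

/-- Cartier's theorem: groups in characteristic zero are smooth. -/
theorem smooth_of_charZero [CharZero k] [Algebra.FiniteType k A] : Algebra.Smooth k A := by
  let K := AlgebraicClosure k
  have : CharZero K := charZero_of_injective_algebraMap (algebraMap k K).injective
  obtain ⟨x, D, hx⟩ := exists_isCoordinateSystem (k := k) (A := A)
  have h := hx.baseChange K
  have : IsReduced (K ⊗[k] A) := h.isReduced h.isQuasiRegular_of_charZero
  have : Algebra.Smooth K (K ⊗[k] A) := smooth_of_isReduced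
  -- Smoothness over the algebraic closure descends along the faithfully flat extension of the base
  -- field.
  exact Algebra.Smooth.of_smooth_tensorProduct_of_faithfullyFlat K

end Smoothness

/-! ### The coefficient matrix of a representation, and stabilizers as subgroups. -/

namespace AlgRep

section Matrix

open Module

variable {k : Type*} [Field k] {A : Type*} [CommRing A] [HopfAlgebra k A]
  {M : Type*} [AddCommGroup M] [Module k M] {ι : Type*} [Fintype ι] [DecidableEq ι]

/-- The matrix over the coordinate ring through which the group acts on a basis. -/
def coeffMatrix (ρ : AlgRep k A M) (b : Basis ι k M) : Matrix ι ι A :=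
  Matrix.of fun i j => ρ.coeff (b j) (b.coord i)

omit [DecidableEq ι] in
theorem _root_.Module.Basis.sum_tmul_lid_rTensor {B : Type*} [AddCommGroup B] [Module k B]
    (b : Basis ι k M) (y : M ⊗[k] B) :
    ∑ i, b i ⊗ₜ[k] TensorProduct.lid k B ((b.coord i).rTensor B y) = y := by
  induction y with
  | zero => simp
  | add y z hy hz => simp only [map_add, TensorProduct.tmul_add, Finset.sum_add_distrib, hy, hz]
  | tmul m a =>
    simp only [LinearMap.rTensor_tmul, TensorProduct.lid_tmul, Basis.coord_apply,
      ← TensorProduct.smul_tmul, ← TensorProduct.sum_tmul, b.sum_repr]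

theorem _root_.Module.Basis.lid_rTensor_sum_tmul {B : Type*} [AddCommGroup B] [Module k B]
    (b : Basis ι k M) (e : ι → B) (j : ι) :
    TensorProduct.lid k B ((b.coord j).rTensor B (∑ i, b i ⊗ₜ[k] e i)) = e j := by
  simp [Finsupp.single_apply]

theorem _root_.Module.Basis.tmul_injective {B : Type*} [AddCommGroup B] [Module k B]
    (b : Basis ι k M) {e e' : ι → B} (h : ∑ i, b i ⊗ₜ[k] e i = ∑ i, b i ⊗ₜ[k] e' i) (i : ι) :
    e i = e' i := by
  rw [← b.lid_rTensor_sum_tmul e i, h, b.lid_rTensor_sum_tmul]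

variable (ρ : AlgRep k A M) (b : Basis ι k M)

omit [DecidableEq ι] in
theorem coact_eq_sum (m : M) : ρ.coact m = ∑ i, b i ⊗ₜ ρ.coeff m (b.coord i) :=
  (b.sum_tmul_lid_rTensor _).symm

omit [DecidableEq ι] in
theorem coact_basis (j : ι) : ρ.coact (b j) = ∑ i, b i ⊗ₜ ρ.coeffMatrix b i j :=
  ρ.coact_eq_sum b (b j)

theorem coeffMatrix_eq {e : ι → ι → A} {j : ι} (h : ρ.coact (b j) = ∑ i, b i ⊗ₜ e i j) (i : ι) :
    ρ.coeffMatrix b i j = e i j :=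
  b.tmul_injective ((ρ.coact_basis b j).symm.trans h) i

omit [DecidableEq ι] in
theorem coeff_coord (m : M) (i : ι) :
    ρ.coeff m (b.coord i) = ∑ j, b.repr m j • ρ.coeffMatrix b i j := by
  conv_lhs => rw [coeff, ← b.sum_repr m]
  simp only [map_sum, map_smul]
  rfl

omit [DecidableEq ι] in
theorem coeff_eq_sum (m : M) (φ : Module.Dual k M) :
    ρ.coeff m φ = ∑ i, φ (b i) • ρ.coeff m (b.coord i) := by
  conv_lhs => rw [coeff, ρ.coact_eq_sum b m]
  simp

omit [DecidableEq ι] in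
theorem contract_basis (D : A →ₗ[k] k) (j : ι) :
    ρ.contract D (b j) = ∑ i, D (ρ.coeffMatrix b i j) • b i := by
  simp [contract, ρ.coact_basis b]

theorem comul_coeffMatrix (i j : ι) : Coalgebra.comul (R := k) (ρ.coeffMatrix b i j) =
    ∑ l, ρ.coeffMatrix b i l ⊗ₜ[k] ρ.coeffMatrix b l j := by
  have h := LinearMap.congr_fun ρ.coassoc (b j)
  simp only [LinearMap.coe_comp, Function.comp_apply, LinearEquiv.coe_coe, ρ.coact_basis b j,
    map_sum, LinearMap.rTensor_tmul, LinearMap.lTensor_tmul, ρ.coact_basis b,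
    TensorProduct.sum_tmul, TensorProduct.assoc_tmul] at h
  rw [Finset.sum_comm] at h
  simp only [← TensorProduct.tmul_sum] at h
  exact (b.tmul_injective h i).symm

theorem counit_coeffMatrix (i j : ι) : Coalgebra.counit (R := k) (ρ.coeffMatrix b i j) =
    (1 : Matrix ι ι k) i j := by
  have h := LinearMap.congr_fun ρ.counit (b j)
  simp only [LinearMap.coe_comp, Function.comp_apply, LinearEquiv.coe_coe, ρ.coact_basis b j,
    map_sum, LinearMap.lTensor_tmul, TensorProduct.rid_tmul, LinearMap.id_apply] at h
  have h1 := congrArg (fun m => b.repr m i) h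
  simpa [Finsupp.single_apply, Matrix.one_apply, eq_comm] using h1

theorem sum_antipode_mul (i j : ι) : ∑ l, HopfAlgebra.antipode k (ρ.coeffMatrix b i l) *
    ρ.coeffMatrix b l j = (1 : Matrix ι ι A) i j := by
  have h := HopfAlgebra.mul_antipode_rTensor_comul_apply (R := k) (ρ.coeffMatrix b i j)
  rw [ρ.comul_coeffMatrix, ρ.counit_coeffMatrix] at h
  simpa [Matrix.one_apply, apply_ite (algebraMap k A)] using h

section Points

variable {B : Type*} [CommRing B] [Algebra k B]

open WithConv

theorem coeffMatrix_map_mul (x y : A →ₐ[k] B) :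
    (ρ.coeffMatrix b).map (toConv x * toConv y).ofConv =
      (ρ.coeffMatrix b).map x * (ρ.coeffMatrix b).map y := by
  ext i j
  rw [Matrix.map_apply, AlgHom.convMul_def]
  simp [ρ.comul_coeffMatrix, Matrix.mul_apply]

theorem coeffMatrix_map_one :
    (ρ.coeffMatrix b).map (1 : WithConv (A →ₐ[k] B)).ofConv = 1 := by
  ext i j
  rw [Matrix.map_apply, AlgHom.convOne_def]
  simp [ρ.counit_coeffMatrix, Matrix.one_apply]

theorem coeffMatrix_map_antipode_mul (g : A →ₐ[k] B) :
    (ρ.coeffMatrix b).map (g.comp (HopfAlgebra.antipodeAlgHom k A)) *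
      (ρ.coeffMatrix b).map g = 1 := by
  rw [← coeffMatrix_map_mul, toConv_antipode_mul_self, coeffMatrix_map_one]

end Points

section FixIdeal

omit [DecidableEq ι] in
-- Every linear form is a combination of coordinate forms, so the entries of `g w - w` generate the
-- ideal.
theorem fixIdeal_le_iff (W : Submodule k M) (J : Ideal A) : ρ.fixIdeal W ≤ J ↔
    ∀ m ∈ W, ∀ i, ∑ j, b.repr m j • ρ.coeffMatrix b i j - algebraMap k A (b.repr m i) ∈ J := by
  simp only [← ρ.coeff_coord b]
  rw [fixIdeal, Ideal.span_le]
  constructor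
  · intro h m hm i
    exact h ⟨m, hm, b.coord i, rfl⟩
  · rintro h _ ⟨m, hm, φ, rfl⟩
    have e : ρ.coeff m φ - algebraMap k A (φ m) =
        ∑ i, φ (b i) • (ρ.coeff m (b.coord i) - algebraMap k A (b.repr m i)) := by
      have e1 : φ m = ∑ i, φ (b i) * b.repr m i := by
        conv_lhs => rw [← b.sum_repr m]
        simp only [map_sum, map_smul, smul_eq_mul, mul_comm]
      rw [ρ.coeff_eq_sum b m φ, e1, map_sum, ← Finset.sum_sub_distrib]
      simp only [Algebra.smul_def, map_mul, mul_sub]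
    rw [e]
    refine Ideal.sum_mem _ fun i _ => ?_
    rw [Algebra.smul_def]
    exact Ideal.mul_mem_left _ _ (h m hm i)

omit [DecidableEq ι] in
theorem mem_fixIdeal (W : Submodule k M) {m : M} (hm : m ∈ W) (i : ι) :
    ∑ j, b.repr m j • ρ.coeffMatrix b i j - algebraMap k A (b.repr m i) ∈ ρ.fixIdeal W :=
  (ρ.fixIdeal_le_iff b W _).mp le_rfl m hm i

include b in
theorem fixIdeal_le_augIdeal (W : Submodule k M) : ρ.fixIdeal W ≤ augIdeal k A := by
  rw [ρ.fixIdeal_le_iff b]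
  intro m _ i
  rw [mem_augIdeal]
  simp [ρ.counit_coeffMatrix, Matrix.one_apply]

include b in
-- The identity fixes `W`, and products and inverses of elements that fix `W` fix `W`; these facts
-- are checked on generators. The quotient becomes a Hopf algebra, so the dimension theorems apply
-- to `G_W`.
theorem isHopfIdeal_fixIdeal (W : Submodule k M) : (ρ.fixIdeal W).IsHopfIdeal k where
  counit_eq_zero := fun x hx => ρ.fixIdeal_le_augIdeal b W hx
  map_mkQ_comul_eq_zero := by
    let q := Ideal.Quotient.mkₐ k (ρ.fixIdeal W)
    have hq : ∀ m ∈ W, ∀ i, ∑ j, b.repr m j • q (ρ.coeffMatrix b i j) =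
        algebraMap k _ (b.repr m i) := by
      intro m hm i
      have h1 : q (∑ j, b.repr m j • ρ.coeffMatrix b i j - algebraMap k A (b.repr m i)) = 0 :=
        Ideal.Quotient.eq_zero_iff_mem.mpr (ρ.mem_fixIdeal b W hm i)
      rw [map_sub, sub_eq_zero, map_sum] at h1
      simpa only [map_smul, AlgHom.commutes] using h1
    have h : ρ.fixIdeal W ≤ RingHom.ker
        ((Algebra.TensorProduct.map q q).comp (Bialgebra.comulAlgHom k A)) := by
      rw [ρ.fixIdeal_le_iff b]
      intro m hm i
      rw [RingHom.mem_ker]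
      simp only [map_sub, map_sum, map_smul, AlgHom.comp_apply, Bialgebra.comulAlgHom_apply,
        ρ.comul_coeffMatrix b, Algebra.TensorProduct.map_tmul, Finset.smul_sum, AlgHom.commutes]
      rw [Finset.sum_comm]
      simp only [← TensorProduct.tmul_smul, ← TensorProduct.tmul_sum, hq m hm,
        Algebra.algebraMap_eq_smul_one]
      simp only [TensorProduct.tmul_smul, TensorProduct.smul_tmul', ← TensorProduct.sum_tmul, hq m hm,
        Algebra.algebraMap_eq_smul_one, Algebra.TensorProduct.one_def, sub_self]
    intro x hx
    exact h hx
  antipode_mem := by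
    have h : ρ.fixIdeal W ≤ (ρ.fixIdeal W).comap (HopfAlgebra.antipodeAlgHom k A) := by
      rw [ρ.fixIdeal_le_iff b]
      intro m hm i
      rw [Ideal.mem_comap]
      -- This is `g⁻¹ w - w = -g⁻¹ (g w - w)` in coordinates.
      have e : HopfAlgebra.antipodeAlgHom k A
          (∑ j, b.repr m j • ρ.coeffMatrix b i j - algebraMap k A (b.repr m i)) =
          -∑ l, HopfAlgebra.antipode k (ρ.coeffMatrix b i l) *
            (∑ j, b.repr m j • ρ.coeffMatrix b l j - algebraMap k A (b.repr m l)) := by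
        have e1 : algebraMap k A (b.repr m i) = ∑ l, HopfAlgebra.antipode k (ρ.coeffMatrix b i l) *
            ∑ j, b.repr m j • ρ.coeffMatrix b l j := by
          simp only [Finset.mul_sum, mul_smul_comm]
          rw [Finset.sum_comm]
          simp only [← Finset.smul_sum, ρ.sum_antipode_mul b]
          simp [Matrix.one_apply, Algebra.algebraMap_eq_smul_one]
        simp only [mul_sub, Finset.sum_sub_distrib, ← e1]
        simp only [map_sub, map_sum, map_smul, AlgHom.commutes, HopfAlgebra.antipodeAlgHom_apply,
          neg_sub]
        simp only [Algebra.smul_def, mul_comm]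
      rw [e]
      exact neg_mem (Ideal.sum_mem _ fun l _ => Ideal.mul_mem_left _ _ (ρ.mem_fixIdeal b W hm l))
    exact fun x hx => h hx

end FixIdeal

end Matrix

end AlgRep

/-! ### Tangent vectors in coordinates, and tangent spaces of closed subgroups. -/

section TangentQuotient

open Module

variable {k : Type*} [Field k] {A : Type*} [CommRing A] [HopfAlgebra k A]

/-- A point derivation at the identity is determined by its values on local coordinates. -/
theorem IsCoordinateSystem.apply_eq_sum {K : Type*} [CommRing K] [Algebra k K] {n : ℕ}
    {x : Fin n → A} {D : Fin n → A →ₗ[k] k} (h : IsCoordinateSystem x D) (E : A →ₗ[k] K)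
    (hE : ∀ a b, E (a * b) = Coalgebra.counit (R := k) a • E b + Coalgebra.counit (R := k) b • E a)
    (a : A) : E a = ∑ j, D j a • E (x j) := by
  obtain ⟨c, hc⟩ := h.generate a
  have hsq : ∀ y ∈ augIdeal k A ^ 2, E y = 0 := by
    intro y hy
    rw [pow_two] at hy
    induction hy using Submodule.mul_induction_on' with
    | mem_mul_mem x hx y hy =>
      rw [hE, mem_augIdeal.mp hx, mem_augIdeal.mp hy, zero_smul, zero_smul, add_zero]
    | add x _ y _ hx hy => rw [map_add, hx, hy, add_zero]
  have hone : E 1 = 0 := by simpa using hE 1 1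
  have h1 := hsq _ hc
  rw [map_sub, map_sub, Algebra.algebraMap_eq_smul_one, map_smul, hone, smul_zero, sub_zero, map_sum,
    sub_eq_zero] at h1
  have h2 : ∀ i, D i a = c i := by
    intro i
    have h3 := (h.isTangent i).map_of_mem_sq hc
    rw [map_sub, map_sub, (h.isTangent i).map_algebraMap, sub_zero, map_sum, sub_eq_zero] at h3
    rw [h3]
    simp [h.apply_eq]
  rw [h1]
  simp [h2]

theorem IsCoordinateSystem.tangent_eq_sum {n : ℕ}
    {x : Fin n → A} {D : Fin n → A →ₗ[k] k} (h : IsCoordinateSystem x D) {E : A →ₗ[k] k}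
    (hE : AlgRep.IsTangent E) : E = ∑ j, E (x j) • D j := by
  ext a
  rw [h.apply_eq_sum E (fun a b => by rw [hE]; simp [mul_comm]) a]
  simp [mul_comm]

theorem IsCoordinateSystem.isTangent_sum {n : ℕ}
    {x : Fin n → A} {D : Fin n → A →ₗ[k] k} (h : IsCoordinateSystem x D) (t : Fin n → k) :
    AlgRep.IsTangent (∑ j, t j • D j) :=
  (tangentSpace k A).sum_mem fun j _ => (tangentSpace k A).smul_mem (t j) (h.isTangent j)

theorem IsCoordinateSystem.sum_apply {n : ℕ}
    {x : Fin n → A} {D : Fin n → A →ₗ[k] k} (h : IsCoordinateSystem x D) (t : Fin n → k) (i : Fin n) :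
    (∑ j, t j • D j) (x i) = t i := by
  simp [LinearMap.sum_apply, h.apply_eq]

/-- The tangent space of a closed subgroup consists of the tangent vectors that kill its ideal. -/
theorem IsCoordinateSystem.finrank_tangentSpace_of_surjective {B : Type*} [CommRing B]
    [HopfAlgebra k B] {n : ℕ} {x : Fin n → A} {D : Fin n → A →ₗ[k] k} (h : IsCoordinateSystem x D)
    (q : A →ₐ[k] B) (hq : Function.Surjective q)
    (hc : ∀ a, Coalgebra.counit (R := k) (q a) = Coalgebra.counit (R := k) a)
    (S : Submodule k (Fin n → k)) (hS : ∀ t, t ∈ S ↔ ∀ a, q a = 0 → (∑ j, t j • D j) a = 0) :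
    finrank k (tangentSpace k B) = finrank k S := by
  have hpull : ∀ E : B →ₗ[k] k, AlgRep.IsTangent E → AlgRep.IsTangent (E ∘ₗ q.toLinearMap) := by
    intro E hE a b
    have := hE (q a) (q b)
    rw [hc, hc, ← map_mul] at this
    exact this
  let Ψ : tangentSpace k B →ₗ[k] (Fin n → k) :=
    { toFun := fun E j => E.1 (q (x j))
      map_add' := fun E E' => rfl
      map_smul' := fun c E => rfl }
  have hsum : ∀ E : tangentSpace k B, ∀ a, (∑ j, Ψ E j • D j) a = E.1 (q a) :=
    fun E a => (LinearMap.congr_fun (h.tangent_eq_sum (hpull E.1 E.2)) a).symm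
  have hinj : Function.Injective Ψ := by
    intro E E' hEE
    refine Subtype.ext (LinearMap.ext fun b => ?_)
    obtain ⟨a, rfl⟩ := hq b
    rw [← hsum, ← hsum, hEE]
  suffices hS' : LinearMap.range Ψ = S by rw [← LinearMap.finrank_range_of_inj hinj, hS']
  ext t
  rw [hS, LinearMap.mem_range]
  constructor
  · rintro ⟨E, rfl⟩ a ha
    rw [hsum, ha, map_zero]
  · intro ht
    -- A tangent vector that kills the kernel of `q` descends to `B`; composition with a linear
    -- section of `q` realizes the descended form.
    obtain ⟨σ, hσ⟩ := q.toLinearMap.exists_rightInverse_of_surjective (LinearMap.range_eq_top.mpr hq)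
    have hσ' : ∀ b, q (σ b) = b := fun b => LinearMap.congr_fun hσ b
    have hE' : ∀ a, (∑ j, t j • D j) (σ (q a)) = (∑ j, t j • D j) a := fun a => by
      rw [← sub_eq_zero, ← map_sub]
      exact ht _ (by rw [map_sub, hσ', sub_self])
    have hE : AlgRep.IsTangent ((∑ j, t j • D j) ∘ₗ σ) := by
      intro b b'
      obtain ⟨a, rfl⟩ := hq b
      obtain ⟨a', rfl⟩ := hq b'
      rw [hc, hc, ← map_mul]
      simp only [LinearMap.comp_apply, hE']
      exact h.isTangent_sum t a a'
    exact ⟨⟨_, hE⟩, funext fun i => (hE' _).trans (h.sum_apply t i)⟩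

end TangentQuotient

/-! ### The Lie algebra as matrices, and the Lie algebra of a stabilizer. -/

namespace AlgRep

section LieMatrix

open Module

variable {k : Type*} [Field k] {A : Type*} [CommRing A] [HopfAlgebra k A]
  {M : Type*} [AddCommGroup M] [Module k M] {ι : Type*} [Fintype ι]

/-- The matrices through which tangent vectors act on a basis. -/
def tangentMatrix (ρ : AlgRep k A M) (b : Basis ι k M) {n : ℕ} (D : Fin n → A →ₗ[k] k) (l : Fin n) :
    Matrix ι ι k := (ρ.coeffMatrix b).map (D l)

variable (ρ : AlgRep k A M) (b : Basis ι k M)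

theorem repr_contract (E : A →ₗ[k] k) (m : M) (i : ι) :
    b.repr (ρ.contract E m) i = ∑ j, b.repr m j * E (ρ.coeffMatrix b i j) := by
  classical
  conv_lhs => rw [← b.sum_repr m]
  simp only [map_sum, map_smul, ρ.contract_basis b]
  simp [Finsupp.single_apply]

include b in
-- `E` takes the function `g ↦ (g m - m)ᵢ` to the `i`-th coordinate of `E` acting on `m`.
-- Conversely, by the Leibniz rule the zeros of `E` in the augmentation ideal form an ideal `J`, so
-- generators suffice.
theorem forall_fixIdeal_iff {E : A →ₗ[k] k} (hE : IsTangent E) (W : Submodule k M) :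
    (∀ a ∈ ρ.fixIdeal W, E a = 0) ↔ ∀ m ∈ W, ρ.contract E m = 0 := by
  classical
  have key : ∀ m i, E (∑ j, b.repr m j • ρ.coeffMatrix b i j - algebraMap k A (b.repr m i)) =
      b.repr (ρ.contract E m) i := by
    intro m i
    rw [repr_contract, map_sub, hE.map_algebraMap]
    simp
  constructor
  · intro h m hm
    apply b.repr.injective
    ext i
    rw [← key, h _ (ρ.mem_fixIdeal b W hm i)]
    simp
  · intro h
    let J : Ideal A :=
      { carrier := {a | Coalgebra.counit (R := k) a = 0 ∧ E a = 0}
        add_mem' := fun {a b} ha hb => by simp [ha.1, ha.2, hb.1, hb.2]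
        zero_mem' := by simp
        smul_mem' := fun r a ha => by simp [hE r a, ha.1, ha.2] }
    have hJ : ρ.fixIdeal W ≤ J := by
      rw [ρ.fixIdeal_le_iff b]
      intro m hm i
      refine ⟨ρ.fixIdeal_le_augIdeal b W (ρ.mem_fixIdeal b W hm i), ?_⟩
      rw [key, h m hm]
      simp
    exact fun a ha => (hJ ha).2

theorem mem_annCoeff_tangentMatrix {n : ℕ} (D : Fin n → A →ₗ[k] k) (W : Submodule k M)
    (t : Fin n → k) : t ∈ annCoeff (K := k) (ρ.tangentMatrix b D) (W.map b.equivFun.toLinearMap) ↔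
      ∀ m ∈ W, ρ.contract (∑ j, t j • D j) m = 0 := by
  have key : ∀ m, (∑ l, t l • (ρ.tangentMatrix b D l).map (algebraMap k k)).mulVec (b.equivFun m) =
      b.equivFun (ρ.contract (∑ j, t j • D j) m) := by
    intro m
    ext i
    rw [sum_smul_map_mulVec_apply, Basis.equivFun_apply, Basis.equivFun_apply, repr_contract]
    refine Finset.sum_congr rfl fun y _ => ?_
    simp [tangentMatrix, LinearMap.sum_apply, mul_comm]
  rw [mem_annCoeff]
  constructor
  · intro h m hm
    have := h _ (Submodule.mem_map_of_mem hm)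
    exact b.equivFun.map_eq_zero_iff.mp ((key m).symm.trans this)
  · rintro h _ ⟨m, hm, rfl⟩
    exact (key m).trans (by rw [h m hm, map_zero])

variable {n : ℕ} {x : Fin n → A} {D : Fin n → A →ₗ[k] k} (hx : IsCoordinateSystem x D)

include hx

/-- The Lie algebra of `G_W` is `𝔤_W`, whether or not `G_W` is smooth: both consist of the tangent
vectors that kill the ideal of `G_W`. -/
theorem finrank_tangentSpace_fixIdeal (W : Submodule k M) [(ρ.fixIdeal W).IsHopfIdeal k] :
    finrank k (tangentSpace k (A ⧸ ρ.fixIdeal W)) =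
      finrank k (annCoeff (K := k) (ρ.tangentMatrix b D) (W.map b.equivFun.toLinearMap)) :=
  hx.finrank_tangentSpace_of_surjective (Ideal.Quotient.mkₐ k (ρ.fixIdeal W))
    Ideal.Quotient.mk_surjective (fun _ => rfl) _ fun t => by
    rw [mem_annCoeff_tangentMatrix, ← forall_fixIdeal_iff ρ b (hx.isTangent_sum t)]
    simp only [Ideal.Quotient.mkₐ_eq_mk, Ideal.Quotient.eq_zero_iff_mem]

theorem affineDim_fixIdeal_le [Algebra.FiniteType k A] (W : Submodule k M) :
    affineDim (A ⧸ ρ.fixIdeal W) ≤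
      finrank k (annCoeff (K := k) (ρ.tangentMatrix b D) (W.map b.equivFun.toLinearMap)) := by
  classical
  have := ρ.isHopfIdeal_fixIdeal b W
  rw [← ρ.finrank_tangentSpace_fixIdeal b hx W]
  exact affineDim_le_finrank_tangentSpace

theorem affineDim_fixIdeal_eq (W : Submodule k M)
    [Algebra.Smooth k (A ⧸ ρ.fixIdeal W)] : affineDim (A ⧸ ρ.fixIdeal W) =
      finrank k (annCoeff (K := k) (ρ.tangentMatrix b D) (W.map b.equivFun.toLinearMap)) := by
  classical
  have := ρ.isHopfIdeal_fixIdeal b W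
  rw [← ρ.finrank_tangentSpace_fixIdeal b hx W]
  exact affineDim_eq_finrank_tangentSpace

omit hx

include b in
/-- The Lie algebra of an algebraic subgroup of `GL_M` acts faithfully on `M`. -/
theorem IsClosedEmbedding.eq_zero_of_contract_eq_zero {ρ : AlgRep k A M} (hρ : ρ.IsClosedEmbedding)
    {E : A →ₗ[k] k} (hE : IsTangent E) (h : ρ.contract E = 0) : E = 0 := by
  classical
  have h1 : ∀ i j, E (ρ.coeffMatrix b i j) = 0 := by
    intro i j
    have h2 := ρ.repr_contract b E (b j) i
    simpa [h, Finsupp.single_apply] using h2.symm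
  -- Differentiating `g⁻¹ g = 1` at the identity shows that `E` kills the coefficients of `g⁻¹`
  -- along with those of `g`.
  have h2 : ∀ i j, E (HopfAlgebra.antipode k (ρ.coeffMatrix b i j)) = 0 := by
    intro i j
    have h3 := congrArg E (ρ.sum_antipode_mul b i j)
    rw [map_sum] at h3
    simp only [hE _ _, h1, mul_zero, zero_add, ρ.counit_coeffMatrix b] at h3
    have h4 : E ((1 : Matrix ι ι A) i j) = 0 := by
      rw [Matrix.one_apply]
      split_ifs
      · exact hE.map_one
      · exact map_zero E
    rw [h4] at h3
    simpa [Matrix.one_apply] using h3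
  have h3 : ∀ (f : A →ₗ[k] A) (_ : ∀ i j, E (f (ρ.coeffMatrix b i j)) = 0) m φ,
      E (f (ρ.coeff m φ)) = 0 := by
    intro f hf m φ
    rw [ρ.coeff_eq_sum b]
    simp [ρ.coeff_coord b, hf]
  have h4 : ∀ a ∈ Algebra.adjoin k ({a : A | ∃ m φ, a = ρ.coeff m φ} ∪
      {a : A | ∃ m φ, a = HopfAlgebra.antipode k (ρ.coeff m φ)}), E a = 0 := by
    intro a ha
    induction ha using Algebra.adjoin_induction with
    | mem a ha =>
      rcases ha with ⟨m, φ, rfl⟩ | ⟨m, φ, rfl⟩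
      · exact h3 LinearMap.id h1 m φ
      · exact h3 (HopfAlgebra.antipode k) h2 m φ
    | algebraMap r => exact hE.map_algebraMap r
    | add x y _ _ hx hy => rw [map_add, hx, hy, add_zero]
    | mul x y _ _ hx hy => rw [hE, hx, hy, mul_zero, zero_mul, add_zero]
  ext a
  exact h4 a (by rw [hρ]; exact Algebra.mem_top)

theorem contract_sum_smul (t : Fin n → k) :
    ρ.contract (∑ j, t j • D j) = ∑ j, t j • ρ.contract (D j) := by
  have : ∀ E : A →ₗ[k] k, ρ.contract E =
      ((LinearMap.lcomp k M ρ.coact) ∘ₗ (LinearMap.llcomp k _ _ _ (TensorProduct.rid k M).toLinearMap) ∘ₗ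
        LinearMap.lTensorHom M) E := fun E => rfl
  simp only [this, map_sum, map_smul]

include hx in
theorem IsClosedEmbedding.linearIndependent_contract [Module.Finite k M] {ρ : AlgRep k A M}
    (hρ : ρ.IsClosedEmbedding) : LinearIndependent k fun l => ρ.contract (D l) := by
  rw [Fintype.linearIndependent_iff]
  intro t ht i
  rw [← ρ.contract_sum_smul] at ht
  have h := hρ.eq_zero_of_contract_eq_zero (Module.finBasis k M) (hx.isTangent_sum t) ht
  rw [← hx.sum_apply t i, h, LinearMap.zero_apply]

include hx in
theorem IsClosedEmbedding.finrank_lieFix [Module.Finite k M] {ρ : AlgRep k A M}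
    (hρ : ρ.IsClosedEmbedding) (W : Submodule k M) : finrank k (lieFix ρ.lieAlgebra W) =
      finrank k (annCoeff (K := k) (ρ.tangentMatrix b D) (W.map b.equivFun.toLinearMap)) := by
  let Θ := Fintype.linearCombination k fun l => ρ.contract (D l)
  have hΘ : Function.Injective Θ := by
    have := hρ.linearIndependent_contract hx
    rwa [linearIndependent_iff_injective_fintypeLinearCombination] at this
  have hΘa : ∀ t, Θ t = ρ.contract (∑ j, t j • D j) := fun t => by
    rw [contract_sum_smul]; exact Fintype.linearCombination_apply _ _ _
  rw [(Submodule.equivMapOfInjective Θ hΘ _).finrank_eq]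
  suffices hS : (lieFix ρ.lieAlgebra W).toSubmodule = Submodule.map Θ
      (annCoeff (K := k) (ρ.tangentMatrix b D) (W.map b.equivFun.toLinearMap)) from
    congrArg (fun S : Submodule k (End k M) => finrank k S) hS
  ext X
  rw [Submodule.mem_map]
  constructor
  · rintro ⟨⟨E, hE, rfl⟩, hX⟩
    have hEs := hx.tangent_eq_sum hE
    refine ⟨fun j => E (x j), ?_, ?_⟩
    · rw [mem_annCoeff_tangentMatrix, ← hEs]
      exact hX
    · rw [hΘa, ← hEs]
  · rintro ⟨t, ht, rfl⟩
    rw [mem_annCoeff_tangentMatrix] at ht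
    rw [hΘa]
    exact ⟨⟨_, hx.isTangent_sum t, rfl⟩, ht⟩

include hx in
theorem IsClosedEmbedding.finrank_lieAlgebra [Module.Finite k M] {ρ : AlgRep k A M}
    (hρ : ρ.IsClosedEmbedding) : finrank k ρ.lieAlgebra = n := by
  have h := finrank_span_eq_card (hρ.linearIndependent_contract hx)
  rw [Fintype.card_fin] at h
  rw [← h]
  suffices hS : ρ.lieAlgebra.toSubmodule = Submodule.span k (Set.range fun l => ρ.contract (D l)) from
    congrArg (fun S : Submodule k (End k M) => finrank k S) hS
  refine le_antisymm ?_ (Submodule.span_le.mpr ?_)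
  · rintro _ ⟨E, hE, rfl⟩
    rw [hx.tangent_eq_sum hE, contract_sum_smul]
    exact Submodule.sum_mem _ fun j _ => Submodule.smul_mem _ _ (Submodule.subset_span ⟨j, rfl⟩)
  · rintro _ ⟨l, rfl⟩
    exact ⟨D l, hx.isTangent l, rfl⟩

include hx in
theorem IsClosedEmbedding.linearIndependent_tangentMatrix [DecidableEq ι] {ρ : AlgRep k A M}
    (hρ : ρ.IsClosedEmbedding) : LinearIndependent k (ρ.tangentMatrix b D) := by
  have : Module.Finite k M := Module.Finite.of_basis b
  have h := (hρ.linearIndependent_contract hx).map' (LinearMap.toMatrix b b).toLinearMap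
    (LinearEquiv.ker _)
  convert! h using 1
  ext l i j
  simp only [Function.comp_apply, LinearEquiv.coe_coe, LinearMap.toMatrix_apply, repr_contract]
  simp [tangentMatrix, Finsupp.single_apply]

end LieMatrix

end AlgRep

/-! ### Compatibility with base change. -/

namespace AlgRep

section BaseChange

open Module

variable {k : Type*} [Field k] {A : Type*} [CommRing A] [HopfAlgebra k A]
  {M : Type*} [AddCommGroup M] [Module k M] {ι : Type*} [Fintype ι]
  (ρ : AlgRep k A M) (b : Basis ι k M) (L : Type*) [Field L] [Algebra k L]

theorem coeffMatrix_baseChange : (ρ.baseChange L).coeffMatrix (b.baseChange L) =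
    (ρ.coeffMatrix b).map fun a => (1 : L) ⊗ₜ[k] a := by
  classical
  ext i j
  refine coeffMatrix_eq (e := fun i j => (1 : L) ⊗ₜ[k] ρ.coeffMatrix b i j) _ _ ?_ i
  rw [Basis.baseChange_apply]
  simp [baseChange, ρ.coact_basis b, TensorProduct.tmul_sum]

theorem tangentMatrix_baseChange {n : ℕ} (D : Fin n → A →ₗ[k] k) (l : Fin n) :
    (ρ.baseChange L).tangentMatrix (b.baseChange L) (fun l => extendForm L (D l)) l =
      (ρ.tangentMatrix b D l).map (algebraMap k L) := by
  ext i j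
  simp [tangentMatrix, coeffMatrix_baseChange, Algebra.smul_def]

theorem annCoeff_map_algebraMap {κ : Type*} [Fintype κ] (X : κ → Matrix ι ι k)
    (W : Submodule L (ι → L)) :
    annCoeff (F := L) (K := L) (fun l => (X l).map (algebraMap k L)) W = annCoeff (F := k) X W := by
  ext c
  simp [mem_annCoeff]

theorem map_equivFun_baseChange (W : Submodule k M) :
    (W.baseChange L).map (b.baseChange L).equivFun.toLinearMap =
      extendScalars L (W.map b.equivFun.toLinearMap) := by
  rw [Submodule.baseChange_eq_span, Submodule.map_span, extendScalars]
  congr 1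
  ext u
  simp only [Set.mem_image, SetLike.mem_coe, Submodule.mem_map, TensorProduct.mk_apply]
  constructor
  · rintro ⟨_, ⟨m, hm, rfl⟩, rfl⟩
    refine ⟨_, ⟨m, hm, rfl⟩, ?_⟩
    ext x
    simp [Algebra.smul_def]
  · rintro ⟨_, ⟨m, hm, rfl⟩, rfl⟩
    refine ⟨_, ⟨m, hm, rfl⟩, ?_⟩
    ext x
    simp [Algebra.smul_def]

include b in
theorem fixIdeal_baseChange (W : Submodule k M) : (ρ.baseChange L).fixIdeal (W.baseChange L) =
    (ρ.fixIdeal W).map (Algebra.TensorProduct.includeRight : A →ₐ[k] L ⊗[k] A) := by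
  have key : ∀ m i, ∑ j, (b.baseChange L).repr ((1 : L) ⊗ₜ[k] m) j •
      (ρ.baseChange L).coeffMatrix (b.baseChange L) i j -
        algebraMap L (L ⊗[k] A) ((b.baseChange L).repr ((1 : L) ⊗ₜ[k] m) i) =
      (Algebra.TensorProduct.includeRight : A →ₐ[k] L ⊗[k] A)
        (∑ j, b.repr m j • ρ.coeffMatrix b i j - algebraMap k A (b.repr m i)) := by
    intro m i
    simp only [map_sub, map_sum, map_smul, AlgHom.commutes, coeffMatrix_baseChange,
      Basis.baseChange_repr_tmul, Matrix.map_apply, Algebra.TensorProduct.includeRight_apply]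
    congr 1
    · exact Finset.sum_congr rfl fun j _ => by rw [smul_assoc, one_smul]
    · simp [Algebra.algebraMap_eq_smul_one]
  refine le_antisymm ?_ (Ideal.map_le_iff_le_comap.mpr ?_)
  · rw [fixIdeal_le_iff _ (b.baseChange L)]
    intro m hm i
    rw [Submodule.baseChange_eq_span] at hm
    induction hm using Submodule.span_induction with
    | mem m hm =>
      obtain ⟨m, hm, rfl⟩ := hm
      rw [TensorProduct.mk_apply, key]
      exact Ideal.mem_map_of_mem _ (ρ.mem_fixIdeal b W hm i)
    | zero => simp
    | add m m' _ _ h h' =>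
      have := Ideal.add_mem _ h h'
      simp only [map_add, Finsupp.add_apply, add_smul, Finset.sum_add_distrib]
      convert! this using 1
      ring
    | smul l m _ h =>
      have := Ideal.mul_mem_left _ (algebraMap L (L ⊗[k] A) l) h
      simpa only [map_smul, Finsupp.smul_apply, smul_eq_mul, map_mul, Algebra.smul_def, mul_sub,
        Finset.mul_sum, mul_assoc] using this
  · rw [fixIdeal_le_iff _ b]
    intro m hm i
    rw [Ideal.mem_comap, ← key]
    exact (ρ.baseChange L).mem_fixIdeal _ _ (Submodule.tmul_mem_baseChange_of_mem 1 hm) i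

include b in
theorem smooth_fixIdeal_baseChange (W : Submodule k M) [Algebra.Smooth k (A ⧸ ρ.fixIdeal W)] :
    Algebra.Smooth L ((L ⊗[k] A) ⧸ (ρ.baseChange L).fixIdeal (W.baseChange L)) := by
  rw [ρ.fixIdeal_baseChange b L W]
  exact Algebra.Smooth.of_equiv (Algebra.TensorProduct.tensorQuotientEquiv L A L (ρ.fixIdeal W))

end BaseChange

/-! ### Points of the group normalize the Lie algebra. -/

section Conjugation

open Module WithConv

variable {k : Type*} [Field k] {A : Type*} [CommRing A] [HopfAlgebra k A]
  {M : Type*} [AddCommGroup M] [Module k M] {ι : Type*} [Fintype ι] [DecidableEq ι]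
  (ρ : AlgRep k A M) (b : Basis ι k M)

/-- The point of `G` over the dual numbers that a tangent vector defines. -/
def IsTangent.dualPoint (Ω : Type*) [Field Ω] [Algebra k Ω] {D : A →ₗ[k] k} (hD : IsTangent D) :
    A →ₐ[k] TrivSqZeroExt Ω Ω :=
  AlgHom.ofLinearMap
    ((TrivSqZeroExt.inlAlgHom k Ω Ω).toLinearMap ∘ₗ Algebra.linearMap k Ω ∘ₗ Coalgebra.counit +
      (TrivSqZeroExt.inrHom Ω Ω).restrictScalars k ∘ₗ Algebra.linearMap k Ω ∘ₗ D)
    (by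
      change TrivSqZeroExt.inl (algebraMap k Ω (Coalgebra.counit (R := k) (1 : A))) +
        TrivSqZeroExt.inr (algebraMap k Ω (D 1)) = 1
      ext <;> simp [hD.map_one])
    (by
      intro a b
      change TrivSqZeroExt.inl (algebraMap k Ω (Coalgebra.counit (R := k) (a * b))) +
        TrivSqZeroExt.inr (algebraMap k Ω (D (a * b))) =
        (TrivSqZeroExt.inl (algebraMap k Ω (Coalgebra.counit (R := k) a)) +
          TrivSqZeroExt.inr (algebraMap k Ω (D a))) *
        (TrivSqZeroExt.inl (algebraMap k Ω (Coalgebra.counit (R := k) b)) +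
          TrivSqZeroExt.inr (algebraMap k Ω (D b)))
      ext
      · simp
      · simp [hD a b, mul_comm]
        simp only [Algebra.smul_def])

theorem IsTangent.dualPoint_apply (Ω : Type*) [Field Ω] [Algebra k Ω] {D : A →ₗ[k] k}
    (hD : IsTangent D) (a : A) : hD.dualPoint Ω a =
      TrivSqZeroExt.inl (algebraMap k Ω (Coalgebra.counit (R := k) a)) +
        TrivSqZeroExt.inr (algebraMap k Ω (D a)) := rfl

/-- The Lie algebra is stable under conjugation by points of the group. -/
theorem conj_tangentMatrix_mem {Ω : Type*} [Field Ω] [Algebra k Ω] {n : ℕ} {x : Fin n → A}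
    {D : Fin n → A →ₗ[k] k} (hx : IsCoordinateSystem x D) (g : A →ₐ[k] Ω) (l : Fin n) :
    (ρ.coeffMatrix b).map g * (ρ.tangentMatrix b D l).map (algebraMap k Ω) *
      (ρ.coeffMatrix b).map (g.comp (HopfAlgebra.antipodeAlgHom k A)) ∈
      Submodule.span Ω (Set.range fun l => (ρ.tangentMatrix b D l).map (algebraMap k Ω)) := by
  let inl := TrivSqZeroExt.inlAlgHom k Ω Ω
  let fst := TrivSqZeroExt.fstHom k Ω Ω
  let g' := g.comp (HopfAlgebra.antipodeAlgHom k A)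
  let h := (hx.isTangent l).dualPoint Ω
  -- The point `g h g⁻¹` over the dual numbers lies above the identity. Its infinitesimal part `E'`
  -- is thus an `Ω`-valued point derivation, hence a combination of the `D j`, and on the
  -- coefficient matrix it is the conjugated matrix.
  let E := toConv (inl.comp g) * toConv h * toConv (inl.comp g')
  have hfst : ∀ a, (E.ofConv a).fst = algebraMap k Ω (Coalgebra.counit (R := k) a) := by
    have h1 : fst.comp E.ofConv = (1 : WithConv (A →ₐ[k] Ω)).ofConv := by
      have e1 : fst.comp (inl.comp g) = g := by ext; simp [fst, inl]
      have e2 : fst.comp (inl.comp g') = g' := by ext; simp [fst, inl]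
      have e3 : toConv (fst.comp h) = 1 := by
        apply WithConv.ofConv_injective
        ext a
        simp [fst, h, IsTangent.dualPoint_apply, AlgHom.convOne_def]
      rw [AlgHom.comp_convMul_distrib, AlgHom.comp_convMul_distrib, toConv_ofConv, ofConv_toConv,
        ofConv_toConv, ofConv_toConv, e1, e2, e3, mul_one, toConv_mul_antipode_self]
    intro a
    have := AlgHom.congr_fun h1 a
    simpa [fst, AlgHom.convOne_def] using this
  let E' : A →ₗ[k] Ω := (TrivSqZeroExt.sndHom Ω Ω).restrictScalars k ∘ₗ E.ofConv.toLinearMap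
  have hE' : ∀ a, E' a = (E.ofConv a).snd := fun a => rfl
  have hsum := hx.apply_eq_sum E' (by
    intro a b
    simp only [hE', map_mul, TrivSqZeroExt.snd_mul, hfst]
    simp [Algebra.smul_def, mul_comm])
  have hmat : ∀ i j, E' (ρ.coeffMatrix b i j) = ((ρ.coeffMatrix b).map g *
      (ρ.tangentMatrix b D l).map (algebraMap k Ω) * (ρ.coeffMatrix b).map g') i j := by
    intro i j
    have h1 := congrFun (congrFun ((ρ.coeffMatrix_map_mul b
      ((toConv (inl.comp g) * toConv h).ofConv) (inl.comp g'))) i) j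
    rw [toConv_ofConv, Matrix.map_apply, ρ.coeffMatrix_map_mul b] at h1
    rw [hE', h1]
    simp only [Matrix.mul_apply, Matrix.map_apply, inl, h, IsTangent.dualPoint_apply,
      AlgHom.comp_apply, TrivSqZeroExt.inlAlgHom_apply, TrivSqZeroExt.snd_sum,
      TrivSqZeroExt.snd_mul, TrivSqZeroExt.snd_inl, TrivSqZeroExt.fst_inl, smul_zero, zero_add,
      TrivSqZeroExt.snd_add, TrivSqZeroExt.snd_inr, add_zero, tangentMatrix, smul_eq_mul]
    simp [mul_comm]
  have hfin : (ρ.coeffMatrix b).map g * (ρ.tangentMatrix b D l).map (algebraMap k Ω) *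
      (ρ.coeffMatrix b).map g' =
      ∑ j, E' (x j) • (ρ.tangentMatrix b D j).map (algebraMap k Ω) := by
    ext i j
    rw [← hmat, hsum]
    rw [Matrix.sum_apply]
    refine Finset.sum_congr rfl fun c _ => ?_
    rw [Algebra.smul_def, mul_comm]
    rfl
  rw [hfin]
  exact Submodule.sum_mem _ fun j _ => Submodule.smul_mem _ _ (Submodule.subset_span ⟨j, rfl⟩)

end Conjugation

/-! ### Testing stability on points. -/

section Stable

open Module

variable {k : Type*} [Field k] {A : Type*} [CommRing A] [HopfAlgebra k A]
  {M : Type*} [AddCommGroup M] [Module k M] {ι : Type*} [Fintype ι]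
  (ρ : AlgRep k A M) (b : Basis ι k M)

include b in
-- With `p` a linear projection onto `W`, the forms `b.coord i ∘ (1 - p)` vanish on `W`. So the
-- coaction of `m ∈ W` is unchanged by `p` and lies in `W ⊗ A`.
theorem isStable_of_coeff_eq_zero (W : Submodule k M)
    (h : ∀ m ∈ W, ∀ φ : Module.Dual k M, (∀ w ∈ W, φ w = 0) → ρ.coeff m φ = 0) : ρ.IsStable W := by
  obtain ⟨p, hp⟩ := W.subtype.exists_leftInverse_of_injective W.ker_subtype
  have hp' : ∀ w : W, p w = w := fun w => LinearMap.congr_fun hp w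
  intro m hm
  refine ⟨p.rTensor A (ρ.coact m), ?_⟩
  rw [← sub_eq_zero, ← neg_eq_zero, neg_sub, ← b.sum_tmul_lid_rTensor (ρ.coact m - _)]
  refine Finset.sum_eq_zero fun i _ => ?_
  have h1 := h m hm (b.coord i ∘ₗ (LinearMap.id - W.subtype ∘ₗ p)) (fun w hw => by
    simp [hp' ⟨w, hw⟩])
  rw [coeff, LinearMap.rTensor_comp, LinearMap.rTensor_sub, LinearMap.rTensor_comp] at h1
  simp only [LinearMap.comp_apply, LinearMap.sub_apply, LinearMap.rTensor_id,
    LinearMap.id_apply] at h1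
  rw [h1, TensorProduct.tmul_zero]

/-- For a smooth group, stability can be tested on points over an algebraically closed field. -/
theorem isStable_of_forall_point (Ω : Type*) [Field Ω] [Algebra k Ω] [IsAlgClosed Ω]
    [Algebra.Smooth k A] (W : Submodule k M)
    (h : ∀ g : A →ₐ[k] Ω, ∀ w ∈ W.map b.equivFun.toLinearMap, ((ρ.coeffMatrix b).map g).mulVec
      (fun x => algebraMap k Ω (w x)) ∈ extendScalars Ω (W.map b.equivFun.toLinearMap)) :
    ρ.IsStable W := by
  have : IsReduced A := isReduced_of_smooth (k := k)
  have : IsJacobsonRing A := isJacobsonRing_of_finiteType (A := k)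
  refine ρ.isStable_of_coeff_eq_zero b W fun m hm φ hφ => ?_
  have hker : ∀ u ∈ extendScalars Ω (W.map b.equivFun.toLinearMap),
      ∑ i, algebraMap k Ω (φ (b i)) * u i = 0 := by
    intro u hu
    induction hu using Submodule.span_induction with
    | mem u hu =>
      obtain ⟨_, ⟨w, hw, rfl⟩, rfl⟩ := hu
      have h1 := hφ w hw
      rw [← b.sum_repr w, map_sum] at h1
      have h2 := congrArg (algebraMap k Ω) h1
      simpa [mul_comm] using h2
    | zero => simp
    | add u v _ _ hu hv => simp [mul_add, Finset.sum_add_distrib, hu, hv]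
    | smul c u _ hu =>
      simp only [Pi.smul_apply, smul_eq_mul, mul_left_comm _ c, ← Finset.mul_sum, hu, mul_zero]
  have hg : ∀ g : A →ₐ[k] Ω, g (ρ.coeff m φ) = 0 := by
    intro g
    rw [← hker _ (h g _ ⟨m, hm, rfl⟩), ρ.coeff_eq_sum b]
    simp [ρ.coeff_coord b, Matrix.mulVec, dotProduct, Algebra.smul_def, mul_comm]
  -- Every maximal ideal is the kernel of an `Ω`-point, so the coefficient lies in all of them; it
  -- vanishes because `A` is Jacobson and reduced.
  have hjac : ρ.coeff m φ ∈ (⊥ : Ideal A).jacobson := by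
    rw [Ideal.jacobson, Submodule.mem_sInf]
    rintro N ⟨-, hN⟩
    obtain ⟨g, rfl⟩ := exists_algHom_ker_eq_of_isMaximal (F := k) Ω N
    exact hg g
  rw [← Ideal.radical_eq_jacobson, Ideal.radical_bot_of_isReduced] at hjac
  exact hjac

end Stable

end AlgRep

/-! ### Equivariant maps and isotypic components. -/

namespace AlgRep

section Isotypic

variable {k : Type*} [Field k] {A : Type*} [CommRing A] [HopfAlgebra k A]
  {M : Type*} [AddCommGroup M] [Module k M] {N : Type*} [AddCommGroup N] [Module k N]
  {ρ : AlgRep k A M} {τ : AlgRep k A N}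

theorem IsEquivariant.coact_apply {f : N →ₗ[k] M} (hf : IsEquivariant τ ρ f) (y : N) :
    ρ.coact (f y) = f.rTensor A (τ.coact y) := (LinearMap.congr_fun hf y).symm

theorem IsEquivariant.contract_apply {f : N →ₗ[k] M} (hf : IsEquivariant τ ρ f) (D : A →ₗ[k] k)
    (y : N) : ρ.contract D (f y) = f (τ.contract D y) := by
  have h : ∀ z : N ⊗[k] A, TensorProduct.rid k M (D.lTensor M (f.rTensor A z)) =
      f (TensorProduct.rid k N (D.lTensor N z)) := by
    intro z
    induction z with
    | zero => simp
    | add z z' hz hz' => simp only [map_add, hz, hz']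
    | tmul m a => simp
  rw [contract, contract]
  simp only [LinearMap.comp_apply, LinearEquiv.coe_coe, hf.coact_apply, h]

theorem IsStable.map {f : N →ₗ[k] M} (hf : IsEquivariant τ ρ f) {W : Submodule k N}
    (hW : τ.IsStable W) : ρ.IsStable (W.map f) := by
  rintro _ ⟨y, hy, rfl⟩
  obtain ⟨z, hz⟩ := hW y hy
  refine ⟨(f.submoduleMap W).rTensor A z, ?_⟩
  rw [hf.coact_apply, ← hz, ← LinearMap.comp_apply, ← LinearMap.comp_apply, ← LinearMap.rTensor_comp,
    ← LinearMap.rTensor_comp]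
  rfl

end Isotypic

section Decomposition

/-- The projections that belong to an internal direct sum. -/
theorem exists_projection_of_isInternal {k : Type*} [Field k] {M : Type*} [AddCommGroup M]
    [Module k M] {n : ℕ} {Vi : Fin n → Submodule k M} (h : DirectSum.IsInternal Vi) :
    ∃ p : Fin n → M →ₗ[k] M, (∀ i v, p i v ∈ Vi i) ∧ (∀ v, ∑ i, p i v = v) ∧
      (∀ i, ∀ v ∈ Vi i, p i v = v) ∧ ∀ i l, l ≠ i → ∀ v ∈ Vi l, p i v = 0 := by
  let e := LinearEquiv.ofBijective (DirectSum.coeLinearMap Vi) h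
  have he : ∀ l (v : Vi l), e.symm (v : M) = DirectSum.lof k (Fin n) (fun i => Vi i) l v := by
    intro l v
    rw [LinearEquiv.symm_apply_eq]
    exact (DirectSum.coeLinearMap_lof Vi l v).symm
  have hsum : ∑ i, (Vi i).subtype ∘ₗ DirectSum.component k (Fin n) (fun i => Vi i) i =
      DirectSum.coeLinearMap Vi := by
    refine DirectSum.linearMap_ext k fun l => LinearMap.ext fun v => ?_
    simp only [LinearMap.comp_apply, LinearMap.sum_apply]
    rw [Finset.sum_eq_single l]
    · simp
    · intro i _ hi
      simp [DirectSum.component.of, hi.symm]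
    · simp
  refine ⟨fun i => (Vi i).subtype ∘ₗ DirectSum.component k (Fin n) (fun i => Vi i) i ∘ₗ
    e.symm.toLinearMap, fun i v => Subtype.coe_prop _, fun v => ?_, fun i v hv => ?_,
    fun i l hl v hv => ?_⟩
  · conv_rhs => rw [← e.apply_symm_apply v]
    change _ = DirectSum.coeLinearMap Vi (e.symm v)
    rw [← hsum]
    simp [LinearMap.sum_apply]
  · have := he i ⟨v, hv⟩
    simp only at this
    simp [this, DirectSum.component.lof_self]
  · have := he l ⟨v, hv⟩
    simp only at this
    simp [this, DirectSum.component.of, hl]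

variable {k : Type u} [Field k] {A : Type w} [CommRing A] [HopfAlgebra k A]
  {M : Type v} [AddCommGroup M] [Module k M] {ρ : AlgRep k A M}

/-- A stable subspace lies in a sum of isotypic components that every linear form on the coordinate
ring which annihilates the subspace annihilates as well. -/
theorem IsIsotypicDecomposition.exists_le_iSup {n : ℕ} {Vi : Fin n → Submodule k M}
    (hV : ρ.IsIsotypicDecomposition Vi) {W : Submodule k M} (hW : ρ.IsStable W) :
    ∃ I : Finset (Fin n), W ≤ ⨆ i ∈ I, Vi i ∧ ∀ D : A →ₗ[k] k, (∀ m ∈ W, ρ.contract D m = 0) →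
      ∀ m ∈ ⨆ i ∈ I, Vi i, ρ.contract D m = 0 := by
  classical
  obtain ⟨hint, -, -, N, _, _, τ, hirr, -, hiso⟩ := hV
  choose m e he hrange heq using hiso
  obtain ⟨p, hpmem, hpsum, hpself, hpother⟩ := exists_projection_of_isInternal hint
  have hr : ∀ i, ∃ r : M →ₗ[k] (Fin (m i) → N i), r ∘ₗ e i = LinearMap.id := fun i =>
    (e i).exists_leftInverse_of_injective (LinearMap.ker_eq_bot.mpr (he i))
  choose r hr using hr
  have hr' : ∀ i y, r i (e i y) = y := fun i y => LinearMap.congr_fun (hr i) y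
  have hesum : ∀ i y, e i y = ∑ j, (e i ∘ₗ LinearMap.single k (fun _ => N i) j) (y j) := by
    intro i y
    conv_lhs => rw [← LinearMap.sum_single_apply (fun _ => N i) y, map_sum]
    rfl
  -- The projection of `M` onto the `j`-th copy of `N i`. It is equivariant because on each copy
  -- inside each component it is the identity or zero.
  let q : ∀ i, Fin (m i) → M →ₗ[k] N i := fun i j => LinearMap.proj j ∘ₗ r i ∘ₗ p i
  have hq : ∀ i j, IsEquivariant ρ (τ i) (q i j) := by
    intro i j
    have h1 : ∀ l, ∀ v ∈ Vi l, (q i j).rTensor A (ρ.coact v) = (τ i).coact (q i j v) := by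
      intro l v hv
      rw [← hrange l] at hv
      obtain ⟨y, rfl⟩ := hv
      rw [hesum, map_sum, map_sum, map_sum, map_sum]
      refine Finset.sum_congr rfl fun j' _ => ?_
      rw [(heq l j').coact_apply, ← LinearMap.comp_apply, ← LinearMap.rTensor_comp,
        ← LinearMap.comp_apply (q i j)]
      have hmem : ∀ z, e l z ∈ Vi l := fun z => hrange l ▸ ⟨z, rfl⟩
      by_cases hl : l = i
      · subst hl
        by_cases hj : j' = j
        · subst hj
          have : q l j' ∘ₗ e l ∘ₗ LinearMap.single k (fun _ => N l) j' = LinearMap.id := by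
            ext z
            simp [q, hpself l _ (hmem _), hr']
          rw [this]
          simp
        · have : q l j ∘ₗ e l ∘ₗ LinearMap.single k (fun _ => N l) j' = 0 := by
            ext z
            simp [q, hpself l _ (hmem _), hr', Ne.symm hj]
          rw [this]
          simp
      · have : q i j ∘ₗ e l ∘ₗ LinearMap.single k (fun _ => N l) j' = 0 := by
          ext z
          simp [q, hpother i l hl _ (hmem _)]
        rw [this]
        simp
    refine LinearMap.ext fun v => ?_
    rw [LinearMap.comp_apply, LinearMap.comp_apply, ← hpsum v]
    simp only [map_sum]
    exact Finset.sum_congr rfl fun l _ => h1 l _ (hpmem l v)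
  let I : Finset (Fin n) := Finset.univ.filter fun i => ∀ D : A →ₗ[k] k,
    (∀ m ∈ W, ρ.contract D m = 0) → ∀ m ∈ Vi i, ρ.contract D m = 0
  -- If `W` projects nontrivially to `Vi i`, some `q i j` maps it onto the irreducible `N i`. A form
  -- that kills `W` then kills `N i`, hence every copy of `N i` in `Vi i`, so `i ∈ I`.
  have hI : ∀ i, i ∉ I → ∀ w ∈ W, p i w = 0 := by
    intro i hi w hw
    by_contra hne
    apply hi
    have hy : ∃ y, e i y = p i w := by
      have := hpmem i w
      rwa [← hrange i] at this
    obtain ⟨y, hy⟩ := hy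
    have hy0 : y ≠ 0 := by
      rintro rfl
      exact hne (by rw [← hy, map_zero])
    obtain ⟨j, hj⟩ := Function.ne_iff.mp hy0
    have hqw : q i j w ≠ 0 := by
      have : q i j w = y j := by simp [q, ← hy, hr']
      rwa [this]
    have htop : W.map (q i j) = ⊤ := by
      refine ((hirr i).2 _ (hW.map (hq i j))).resolve_left fun hbot => hqw ?_
      have := Submodule.mem_map_of_mem (f := q i j) hw
      rwa [hbot, Submodule.mem_bot] at this
    rw [Finset.mem_filter]
    refine ⟨Finset.mem_univ _, fun D hD v hv => ?_⟩
    rw [← hrange i] at hv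
    obtain ⟨z, rfl⟩ := hv
    rw [hesum, map_sum]
    refine Finset.sum_eq_zero fun j' _ => ?_
    have hz : z j' ∈ W.map (q i j) := htop ▸ Submodule.mem_top
    obtain ⟨w', hw', hz'⟩ := hz
    rw [(heq i j').contract_apply, ← hz', (hq i j).contract_apply, hD w' hw', map_zero, map_zero]
  refine ⟨I, fun w hw => ?_, fun D hD v hv => ?_⟩
  · rw [← hpsum w]
    refine Submodule.sum_mem _ fun i _ => ?_
    by_cases hi : i ∈ I
    · exact Submodule.mem_iSup_of_mem i (Submodule.mem_iSup_of_mem hi (hpmem i w))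
    · rw [hI i hi w hw]
      exact Submodule.zero_mem _
  · have hle : ⨆ i ∈ I, Vi i ≤ LinearMap.ker (ρ.contract D) :=
      iSup₂_le fun i hi v hv => (Finset.mem_filter.mp hi).2 D hD v hv
    exact hle hv

end Decomposition

end AlgRep

theorem ciInf_eq_of_forall_ge_of_le {ι : Type*} {f : ι → ℝ} {s : ℝ} (h : ∀ i, s ≤ f i) (i : ι)
    (hi : f i ≤ s) : ⨅ i, f i = s := by
  have : Nonempty ι := ⟨i⟩
  exact le_antisymm (ciInf_le_of_le ⟨s, by rintro _ ⟨i, rfl⟩; exact h i⟩ i hi) (le_ciInf h)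

/-! ### Comparison of group slopes and Lie slopes over all extensions. -/

namespace AlgRep

section Slope

open Module

variable {k : Type*} [Field k] {A : Type*} [CommRing A] [HopfAlgebra k A]
  {M : Type*} [AddCommGroup M] [Module k M] {ι : Type*} [Fintype ι]

variable (ρ : AlgRep k A M) (b : Basis ι k M) {n : ℕ} {x : Fin n → A} {D : Fin n → A →ₗ[k] k}
  (hx : IsCoordinateSystem x D)

include hx

/-- Smoothness of `G` gives `dim G = dim 𝔤`, while `dim G_W ≤ dim 𝔤_W` always. The left side is the
Lie slope in coordinates. -/
theorem le_slope [Algebra.Smooth k A] (W : Submodule k M) :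
    ((n : ℝ) - finrank k (annCoeff (K := k) (ρ.tangentMatrix b D) (W.map b.equivFun.toLinearMap))) /
      finrank k W ≤ ρ.slope W := by
  rw [slope, affineDim_eq_finrank_tangentSpace (k := k) (A := A), hx.finrank_eq]
  have h := ρ.affineDim_fixIdeal_le b hx W
  gcongr

theorem slope_eq [Algebra.Smooth k A] (W : Submodule k M)
    [Algebra.Smooth k (A ⧸ ρ.fixIdeal W)] : ρ.slope W =
    ((n : ℝ) - finrank k (annCoeff (K := k) (ρ.tangentMatrix b D) (W.map b.equivFun.toLinearMap))) /
      finrank k W := by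
  rw [slope, affineDim_eq_finrank_tangentSpace (k := k) (A := A), hx.finrank_eq,
    ρ.affineDim_fixIdeal_eq b hx W]

theorem IsClosedEmbedding.lieSlope_eq {ρ : AlgRep k A M} (hρ : ρ.IsClosedEmbedding)
    (W : Submodule k M) : lieSlope ρ.lieAlgebra W =
    ((n : ℝ) - finrank k (annCoeff (K := k) (ρ.tangentMatrix b D) (W.map b.equivFun.toLinearMap))) /
      finrank k W := by
  have : Module.Finite k M := Module.Finite.of_basis b
  rw [lieSlope, hρ.finrank_lieAlgebra hx, hρ.finrank_lieFix b hx]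

end Slope

section MinimalSlope

open Module

variable {F : Type*} [Field F] {ι : Type*} [Fintype ι] {n : ℕ}

/-- Specialization to `Ω` keeps `dim W` and cannot shrink the annihilator, so it cannot raise the
slope. Minimality over the single field `Ω` thus controls every extension `L`. -/
theorem slope_le_slope_of_specialization (Ω : Type*) [Field Ω] [Algebra F Ω] [IsAlgClosed Ω]
    {X : Fin n → Matrix ι ι F} {W₀ : Submodule F (ι → F)} (hW₀ : W₀ ≠ ⊥)
    (hmin : ∀ W : Submodule Ω (ι → Ω), W ≠ ⊥ →
      ((Fintype.card (Fin n) : ℤ) - finrank F (annCoeff (K := F) X W₀)) * finrank Ω W ≤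
        ((Fintype.card (Fin n) : ℤ) - finrank Ω (annCoeff X W)) * finrank F W₀)
    {L : Type*} [Field L] [Algebra F L] (W : Submodule L (ι → L)) (hW : W ≠ ⊥) :
    ((n : ℝ) - finrank F (annCoeff (K := F) X W₀)) / finrank F W₀ ≤
      ((n : ℝ) - finrank L (annCoeff X W)) / finrank L W := by
  obtain ⟨W', hW', hle⟩ := exists_specialization Ω X W
  have hpos : 0 < finrank L W := by
    rw [finrank_pos_iff]; exact Submodule.nontrivial_iff_ne_bot.mpr hW
  have hpos₀ : 0 < finrank F W₀ := by
    rw [finrank_pos_iff]; exact Submodule.nontrivial_iff_ne_bot.mpr hW₀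
  have h := hmin W' (by
    rintro rfl
    rw [finrank_bot] at hW'
    omega)
  rw [Fintype.card_fin, hW'] at h
  have h1 : ((n : ℝ) - finrank F (annCoeff (K := F) X W₀)) * finrank L W ≤
      ((n : ℝ) - finrank Ω (annCoeff X W')) * finrank F W₀ := by exact_mod_cast h
  have h2 : (finrank L (annCoeff X W) : ℝ) ≤ finrank Ω (annCoeff X W') := by exact_mod_cast hle
  rw [div_le_div_iff₀ (by exact_mod_cast hpos₀) (by exact_mod_cast hpos)]
  refine h1.trans ?_
  gcongr

end MinimalSlope

/-! ### A minimizing sum of isotypic components, and the theorem. -/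

section Main

open Module

variable {F : Type u} [Field F] [PerfectField F] {A : Type w} [CommRing A] [HopfAlgebra F A]
  {V : Type v} [AddCommGroup V] [Module F V] [FiniteDimensional F V] [Nontrivial V]

/-- There is a sum of isotypic components whose slope bounds the slopes of all subspaces over all
field extensions. -/
theorem exists_isotypic_minimal_slope [Algebra.Smooth F A] {ρ : AlgRep F A V}
    (hρ : ρ.IsClosedEmbedding) {n : ℕ} {Vi : Fin n → Submodule F V}
    (hV : ρ.IsIsotypicDecomposition Vi) {ι : Type*} [Fintype ι] (b : Basis ι F V) {d : ℕ}
    {x : Fin d → A} {D : Fin d → A →ₗ[F] F} (hx : IsCoordinateSystem x D) :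
    ∃ I : Finset (Fin n), I.Nonempty ∧ (⨆ i ∈ I, Vi i) ≠ ⊥ ∧
      ∀ W : Submodule (AlgebraicClosure F) (ι → AlgebraicClosure F), W ≠ ⊥ →
        ((Fintype.card (Fin d) : ℤ) - finrank F (annCoeff (K := F) (ρ.tangentMatrix b D)
          ((⨆ i ∈ I, Vi i).map b.equivFun.toLinearMap))) * finrank (AlgebraicClosure F) W ≤
        ((Fintype.card (Fin d) : ℤ) -
            finrank (AlgebraicClosure F) (annCoeff (ρ.tangentMatrix b D) W)) *
          finrank F ((⨆ i ∈ I, Vi i).map b.equivFun.toLinearMap) := by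
  classical
  let Ω := AlgebraicClosure F
  -- Perfectness of `F` makes its algebraic closure separable, so Galois descent applies.
  have : IsGalois F Ω := {}
  have : Nonempty ι := b.index_nonempty
  obtain ⟨W₀, hW₀, hstab, hmin⟩ :=
    exists_stable_of_minimal_slope Ω (hρ.linearIndependent_tangentMatrix b hx)
  set U : Submodule F V := W₀.comap b.equivFun.toLinearMap with hU
  have hUmap : U.map b.equivFun.toLinearMap = W₀ :=
    Submodule.map_comap_eq_of_surjective b.equivFun.surjective _
  have hUst : ρ.IsStable U := by
    refine ρ.isStable_of_forall_point b Ω U fun g w hw => ?_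
    rw [hUmap] at hw ⊢
    exact hstab _ _ (ρ.coeffMatrix_map_antipode_mul b g)
      (fun l => ρ.conj_tangentMatrix_mem b hx g l) w hw
  obtain ⟨I, hle, hkill⟩ := hV.exists_le_iSup hUst
  have hU0 : U ≠ ⊥ := by
    intro h
    rw [h, Submodule.map_bot] at hUmap
    exact hW₀ hUmap.symm
  have hI0 : (⨆ i ∈ I, Vi i) ≠ ⊥ := fun h => hU0 (le_bot_iff.mp (h ▸ hle))
  refine ⟨I, ?_, hI0, fun W hW => ?_⟩
  · rw [Finset.nonempty_iff_ne_empty]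
    rintro rfl
    simp at hI0
  -- Replacing `U` by the larger sum loses nothing from the annihilator and does not lower the
  -- dimension, so the slope stays minimal.
  · have hann : annCoeff (K := F) (ρ.tangentMatrix b D) W₀ ≤ annCoeff (K := F) (ρ.tangentMatrix b D)
        ((⨆ i ∈ I, Vi i).map b.equivFun.toLinearMap) := by
      intro t ht
      rw [← hUmap, mem_annCoeff_tangentMatrix] at ht
      rw [mem_annCoeff_tangentMatrix]
      exact hkill _ ht
    have h1 := Submodule.finrank_mono hann
    have h2 : finrank F W₀ ≤ finrank F ((⨆ i ∈ I, Vi i).map b.equivFun.toLinearMap) := by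
      conv_lhs => rw [← hUmap]
      exact Submodule.finrank_mono (Submodule.map_mono hle)
    have h3 : (0 : ℤ) ≤ (Fintype.card (Fin d) : ℤ) -
        finrank (AlgebraicClosure F) (annCoeff (ρ.tangentMatrix b D) W) := by
      rw [sub_nonneg, ← Module.finrank_fintype_fun_eq_card (AlgebraicClosure F)]
      exact_mod_cast Submodule.finrank_le (annCoeff (ρ.tangentMatrix b D) W)
    calc _ ≤ _ := mul_le_mul_of_nonneg_right (sub_le_sub_left (by exact_mod_cast h1) _) (by positivity)
      _ ≤ _ := hmin W hW
      _ ≤ _ := mul_le_mul_of_nonneg_left (by exact_mod_cast h2) h3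

end Main

end AlgRep

theorem propositionP {F : Type u} [Field F] [PerfectField F]
    {A : Type w} [CommRing A] [HopfAlgebra F A]
    {V : Type v} [AddCommGroup V] [Module F V] [FiniteDimensional F V] [Nontrivial V]
    (ρ : AlgRep F A V) (hρ : ρ.IsClosedEmbedding) (hred : ρ.IsReductive)
    {n : ℕ} (Vi : Fin n → Submodule F V) (hV : ρ.IsIsotypicDecomposition Vi) :
    (CharZero F → ∀ I : Finset (Fin n), I.Nonempty →
      Algebra.Smooth F (A ⧸ ρ.fixIdeal (⨆ i ∈ I, Vi i))) ∧
    ((∀ I : Finset (Fin n), I.Nonempty →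
        Algebra.Smooth F (A ⧸ ρ.fixIdeal (⨆ i ∈ I, Vi i))) →
      ρ.alpha = lieAlpha ρ.lieAlgebra ∧
      IsLeast {r : ℝ | ∃ I : Finset (Fin n), I.Nonempty ∧ r = ρ.slope (⨆ i ∈ I, Vi i)} ρ.alpha ∧
      ∀ (L : Type t) [Field L] [Algebra F L], (ρ.baseChange L).alpha = ρ.alpha) := by
  have hsm : Algebra.Smooth F A := hred.1
  let b := Module.finBasis F V
  refine ⟨fun _ I _ => ?_, fun hI => ?_⟩
  · have := ρ.isHopfIdeal_fixIdeal b (⨆ i ∈ I, Vi i)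
    exact smooth_of_charZero
  obtain ⟨x, D, hx⟩ := exists_isCoordinateSystem (k := F) (A := A)
  obtain ⟨I, hIne, hI0, hmin⟩ := AlgRep.exists_isotypic_minimal_slope hρ hV b hx
  set U : Submodule F V := ⨆ i ∈ I, Vi i with hU
  have := hI I hIne
  have hmap0 : ∀ {L : Type t} [Field L] [Algebra F L] (W : Submodule L (L ⊗[F] V)), W ≠ ⊥ →
      W.map (b.baseChange L).equivFun.toLinearMap ≠ ⊥ := fun W hW h =>
    hW (Submodule.map_eq_bot_iff.mp h)
  have hmap0' : ∀ W : Submodule F V, W ≠ ⊥ → W.map b.equivFun.toLinearMap ≠ ⊥ := fun W hW h =>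
    hW (Submodule.map_eq_bot_iff.mp h)
  have hfin : ∀ W : Submodule F V, Module.finrank F (W.map b.equivFun.toLinearMap) = Module.finrank F W :=
    fun W => LinearEquiv.finrank_map_eq b.equivFun W
  have hslope := ρ.slope_eq b hx U
  have hlie := fun W => hρ.lieSlope_eq b hx W
  -- The case `L = F` of the comparison; smoothness of `G_U` makes the group slope of `U` equal to
  -- its Lie slope.
  have hle : ∀ W : Submodule F V, W ≠ ⊥ → ρ.slope U ≤ lieSlope ρ.lieAlgebra W := by
    intro W hW
    have h := AlgRep.slope_le_slope_of_specialization _ (hmap0' U hI0) hmin _ (hmap0' W hW)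
    rwa [hfin, hfin, ← hslope, ← hlie] at h
  have hle' : ∀ W : Submodule F V, W ≠ ⊥ → ρ.slope U ≤ ρ.slope W := fun W hW =>
    (hle W hW).trans ((hlie W).trans_le (ρ.le_slope b hx W))
  have halpha : ρ.alpha = ρ.slope U :=
    ciInf_eq_of_forall_ge_of_le (fun W => hle' W.1 W.2) ⟨U, hI0⟩ le_rfl
  have hlieAlpha : lieAlpha ρ.lieAlgebra = ρ.slope U :=
    ciInf_eq_of_forall_ge_of_le (fun W => hle W.1 W.2) ⟨U, hI0⟩ ((hlie U).trans hslope.symm).le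
  refine ⟨halpha.trans hlieAlpha.symm, ⟨⟨I, hIne, halpha⟩, ?_⟩, fun L _ _ => ?_⟩
  · rintro _ ⟨J, hJ, rfl⟩
    rw [halpha]
    refine hle' _ fun h => ?_
    obtain ⟨i, hi⟩ := hJ
    exact hV.2.1 i (le_bot_iff.mp (h ▸ le_iSup₂_of_le i hi le_rfl))
  · have hxL := hx.baseChange L
    have hX : (ρ.baseChange L).tangentMatrix (b.baseChange L) (fun l => extendForm L (D l)) =
        fun l => (ρ.tangentMatrix b D l).map (algebraMap F L) :=
      funext fun l => ρ.tangentMatrix_baseChange b L D l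
    -- Smoothness of the stabilizer survives base change, and the annihilator and `U` keep their
    -- dimensions, so `L ⊗ U` attains the same value over `L`.
    have hUL : (ρ.baseChange L).slope (U.baseChange L) = ρ.slope U := by
      have := ρ.smooth_fixIdeal_baseChange b L U
      rw [hslope, (ρ.baseChange L).slope_eq (b.baseChange L) hxL, hX, AlgRep.annCoeff_map_algebraMap,
        AlgRep.map_equivFun_baseChange, finrank_annCoeff_extendScalars,
        ← LinearEquiv.finrank_map_eq (b.baseChange L).equivFun (U.baseChange L),
        AlgRep.map_equivFun_baseChange, finrank_extendScalars, hfin]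
    rw [halpha]
    refine ciInf_eq_of_forall_ge_of_le (fun W => ?_) ⟨U.baseChange L, fun h => ?_⟩ hUL.le
    · refine le_trans ?_ ((ρ.baseChange L).le_slope (b.baseChange L) hxL W.1)
      rw [hX, AlgRep.annCoeff_map_algebraMap]
      have h := AlgRep.slope_le_slope_of_specialization _ (hmap0' U hI0) hmin _ (hmap0 W.1 W.2)
      rwa [hfin, ← hslope, LinearEquiv.finrank_map_eq (b.baseChange L).equivFun W.1] at h
    · have h1 := AlgRep.map_equivFun_baseChange b L U
      rw [h, Submodule.map_bot] at h1
      have h2 := finrank_extendScalars L (U.map b.equivFun.toLinearMap)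
      rw [← h1, finrank_bot, hfin] at h2
      exact hI0 (Submodule.finrank_eq_zero.mp h2.symm)

end
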